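/- The following is provable in $\mathsf{ATR_0^{set}}$ (equivalently, it holds in every model of this theory). Let $\lambda$ be a limit ordinal, let $(D_\alpha)_{\alpha<\lambda}$ be a family of dilators (given as a set), and let $\gamma$ be an ordinal. If $(\sum_{\alpha<\mu}D_\alpha)^\gamma$ has a $\psi$-fixed point for every $\mu<\lambda$, then the supremum of these $\psi$-fixed points exists and is the (unique) $\psi$-fixed point of $(\sum_{\alpha<\lambda}D_\alpha)^\gamma$, i.e. $$\psi\Big(\sum_{\alpha<\lambda}D_\alpha\Big)^\gamma=\sup_{\mu<\lambda}\psi\Big(\sum_{\alpha<\mu}D_\alpha\Big)^\gamma .$$ Here the notions are as follows. * $\mathsf{ATR_0^{set}}$ has the language with $\in$, $=$ and a function symbol for each construction of a primitive recursive set function (with $\omega$ as an additional constant). Its axioms are the defining axioms of these symbols, extensionality, foundation (every non-empty set has an $\in$-minimal element), infinity, axiom beta (for every well-founded relation $r$ there is a function $f$ on the field of $r$ with $f(y)=\{f(x)\mid(x,y)\in r\}$), and countability (every set admits an injection into $\omega$). * A predilator is a functor $D$ from the category of the finite orders $n=\{0,\dots,n-1\}$ and strictly increasing maps to the category of linear orders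 and embeddings, which is monotone ($f\le g$ pointwise implies $D(f)\le D(g)$ pointwise), together with a natural transformation $\operatorname{supp}_n:D(n)\to[n]^{<\omega}$ such that, for every $f:m\to n$ and $\sigma\in D(n)$, $\operatorname{supp}_n(\sigma)\subseteq\operatorname{rng}(f)$ implies $\sigma\in\operatorname{rng}(D(f))$. * A predilator extends to all linear orders $X$: the elements of $D(X)$ are the pairs $(\sigma,a)$ with $a\subseteq X$ finite, $\sigma\in D(|a|)$ and $\operatorname{supp}_{|a|}(\sigma)=|a|$. We have $(\sigma,a)<(\tau,b)$ iff $D(f)(\sigma)<D(g)(\tau)$ in $D(|a\cup b|)$, where $f:|a|\to|a\cup b|$ and $g:|b|\to|a\cup b|$ correspond to the inclusions of $a$ and $b$ into $a\cup b$. The action on an embedding $h$ is $(\sigma,a)\mapsto(\sigma,h[a])$, and the support of $(\sigma,a)$ is $a$. A dilator is a predilator $D$ such that $D(X)$ is well-founded for every well order $X$. * The sum $\sum_{\alpha<\mu}D_\alpha$ has as elements at $n$ the pairs $(\alpha,\sigma)$ with $\alpha<\mu$ and $\sigma\in D_\alpha(n)$, ordered lexicographically (first by $\alpha$), with $(\alpha,\sigma)\mapsto(\alpha,D_\alpha(f)(\sigma))$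 as action on $f$ and with the support of $\sigma$ as support of $(\alpha,\sigma)$. * $D^\gamma$ is given by $D^\gamma(n)=D(\gamma+n)$ and $D^\gamma(f)=D(\gamma+f)$, where the support of $(\sigma,a)\in D(\gamma+n)$ is $\{i<n\mid\gamma+i\in a\}$. * An ordinal $\Omega$ is a $\psi$-fixed point of a predilator $D$ if there is an order embedding $\pi:\Omega\to D(\Omega)$ such that for all $\alpha,\beta<\Omega$ and $\tau\in D(\Omega)$: if $\alpha\in\operatorname{supp}_\Omega(\pi(\beta))$ then $\alpha<\beta$; and if $\pi(\alpha)<\tau$ for all $\alpha\in\operatorname{supp}_\Omega(\tau)$, then $\tau\in\operatorname{rng}(\pi)$. A dilator $D$ has at most one $\psi$-fixed point; it is denoted by $\psi D$ if it exists. -/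

import Mathlib

universe u

namespace ATRSet

/-- Function symbols for the primitive recursive set functions (with parameter `ω`), one for each
construction of such a function; `PRFun n` contains the symbols of arity `n`. -/
inductive PRFun : ℕ → Type
  /-- `x ↦ 0` -/
  | zero : PRFun 1
  /-- `(x₀, …, xₙ₋₁) ↦ xᵢ` -/
  | proj {n : ℕ} (i : Fin n) : PRFun n
  /-- `(x₀, x₁) ↦ x₀ ∪ {x₁}` -/
  | adjoin : PRFun 2
  /-- `(x₀, x₁, x₂, x₃) ↦ x₀` if `x₂ ∈ x₃`, and `x₁` otherwise -/
  | cond : PRFun 4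
  /-- the constant `ω` -/
  | omega : PRFun 0
  /-- `x ↦ F (G₀ x, …, Gₘ₋₁ x)` -/
  | comp {m n : ℕ} (F : PRFun m) (G : Fin m → PRFun n) : PRFun n
  /-- `R (x, y) = H (⋃ {R (v, y) | v ∈ x}, x, y)` -/
  | recursion {n : ℕ} (H : PRFun (n + 2)) : PRFun (n + 1)

/-- Structures for the language with a binary relation symbol `∈` and the function symbols
`PRFun`. -/
class SetStructure (M : Type u) where
  mem : M → M → Prop
  fn : ∀ {n : ℕ}, PRFun n → (Fin n → M) → M

infix:50 " ∈ᴹ " => SetStructure.mem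

section

variable {M : Type u} [SetStructure M]

/-! ### Terms and basic set theoretic notions inside a structure -/

/-- The set `ω`. -/
def om : M := SetStructure.fn PRFun.omega ![]

/-- The empty set. -/
def empty : M := SetStructure.fn PRFun.zero ![om]

/-- `x ∪ {y}` -/
def adj (x y : M) : M := SetStructure.fn PRFun.adjoin ![x, y]

/-- `{x, y}` -/
def upair (x y : M) : M := adj (adj empty x) y

/-- The ordered pair `⟨x, y⟩ = {{x}, {x, y}}`. -/
def pair (x y : M) : M := upair (upair x x) (upair x y)

open Classical in
/-- The value `f(x)` of a function `f` (a set of ordered pairs); the empty set if there is no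
unique value. -/
noncomputable def app (f x : M) : M :=
  if h : ∃! y, pair x y ∈ᴹ f then h.choose else empty

/-- `f` is (the graph of) a function with domain `A`. -/
def IsFunOn (f A : M) : Prop :=
  (∀ p, p ∈ᴹ f → ∃ x y, x ∈ᴹ A ∧ p = pair x y) ∧ ∀ x, x ∈ᴹ A → ∃! y, pair x y ∈ᴹ f

/-- The relation `r` (a set of ordered pairs) is well-founded: any non-empty set has an
`r`-minimal element. -/
def WFRel (r : M) : Prop :=
  ∀ s, (∃ x, x ∈ᴹ s) → ∃ y, y ∈ᴹ s ∧ ∀ x, x ∈ᴹ s → ¬ pair x y ∈ᴹ r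

end

/-! ### The theory -/

/-- `M` is a model of `ATR₀^set`, that is, of primitive recursive set theory with infinity
(defining axioms for all function symbols, extensionality, foundation, infinity), axiom beta, and
the axiom of countability. -/
structure ModelsATR0Set (M : Type u) [SetStructure M] : Prop where
  fn_zero : ∀ (v : Fin 1 → M) (z : M), ¬ z ∈ᴹ SetStructure.fn PRFun.zero v
  fn_proj : ∀ {n : ℕ} (i : Fin n) (v : Fin n → M), SetStructure.fn (PRFun.proj i) v = v i
  fn_adjoin : ∀ (v : Fin 2 → M) (z : M),
    z ∈ᴹ SetStructure.fn PRFun.adjoin v ↔ z ∈ᴹ v 0 ∨ z = v 1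
  fn_cond_pos : ∀ v : Fin 4 → M, v 2 ∈ᴹ v 3 → SetStructure.fn PRFun.cond v = v 0
  fn_cond_neg : ∀ v : Fin 4 → M, ¬ v 2 ∈ᴹ v 3 → SetStructure.fn PRFun.cond v = v 1
  fn_comp : ∀ {m n : ℕ} (F : PRFun m) (G : Fin m → PRFun n) (v : Fin n → M),
    SetStructure.fn (PRFun.comp F G) v
      = SetStructure.fn F (fun i => SetStructure.fn (G i) v)
  fn_recursion : ∀ {n : ℕ} (H : PRFun (n + 2)) (x : M) (y : Fin n → M), ∃ w : M,
    (∀ z, z ∈ᴹ w ↔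
      ∃ v, v ∈ᴹ x ∧ z ∈ᴹ SetStructure.fn (PRFun.recursion H) (Fin.cons v y : Fin (n + 1) → M)) ∧
    SetStructure.fn (PRFun.recursion H) (Fin.cons x y : Fin (n + 1) → M)
      = SetStructure.fn H (Fin.cons w (Fin.cons x y : Fin (n + 1) → M) : Fin (n + 2) → M)
  extensionality : ∀ x y : M, (∀ z, z ∈ᴹ x ↔ z ∈ᴹ y) → x = y
  foundation : ∀ x : M, (∃ y, y ∈ᴹ x) → ∃ y, y ∈ᴹ x ∧ ∀ z, z ∈ᴹ x → ¬ z ∈ᴹ y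
  infinity : ∀ n : M, n ∈ᴹ om ↔ n = empty ∨ ∃ m, m ∈ᴹ om ∧ n = adj m m
  beta : ∀ r : M, WFRel r → ∃ A f : M,
    (∀ x, x ∈ᴹ A ↔ ∃ y, pair x y ∈ᴹ r ∨ pair y x ∈ᴹ r) ∧ IsFunOn f A ∧
    ∀ y, y ∈ᴹ A → ∀ z, z ∈ᴹ app f y ↔ ∃ x, pair x y ∈ᴹ r ∧ z = app f x
  countability : ∀ x : M, ∃ g : M, IsFunOn g x ∧ (∀ y, y ∈ᴹ x → app g y ∈ᴹ om) ∧
    ∀ y z, y ∈ᴹ x → z ∈ᴹ x → app g y = app g z → y = z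

section

variable {M : Type u} [SetStructure M]

/-! ### Ordinals -/

/-- `x` is a transitive set. -/
def IsTransSet (x : M) : Prop := ∀ y, y ∈ᴹ x → ∀ z, z ∈ᴹ y → z ∈ᴹ x

/-- `x` is an ordinal: a transitive set of transitive sets. -/
def IsOrd (x : M) : Prop := IsTransSet x ∧ ∀ y, y ∈ᴹ x → IsTransSet y

/-- `x` is a limit ordinal (in particular, `x` is not zero). -/
def IsLimitOrd (x : M) : Prop :=
  IsOrd x ∧ (∃ y, y ∈ᴹ x) ∧ ∀ y, y ∈ᴹ x → ∃ z, z ∈ᴹ x ∧ y ∈ᴹ z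

/-- `α ≤ β` for ordinals. -/
def OrdLe (α β : M) : Prop := α ∈ᴹ β ∨ α = β

/-- The ordinal `Ω` is the supremum of the class `C` of ordinals. -/
def IsOrdSup (C : M → Prop) (Ω : M) : Prop :=
  IsOrd Ω ∧ (∀ β, C β → OrdLe β Ω) ∧ ∀ Ω', IsOrd Ω' → (∀ β, C β → OrdLe β Ω') → OrdLe Ω Ω'

/-! ### Orders -/

end

/-- The data of a (strict) order, given by definable classes of elements of `M`. -/
structure ClassOrder (M : Type u) where
  mem : M → Prop
  lt : M → M → Prop

section

variable {M : Type u} [SetStructure M]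

/-- A set `X` with order relation `R` (a set of ordered pairs). -/
def setOrder (X R : M) : ClassOrder M where
  mem x := x ∈ᴹ X
  lt x y := pair x y ∈ᴹ R

/-- An ordinal as an order. In particular this covers `n = {0, …, n - 1}` for `n ∈ ω`. -/
def ordOrder (α : M) : ClassOrder M where
  mem x := x ∈ᴹ α
  lt x y := x ∈ᴹ y

/-- The order sum `X + Y`. An element `x` of the left summand is represented by `⟨0, x⟩`, and the
element `X + y` for `y` in `Y` by `⟨1, y⟩` with `1 = {0}`. -/
def ClassOrder.add (X Y : ClassOrder M) : ClassOrder M where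
  mem z := (∃ x, X.mem x ∧ z = pair empty x) ∨ (∃ y, Y.mem y ∧ z = pair (adj empty empty) y)
  lt z w :=
    (∃ x x', z = pair empty x ∧ w = pair empty x' ∧ X.lt x x') ∨
    (∃ x y, z = pair empty x ∧ w = pair (adj empty empty) y) ∨
    (∃ y y', z = pair (adj empty empty) y ∧ w = pair (adj empty empty) y' ∧ Y.lt y y')

/-- `X` is a (strict) linear order. -/
def ClassOrder.IsLinear (X : ClassOrder M) : Prop :=
  (∀ x, X.mem x → ¬ X.lt x x) ∧
  (∀ x y z, X.mem x → X.mem y → X.mem z → X.lt x y → X.lt y z → X.lt x z) ∧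
  (∀ x y, X.mem x → X.mem y → X.lt x y ∨ x = y ∨ X.lt y x)

/-- `X` is well-founded in the sense of `M`: any non-empty subset of `X` that is an element of `M`
has a minimal element. -/
def ClassOrder.IsWF (X : ClassOrder M) : Prop :=
  ∀ s : M, (∃ x, x ∈ᴹ s) → (∀ x, x ∈ᴹ s → X.mem x) →
    ∃ y, y ∈ᴹ s ∧ ∀ x, x ∈ᴹ s → ¬ X.lt x y

/-- `a` is a finite subset of `X` with `n ∈ ω` elements, and `e` is the increasing enumeration
`en_a : n → a`. -/
def Enum (X : ClassOrder M) (a n e : M) : Prop :=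
  n ∈ᴹ om ∧ IsFunOn e n ∧
  (∀ x, x ∈ᴹ a → X.mem x) ∧
  (∀ x, x ∈ᴹ a ↔ ∃ i, i ∈ᴹ n ∧ x = app e i) ∧
  ∀ i j, i ∈ᴹ n → j ∈ᴹ n → i ∈ᴹ j → X.lt (app e i) (app e j)

/-- `f : m → n` is a morphism of the category `Nat`, i.e. `m, n ∈ ω` and `f` is strictly
increasing. -/
def NatHom (m n f : M) : Prop :=
  m ∈ᴹ om ∧ n ∈ᴹ om ∧ IsFunOn f m ∧ (∀ i, i ∈ᴹ m → app f i ∈ᴹ n) ∧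
  ∀ i j, i ∈ᴹ m → j ∈ᴹ m → i ∈ᴹ j → app f i ∈ᴹ app f j

/-- For finite `a ⊆ b` in `X` with `|a| = m` and `|b| = n`, the morphism `f : m → n` is
`|ι|` for the inclusion `ι : a → b`, i.e. we have `en_b ∘ f = en_a`. -/
def InclHom (X : ClassOrder M) (a b m n f : M) : Prop :=
  NatHom m n f ∧ ∃ e e', Enum X a m e ∧ Enum X b n e' ∧
    ∀ i, i ∈ᴹ m → app e' (app f i) = app e i

/-! ### Predilators and dilators -/

end

/-- The data of a predilator `D : Nat → LO` with support functions:
* `El n σ` says that `σ` is an element of `D(n)`,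
* `lt n σ τ` says that `σ < τ` holds in `D(n)`,
* `map m n f σ τ` says that `D(f)(σ) = τ` holds for the morphism `f : m → n`,
* `supp n σ i` says that `i` lies in `supp_n(σ)`.
The values matter only for `n ∈ ω`, morphisms `f : m → n` and elements `σ` of `D(n)` or `D(m)`. -/
structure Predil (M : Type u) where
  El : M → M → Prop
  lt : M → M → M → Prop
  map : M → M → M → M → M → Prop
  supp : M → M → M → Prop

section

variable {M : Type u} [SetStructure M]

namespace Predil

/-- The linear order `D(n)`. -/
def ob (D : Predil M) (n : M) : ClassOrder M where
  mem := D.El n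
  lt := D.lt n

/-- `D` is a predilator: a monotone functor from `Nat` to linear orders with a natural
transformation `supp` to finite powersets that validates the support condition. -/
structure IsPredilator (D : Predil M) : Prop where
  linear : ∀ n, n ∈ᴹ om → (D.ob n).IsLinear
  map_fun : ∀ m n f σ, NatHom m n f → D.El m σ → ∃! τ, D.map m n f σ τ
  map_mem : ∀ m n f σ τ, NatHom m n f → D.El m σ → D.map m n f σ τ → D.El n τ
  map_lt : ∀ m n f σ σ' τ τ', NatHom m n f → D.El m σ → D.El m σ' →
    D.map m n f σ τ → D.map m n f σ' τ' → D.lt m σ σ' → D.lt n τ τ'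
  map_id : ∀ n f σ, NatHom n n f → (∀ i, i ∈ᴹ n → app f i = i) → D.El n σ → D.map n n f σ σ
  map_comp : ∀ k m n f g h ρ σ τ, NatHom k m f → NatHom m n g → NatHom k n h →
    (∀ i, i ∈ᴹ k → app h i = app g (app f i)) → D.El k ρ →
    D.map k m f ρ σ → D.map m n g σ τ → D.map k n h ρ τ
  monotone : ∀ m n f g σ τ τ', NatHom m n f → NatHom m n g →
    (∀ i, i ∈ᴹ m → OrdLe (app f i) (app g i)) → D.El m σ →
    D.map m n f σ τ → D.map m n g σ τ' → D.lt n τ τ' ∨ τ = τ'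
  supp_sub : ∀ n σ i, n ∈ᴹ om → D.El n σ → D.supp n σ i → i ∈ᴹ n
  supp_nat : ∀ m n f σ τ, NatHom m n f → D.El m σ → D.map m n f σ τ →
    ∀ j, D.supp n τ j ↔ ∃ i, D.supp m σ i ∧ app f i = j
  supp_cond : ∀ m n f τ, NatHom m n f → D.El n τ →
    (∀ j, D.supp n τ j → ∃ i, i ∈ᴹ m ∧ app f i = j) → ∃ σ, D.El m σ ∧ D.map m n f σ τ

/-- `(σ, n)` lies in the trace of `D`. -/
def Tr (D : Predil M) (σ n : M) : Prop :=
  n ∈ᴹ om ∧ D.El n σ ∧ ∀ i, i ∈ᴹ n → D.supp n σ i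

/-- The extension of `D` to arbitrary linear orders `X`: the elements of `D(X)` are the pairs
`⟨σ, a⟩` for a finite subset `a` of `X` such that `(σ, |a|)` lies in the trace of `D`, and we have
`⟨σ, a⟩ < ⟨τ, b⟩` if `D(|ι_a|)(σ) < D(|ι_b|)(τ)` holds in `D(|c|)` with `c = a ∪ b`, for the
inclusions `ι_a : a → c` and `ι_b : b → c`. -/
def ext (D : Predil M) (X : ClassOrder M) : ClassOrder M where
  mem p := ∃ σ a n e, p = pair σ a ∧ Enum X a n e ∧ D.Tr σ n
  lt p q := ∃ σ a τ b, p = pair σ a ∧ q = pair τ b ∧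
    ∃ c k m n f g σ' τ', (∀ x, x ∈ᴹ c ↔ x ∈ᴹ a ∨ x ∈ᴹ b) ∧
      InclHom X a c k n f ∧ InclHom X b c m n g ∧
      D.map k n f σ σ' ∧ D.map m n g τ τ' ∧ D.lt n σ' τ'

/-- The action of the extended functor on an embedding `F` (given by its graph), which maps
`⟨σ, a⟩` to `⟨σ, F[a]⟩`: here `extMap F p q` says that `q` is the value on `p`. -/
def extMap (F : M → M → Prop) (p q : M) : Prop :=
  ∃ σ a b, p = pair σ a ∧ q = pair σ b ∧ ∀ y, y ∈ᴹ b ↔ ∃ x, x ∈ᴹ a ∧ F x y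

/-- The support `a` of an element `⟨σ, a⟩` of `D(X)`: here `extSupp p x` says that `x` is an
element of the support of `p`. -/
def extSupp (p x : M) : Prop := ∃ σ a, p = pair σ a ∧ x ∈ᴹ a

/-- `D` is a dilator: a predilator such that `D(X)` is well-founded for any well order `X`. -/
def IsDilator (D : Predil M) : Prop :=
  D.IsPredilator ∧ ∀ X R : M, (setOrder X R).IsLinear → (setOrder X R).IsWF →
    (D.ext (setOrder X R)).IsWF

/-- The sum `∑_{α ∈ L} D_α`. -/
def sum (L : ClassOrder M) (D : M → Predil M) : Predil M where
  El n p := ∃ α σ, p = pair α σ ∧ L.mem α ∧ (D α).El n σ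
  lt n p q := ∃ α σ β τ, p = pair α σ ∧ q = pair β τ ∧ L.mem α ∧ L.mem β ∧
    (L.lt α β ∨ (α = β ∧ (D α).lt n σ τ))
  map m n f p q := ∃ α σ τ, p = pair α σ ∧ q = pair α τ ∧ L.mem α ∧ (D α).map m n f σ τ
  supp n p i := ∃ α σ, p = pair α σ ∧ L.mem α ∧ (D α).supp n σ i

/-- The graph of the function `γ + f : γ + m → γ + n` for `f : m → n`. -/
def addMap (γ m f x y : M) : Prop :=
  (∃ z, z ∈ᴹ γ ∧ x = pair empty z ∧ y = pair empty z) ∨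
  (∃ i, i ∈ᴹ m ∧ x = pair (adj empty empty) i ∧ y = pair (adj empty empty) (app f i))

/-- The predilator `D^γ` with `D^γ(n) = D(γ + n)` and `D^γ(f) = D(γ + f)`, where the support of
`⟨σ, a⟩` in `D^γ(n)` consists of those `i < n` such that the element `γ + i` lies in `a`. -/
def shift (D : Predil M) (γ : M) : Predil M where
  El n p := (D.ext ((ordOrder γ).add (ordOrder n))).mem p
  lt n p q := (D.ext ((ordOrder γ).add (ordOrder n))).lt p q
  map m _ f p q := extMap (addMap γ m f) p q
  supp n p i := i ∈ᴹ n ∧ extSupp p (pair (adj empty empty) i)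

/-- The ordinal `Ω` is a `ψ`-fixed point of `D`. -/
def IsPsiFixedPoint (D : Predil M) (Ω : M) : Prop :=
  IsOrd Ω ∧ ∃ π : M, IsFunOn π Ω ∧
    (∀ α, α ∈ᴹ Ω → (D.ext (ordOrder Ω)).mem (app π α)) ∧
    (∀ α β, α ∈ᴹ Ω → β ∈ᴹ Ω → α ∈ᴹ β → (D.ext (ordOrder Ω)).lt (app π α) (app π β)) ∧
    (∀ α β, α ∈ᴹ Ω → β ∈ᴹ Ω → extSupp (app π β) α → α ∈ᴹ β) ∧
    (∀ τ, (D.ext (ordOrder Ω)).mem τ →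
      (∀ α, extSupp τ α → (D.ext (ordOrder Ω)).lt (app π α) τ) →
      ∃ β, β ∈ᴹ Ω ∧ app π β = τ)

/-- The element `⟨⟨E, L⟩, ⟨F, S⟩⟩` of `M`, which codes a predilator. -/
def code (E L F S : M) : M := pair (pair E L) (pair F S)

/-- The predilator that is coded by the set `d = ⟨⟨E, L⟩, ⟨F, S⟩⟩`, where
* `E` contains the pairs `⟨n, σ⟩` with `σ` in `D(n)`,
* `L` contains the triples `⟨n, ⟨σ, τ⟩⟩` with `σ < τ` in `D(n)`,
* `F` contains the tuples `⟨⟨⟨m, n⟩, f⟩, ⟨σ, τ⟩⟩` with `D(f)(σ) = τ`,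
* `S` contains the triples `⟨n, ⟨σ, i⟩⟩` with `i` in `supp_n(σ)`. -/
def ofCode (d : M) : Predil M where
  El n σ := ∃ E L F S, d = code E L F S ∧ pair n σ ∈ᴹ E
  lt n σ τ := ∃ E L F S, d = code E L F S ∧ pair n (pair σ τ) ∈ᴹ L
  map m n f σ τ := ∃ E L F S, d = code E L F S ∧ pair (pair (pair m n) f) (pair σ τ) ∈ᴹ F
  supp n σ i := ∃ E L F S, d = code E L F S ∧ pair n (pair σ i) ∈ᴹ S

/-- The element `d` of `M` is (a code of) a dilator in the sense of `M`. -/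
def IsDilatorCode (d : M) : Prop :=
  (∃ E L F S, d = code E L F S) ∧ (ofCode d).IsDilator

/-- For a family `D` of dilators, i.e. a function in `M` with codes of dilators as values, this is
the predilator `(∑_{α < μ} D_α)^γ`. -/
noncomputable def shiftedSum (D μ γ : M) : Predil M :=
  (sum (ordOrder μ) (fun α => ofCode (app D α))).shift γ

end Predil

end

end ATRSet

/-!
Consider an order `X` whose elements are terms `t ∈ D(X)` over `X` itself, namely those that lie
above the elements of their own support. The least such order can be built in `ω` stages, since
supports are finite. It satisfies the conditions on a `ψ`-fixed point, except that it need not be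
an ordinal. When `E` is an initial segment of `D`, the fixed point `ψE` can be embedded into `X` by
recursion, and its image consists of those terms in `X` that lie in `E(X)`. Now assume that `D` is
covered by initial segments with fixed points, such as the partial sums of a sum of limit length.
Then any non-empty subset of `X` meets the image of some `ψE`, which is an initial segment of `X`,
so that `X` is well-founded. By axiom beta, `X` is isomorphic to an ordinal `Ω`, which is the fixed
point of `D`. It is the supremum of the ordinals `ψE` because these cover it.
-/

namespace ATRSet

/-! ### Primitive recursive functions and predicates -/

/-- `M` is a model of primitive recursive set theory with infinity, that is, of `ATR₀^set` without
axiom beta and countability. -/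
class ModelsPRS (M : Type u) [SetStructure M] : Prop where
  fn_zero : ∀ (v : Fin 1 → M) (z : M), ¬ z ∈ᴹ SetStructure.fn PRFun.zero v
  fn_proj : ∀ {n : ℕ} (i : Fin n) (v : Fin n → M), SetStructure.fn (PRFun.proj i) v = v i
  fn_adjoin : ∀ (v : Fin 2 → M) (z : M),
    z ∈ᴹ SetStructure.fn PRFun.adjoin v ↔ z ∈ᴹ v 0 ∨ z = v 1
  fn_cond_pos : ∀ v : Fin 4 → M, v 2 ∈ᴹ v 3 → SetStructure.fn PRFun.cond v = v 0
  fn_cond_neg : ∀ v : Fin 4 → M, ¬ v 2 ∈ᴹ v 3 → SetStructure.fn PRFun.cond v = v 1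
  fn_comp : ∀ {m n : ℕ} (F : PRFun m) (G : Fin m → PRFun n) (v : Fin n → M),
    SetStructure.fn (PRFun.comp F G) v
      = SetStructure.fn F (fun i => SetStructure.fn (G i) v)
  fn_recursion : ∀ {n : ℕ} (H : PRFun (n + 2)) (x : M) (y : Fin n → M), ∃ w : M,
    (∀ z, z ∈ᴹ w ↔
      ∃ v, v ∈ᴹ x ∧ z ∈ᴹ SetStructure.fn (PRFun.recursion H) (Fin.cons v y : Fin (n + 1) → M)) ∧
    SetStructure.fn (PRFun.recursion H) (Fin.cons x y : Fin (n + 1) → M)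
      = SetStructure.fn H (Fin.cons w (Fin.cons x y : Fin (n + 1) → M) : Fin (n + 2) → M)
  extensionality : ∀ x y : M, (∀ z, z ∈ᴹ x ↔ z ∈ᴹ y) → x = y
  foundation : ∀ x : M, (∃ y, y ∈ᴹ x) → ∃ y, y ∈ᴹ x ∧ ∀ z, z ∈ᴹ x → ¬ z ∈ᴹ y
  infinity : ∀ n : M, n ∈ᴹ om ↔ n = empty ∨ ∃ m, m ∈ᴹ om ∧ n = adj m m

theorem ModelsATR0Set.modelsPRS {M : Type u} [SetStructure M] (hM : ModelsATR0Set M) :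
    ModelsPRS M :=
  { hM with }

universe v w

/-- Types whose elements are coded by tuples of elements of `M`, of a fixed length. A proposition
is coded by its truth value `0` or `1`. -/
class TupleCoded (M : Type u) (Γ : Type v) where
  dim : ℕ
  toTuple : Γ → Fin dim → M

open TupleCoded

instance TupleCoded.self (M : Type u) : TupleCoded M M := ⟨1, fun x _ => x⟩

instance TupleCoded.prod (M : Type u) (Γ : Type v) (Δ : Type w) [TupleCoded M Γ]
    [TupleCoded M Δ] : TupleCoded M (Γ × Δ) :=
  ⟨dim M Γ + dim M Δ, fun z => Fin.append (toTuple z.1) (toTuple z.2)⟩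

instance TupleCoded.pi (M : Type u) (n : ℕ) : TupleCoded M (Fin n → M) := ⟨n, id⟩

open Classical in
noncomputable instance TupleCoded.prop (M : Type u) [SetStructure M] : TupleCoded M Prop :=
  ⟨1, fun P _ => if P then adj empty empty else empty⟩

/-- The function `f` is primitive recursive with parameters `p` from `M`. -/
@[fun_prop]
def IsPR (M : Type u) [SetStructure M] {Γ : Type v} {Δ : Type w} [TupleCoded M Γ] [TupleCoded M Δ]
    (f : Γ → Δ) : Prop :=
  ∃ (k : ℕ) (p : Fin k → M) (s : Fin (dim M Δ) → PRFun (k + dim M Γ)),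
    ∀ x j, toTuple (f x) j = SetStructure.fn (s j) (Fin.append p (toTuple x))

/-- The symbol for `v ↦ s (v ∘ r)`. -/
def PRFun.reindex {m n : ℕ} (s : PRFun m) (r : Fin m → Fin n) : PRFun n :=
  .comp s fun i => .proj (r i)

section

variable {M : Type u} [SetStructure M] [ModelsPRS M]
variable {Γ : Type*} {Δ : Type*} {Θ : Type*} [TupleCoded M Γ] [TupleCoded M Δ] [TupleCoded M Θ]

theorem fn_reindex {m n : ℕ} (s : PRFun m) (r : Fin m → Fin n) (v : Fin n → M) :
    SetStructure.fn (s.reindex r) v = SetStructure.fn s (fun i => v (r i)) := by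
  simp only [PRFun.reindex, ModelsPRS.fn_comp, ModelsPRS.fn_proj]

namespace IsPR

theorem of_reindex {f : Γ → Δ} (r : Fin (dim M Δ) → Fin (dim M Γ))
    (hr : ∀ x j, toTuple (f x) j = (toTuple x (r j) : M)) : IsPR M f :=
  ⟨0, ![], fun j => .proj (Fin.natAdd 0 (r j)), fun x j => by
    rw [ModelsPRS.fn_proj, Fin.append_right, hr]⟩

@[fun_prop]
protected theorem id : IsPR M (fun x : Γ => x) := of_reindex id fun _ _ => rfl

@[fun_prop]
protected theorem const (c : Δ) : IsPR M (fun _ : Γ => c) :=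
  ⟨dim M Δ, toTuple c, fun j => .proj (Fin.castAdd _ j), fun x j => by
    rw [ModelsPRS.fn_proj, Fin.append_left]⟩

@[fun_prop]
protected theorem comp {g : Δ → Θ} {f : Γ → Δ} (hg : IsPR M g) (hf : IsPR M f) :
    IsPR M (fun x => g (f x)) := by
  obtain ⟨l, q, t, ht⟩ := hg
  obtain ⟨k, p, s, hs⟩ := hf
  refine ⟨l + k, Fin.append q p, fun j => .comp (t j) (Fin.addCases
    (fun a => .proj (Fin.castAdd _ (Fin.castAdd _ a)))
    (fun b => (s b).reindex (Fin.addCases (fun a => Fin.castAdd _ (Fin.natAdd _ a))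
      (fun a => Fin.natAdd _ a)))), fun x j => ?_⟩
  rw [ht, ModelsPRS.fn_comp]
  congr 1
  funext i
  refine Fin.addCases (fun a => ?_) (fun b => ?_) i
  · simp [ModelsPRS.fn_proj]
  · simp only [Fin.append_right, Fin.addCases_right, fn_reindex, hs]
    congr 1
    funext i
    refine Fin.addCases (fun a => ?_) (fun b => ?_) i <;> simp

@[fun_prop]
protected theorem fst {f : Γ → Δ × Θ} (hf : IsPR M f) : IsPR M (fun z => (f z).1) :=
  (of_reindex (f := Prod.fst) (Fin.castAdd _) fun _ _ => (Fin.append_left _ _ _).symm).comp hf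

@[fun_prop]
protected theorem snd {f : Γ → Δ × Θ} (hf : IsPR M f) : IsPR M (fun z => (f z).2) :=
  (of_reindex (f := Prod.snd) (Fin.natAdd _) fun _ _ => (Fin.append_right _ _ _).symm).comp hf

@[fun_prop]
protected theorem prodMk {f : Γ → Δ} {g : Γ → Θ} (hf : IsPR M f) (hg : IsPR M g) :
    IsPR M (fun x => (f x, g x)) := by
  obtain ⟨k, p, s, hs⟩ := hf
  obtain ⟨l, q, t, ht⟩ := hg
  refine ⟨k + l, Fin.append p q, Fin.addCases
    (fun b => (s b).reindex (Fin.addCases (fun a => Fin.castAdd _ (Fin.castAdd _ a))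
      (fun a => Fin.natAdd _ a)))
    (fun b => (t b).reindex (Fin.addCases (fun a => Fin.castAdd _ (Fin.natAdd _ a))
      (fun a => Fin.natAdd _ a))), fun x j => ?_⟩
  refine Fin.addCases (fun a => ?_) (fun b => ?_) j
  · simp only [Fin.addCases_left, fn_reindex]
    refine (Fin.append_left _ _ _).trans ((hs x a).trans ?_)
    congr 1
    funext i
    refine Fin.addCases (fun a => ?_) (fun b => ?_) i <;> simp
  · simp only [Fin.addCases_right, fn_reindex]
    refine (Fin.append_right _ _ _).trans ((ht x b).trans ?_)
    congr 1
    funext i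
    refine Fin.addCases (fun a => ?_) (fun b => ?_) i <;> simp

protected theorem cons {n : ℕ} {f : Γ → M} {g : Γ → Fin n → M} (hf : IsPR M f) (hg : IsPR M g) :
    IsPR M (fun x => (Fin.cons (f x) (g x) : Fin (n + 1) → M)) := by
  refine (of_reindex (f := fun z : M × (Fin n → M) => (Fin.cons z.1 z.2 : Fin (n + 1) → M))
    (Fin.cons (Fin.castAdd n 0) (Fin.natAdd 1)) fun x j => ?_).comp (hf.prodMk hg)
  refine Fin.cases ?_ (fun j => ?_) j
  · exact (Fin.append_left (m := 1) (n := n) (fun _ => x.1) x.2 0).symm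
  · exact (Fin.append_right (m := 1) (n := n) (fun _ => x.1) x.2 j).symm

theorem fn {n : ℕ} (s : PRFun n) {f : Γ → Fin n → M} (hf : IsPR M f) :
    IsPR M (fun x => SetStructure.fn s (f x)) := by
  refine IsPR.comp (g := fun v : Fin n → M => SetStructure.fn s v)
    ⟨0, ![], fun _ => s.reindex (Fin.natAdd 0), fun x j => ?_⟩ hf
  simp only [fn_reindex, Fin.append_right]
  rfl

@[fun_prop]
protected theorem adj {f g : Γ → M} (hf : IsPR M f) (hg : IsPR M g) :
    IsPR M (fun x => adj (f x) (g x)) :=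
  fn .adjoin (hf.cons (hg.cons (.const ![])))

@[fun_prop]
protected theorem upair {f g : Γ → M} (hf : IsPR M f) (hg : IsPR M g) :
    IsPR M (fun x => upair (f x) (g x)) := by
  unfold upair; fun_prop

@[fun_prop]
protected theorem pair {f g : Γ → M} (hf : IsPR M f) (hg : IsPR M g) :
    IsPR M (fun x => pair (f x) (g x)) := by
  unfold pair; fun_prop

end IsPR

theorem set_ext {x y : M} (h : ∀ z, z ∈ᴹ x ↔ z ∈ᴹ y) : x = y := ModelsPRS.extensionality x y h

@[simp] theorem not_mem_empty (x : M) : ¬ x ∈ᴹ empty := ModelsPRS.fn_zero _ _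

@[simp] theorem mem_adj {x y z : M} : z ∈ᴹ adj x y ↔ z ∈ᴹ x ∨ z = y := ModelsPRS.fn_adjoin _ _

@[simp] theorem mem_upair {x y z : M} : z ∈ᴹ upair x y ↔ z = x ∨ z = y := by simp [upair]

theorem not_mem_self (x : M) : ¬ x ∈ᴹ x := by
  obtain ⟨y, hy, hmin⟩ := ModelsPRS.foundation (adj empty x) ⟨x, by simp⟩
  obtain rfl : y = x := by simpa using hy
  exact hmin y hy

theorem not_mem_of_mem {x y : M} (h : x ∈ᴹ y) : ¬ y ∈ᴹ x := by
  intro h'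
  obtain ⟨z, hz, hmin⟩ := ModelsPRS.foundation (upair x y) ⟨x, by simp⟩
  rcases mem_upair.1 hz with rfl | rfl
  · exact hmin y (by simp) h'
  · exact hmin x (by simp) h

theorem upair_eq_upair_left {x y z : M} (h : upair x y = upair x z) : y = z := by
  have hy : y ∈ᴹ upair x z := by simp [← h]
  have hz : z ∈ᴹ upair x y := by simp [h]
  grind [mem_upair]

theorem upair_self_eq_upair {x y z : M} (h : upair x x = upair y z) : x = y := by
  have hy : y ∈ᴹ upair x x := by simp [h]
  simpa [eq_comm] using hy

@[simp] theorem pair_inj {x y x' y' : M} : pair x y = pair x' y' ↔ x = x' ∧ y = y' := by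
  refine ⟨fun h => ?_, by rintro ⟨rfl, rfl⟩; rfl⟩
  obtain rfl : x = x' := by
    have hx : upair x x ∈ᴹ pair x' y' := by rw [← h]; simp [pair]
    rcases mem_upair.1 hx with h | h <;> exact upair_self_eq_upair h
  exact ⟨rfl, upair_eq_upair_left (upair_eq_upair_left h)⟩

theorem empty_ne_one : (empty : M) ≠ adj empty empty := fun h =>
  not_mem_empty (M := M) empty ((congrArg (empty ∈ᴹ ·) h).mpr (by simp))

namespace IsPR

omit [ModelsPRS M] in
open Classical in
theorem iff_ite {P : Γ → Prop} :
    IsPR M P ↔ IsPR M (fun x => if P x then adj empty empty else (empty : M)) :=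
  ⟨fun ⟨k, p, s, h⟩ => ⟨k, p, s, h⟩, fun ⟨k, p, s, h⟩ => ⟨k, p, s, h⟩⟩

theorem cond {a b c d : Γ → M} (ha : IsPR M a) (hb : IsPR M b) (hc : IsPR M c) (hd : IsPR M d) :
    IsPR M (fun x => SetStructure.fn PRFun.cond ![a x, b x, c x, d x]) :=
  fn .cond (ha.cons (hb.cons (hc.cons (hd.cons (.const ![])))))

@[fun_prop]
protected theorem mem {f g : Γ → M} (hf : IsPR M f) (hg : IsPR M g) :
    IsPR M (fun x => f x ∈ᴹ g x) := by
  rw [iff_ite]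
  convert cond (.const (M := M) (adj empty empty)) (.const (M := M) empty) hf hg using 2 with x
  split_ifs with h
  · exact (ModelsPRS.fn_cond_pos ![_, _, f x, g x] h).symm
  · exact (ModelsPRS.fn_cond_neg ![_, _, f x, g x] h).symm

open Classical in
@[fun_prop]
protected theorem ite {P : Γ → Prop} {f g : Γ → M} (hP : IsPR M P) (hf : IsPR M f)
    (hg : IsPR M g) : IsPR M (fun x => if P x then f x else g x) := by
  rw [iff_ite] at hP
  convert cond hf hg (.const (M := M) empty) hP using 2 with x
  split_ifs with h
  · exact (ModelsPRS.fn_cond_pos ![f x, g x, _, _] (by simp)).symm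
  · exact (ModelsPRS.fn_cond_neg ![f x, g x, _, _] (by simp)).symm

omit [ModelsPRS M] in
theorem congr {P Q : Γ → Prop} (hQ : IsPR M Q) (h : ∀ x, P x ↔ Q x) : IsPR M P := by
  obtain rfl : P = Q := funext fun x => propext (h x)
  exact hQ

@[fun_prop]
protected theorem eq {f g : Γ → M} (hf : IsPR M f) (hg : IsPR M g) :
    IsPR M (fun x => f x = g x) :=
  congr (Q := fun x => f x ∈ᴹ adj empty (g x)) (by fun_prop) (by simp)

open Classical in
@[fun_prop]
protected theorem not {P : Γ → Prop} (hP : IsPR M P) : IsPR M (fun x => ¬ P x) :=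
  congr (Q := fun x => empty ∈ᴹ if P x then empty else adj (empty : M) empty) (by fun_prop)
    fun x => by by_cases h : P x <;> simp [h]

open Classical in
@[fun_prop]
protected theorem and {P Q : Γ → Prop} (hP : IsPR M P) (hQ : IsPR M Q) :
    IsPR M (fun x => P x ∧ Q x) :=
  congr (Q := fun x => empty ∈ᴹ
      if P x then (if Q x then adj empty empty else empty) else (empty : M)) (by fun_prop)
    fun x => by by_cases h : P x <;> by_cases h' : Q x <;> simp [h, h']

@[fun_prop]
protected theorem or {P Q : Γ → Prop} (hP : IsPR M P) (hQ : IsPR M Q) :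
    IsPR M (fun x => P x ∨ Q x) :=
  congr (Q := fun x => ¬ (¬ P x ∧ ¬ Q x)) (by fun_prop) fun x => by tauto

@[fun_prop]
protected theorem imp {P Q : Γ → Prop} (hP : IsPR M P) (hQ : IsPR M Q) :
    IsPR M (fun x => P x → Q x) :=
  congr (Q := fun x => ¬ (P x ∧ ¬ Q x)) (by fun_prop) fun x => by tauto

/-! ### Recursion and bounded quantifiers -/

theorem exists_prFun {h : M → M → Γ → M} (hh : IsPR M (fun z : M × M × Γ => h z.1 z.2.1 z.2.2)) :
    ∃ (k : ℕ) (p : Fin k → M) (H : PRFun (k + dim M Γ + 2)), ∀ w x y,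
      SetStructure.fn H (Fin.cons w (Fin.cons x (Fin.append p (toTuple y)) :
        Fin (k + dim M Γ + 1) → M) : Fin (k + dim M Γ + 2) → M) = h w x y := by
  obtain ⟨k, p, s, hs⟩ := hh
  let n := dim M Γ
  refine ⟨k, p, (s (0 : Fin 1)).reindex (Fin.addCases (fun a => (Fin.castAdd n a).succ.succ)
    (Fin.addCases (m := 1) (n := 1 + n) (fun _ => 0) (Fin.addCases (m := 1) (n := n) (fun _ => 1)
      (fun c => (Fin.natAdd k c : Fin (k + n)).succ.succ)))), fun w x y => ?_⟩
  refine Eq.trans ?_ (hs (w, x, y) (0 : Fin 1)).symm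
  rw [fn_reindex]
  congr 1
  funext i
  refine Fin.addCases (fun a => ?_) (fun b => ?_) i
  · simp only [Fin.addCases_left, Fin.cons_succ]
    exact (Fin.append_left _ _ _).trans (Fin.append_left _ _ _).symm
  rw [Fin.addCases_right, Fin.append_right]
  refine Fin.addCases (m := 1) (n := 1 + n) (fun a => ?_) (fun b => ?_) b
  · rw [Fin.addCases_left]
    exact (Fin.append_left (m := 1) (n := 1 + n) (fun _ => w) _ a).symm
  refine Eq.trans ?_ (Fin.append_right (m := 1) (n := 1 + n) (fun _ => w) _ b).symm
  rw [Fin.addCases_right]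
  refine Fin.addCases (fun a => ?_) (fun b => ?_) b
  · rw [Fin.addCases_left]
    exact (Fin.append_left (m := 1) (n := n) (fun _ => x) (toTuple y) a).symm
  · simp only [Fin.addCases_right, Fin.cons_succ, Fin.append_right]
    exact (Fin.append_right (m := 1) (n := n) (fun _ => x) (toTuple y) b).symm

theorem exists_recursion {h : M → M → Γ → M}
    (hh : IsPR M (fun z : M × M × Γ => h z.1 z.2.1 z.2.2)) :
    ∃ R : M → Γ → M, IsPR M (fun z : M × Γ => R z.1 z.2) ∧ ∀ x y, ∃ w,
      (∀ z, z ∈ᴹ w ↔ ∃ v, v ∈ᴹ x ∧ z ∈ᴹ R v y) ∧ R x y = h w x y := by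
  obtain ⟨k, p, H, hH⟩ := exists_prFun hh
  have h_args : IsPR M (fun z : Γ => (Fin.append p (toTuple z) : Fin (k + dim M Γ) → M)) :=
    ⟨k, p, fun j => .proj j, fun x j => (ModelsPRS.fn_proj _ _).symm⟩
  refine ⟨fun x y => SetStructure.fn (.recursion H) (Fin.cons x (Fin.append p (toTuple y)) :
    Fin (k + dim M Γ + 1) → M), fn _ (.cons (by fun_prop) (h_args.comp (.snd .id))), fun x y => ?_⟩
  obtain ⟨w, hw, e⟩ := ModelsPRS.fn_recursion H x (Fin.append p (toTuple y))
  exact ⟨w, hw, e.trans (hH w x y)⟩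

open Classical in
theorem exists_bUnion {u : Γ → M} {F : Γ → M → M} (hu : IsPR M u)
    (hF : IsPR M (fun z : Γ × M => F z.1 z.2)) :
    ∃ G : Γ → M, IsPR M G ∧ ∀ y z, z ∈ᴹ G y ↔ ∃ x, x ∈ᴹ u y ∧ z ∈ᴹ F y x := by
  -- Recurse on `x` with value `F y x`, except at `x = u y`, where all earlier values are collected.
  obtain ⟨R, hR, h⟩ := exists_recursion (Γ := Γ) (h := fun w x y => if x = u y then w else F y x)
    (by fun_prop)
  refine ⟨fun y => R (u y) y, by fun_prop, fun y z => ?_⟩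
  obtain ⟨w, hw, e⟩ := h (u y) y
  simp only [e, if_pos, hw]
  refine exists_congr fun x => and_congr_right fun hx => ?_
  obtain ⟨w', -, e'⟩ := h x y
  rw [e', if_neg]
  rintro rfl
  exact not_mem_self _ hx

open Classical in
@[fun_prop]
theorem exists_mem {u : Γ → M} {P : Γ → M → Prop} (hu : IsPR M u)
    (hP : IsPR M (fun z : Γ × M => P z.1 z.2)) : IsPR M (fun y => ∃ x, x ∈ᴹ u y ∧ P y x) := by
  obtain ⟨G, hG, h⟩ := exists_bUnion (F := fun y x => if P y x then adj empty empty else empty)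
    hu (by fun_prop)
  refine congr (Q := fun y => empty ∈ᴹ G y) (by fun_prop) fun y => ?_
  rw [h]
  refine exists_congr fun x => and_congr_right fun _ => ?_
  by_cases h : P y x <;> simp [h]

@[fun_prop]
theorem forall_mem {u : Γ → M} {P : Γ → M → Prop} (hu : IsPR M u)
    (hP : IsPR M (fun z : Γ × M => P z.1 z.2)) : IsPR M (fun y => ∀ x, x ∈ᴹ u y → P y x) :=
  congr (Q := fun y => ¬ ∃ x, x ∈ᴹ u y ∧ ¬ P y x) (by fun_prop) fun x => by simp

open Classical in
theorem exists_sep {u : Γ → M} {P : Γ → M → Prop} (hu : IsPR M u)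
    (hP : IsPR M (fun z : Γ × M => P z.1 z.2)) :
    ∃ G : Γ → M, IsPR M G ∧ ∀ y z, z ∈ᴹ G y ↔ z ∈ᴹ u y ∧ P y z := by
  obtain ⟨G, hG, h⟩ := exists_bUnion (F := fun y x => if P y x then adj empty x else empty)
    hu (by fun_prop)
  refine ⟨G, hG, fun y z => (h y z).trans ⟨?_, fun ⟨hz, hP⟩ => ⟨z, hz, by simp [hP]⟩⟩⟩
  rintro ⟨x, hx, hz⟩
  split_ifs at hz with hP
  · obtain rfl : z = x := by simpa using hz
    exact ⟨hx, hP⟩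
  · simp at hz

theorem exists_image {u : Γ → M} {F : Γ → M → M} (hu : IsPR M u)
    (hF : IsPR M (fun z : Γ × M => F z.1 z.2)) :
    ∃ G : Γ → M, IsPR M G ∧ ∀ y z, z ∈ᴹ G y ↔ ∃ x, x ∈ᴹ u y ∧ z = F y x := by
  simpa using exists_bUnion (F := fun y x => adj empty (F y x)) hu (by fun_prop)

end IsPR

theorem exists_sep (u : M) {P : M → Prop} (hP : IsPR M P) :
    ∃ s : M, ∀ z, z ∈ᴹ s ↔ z ∈ᴹ u ∧ P z := by
  obtain ⟨G, -, h⟩ := IsPR.exists_sep (Γ := M) (u := fun _ => u) (P := fun _ => P) (by fun_prop)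
    (by fun_prop)
  exact ⟨G u, h u⟩

theorem exists_image (A : M) {F : M → M} (hF : IsPR M F) :
    ∃ B, ∀ y, y ∈ᴹ B ↔ ∃ x, x ∈ᴹ A ∧ y = F x := by
  obtain ⟨G, -, h⟩ := IsPR.exists_image (Γ := M) (u := fun _ => A) (F := fun _ => F) (by fun_prop)
    (by fun_prop)
  exact ⟨G A, h A⟩

end

section

variable {M : Type u} [SetStructure M] [ModelsPRS M]
variable {Γ : Type*} [TupleCoded M Γ]

/-! ### Foundation and ordinals -/

theorem exists_minimal {A : M} {P : M → Prop} (hP : IsPR M P) (h : ∃ x, x ∈ᴹ A ∧ P x) :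
    ∃ x, x ∈ᴹ A ∧ P x ∧ ∀ z, z ∈ᴹ x → z ∈ᴹ A → ¬ P z := by
  obtain ⟨s, hs⟩ := exists_sep A hP
  obtain ⟨x, hx⟩ := h
  obtain ⟨y, hy, hmin⟩ := ModelsPRS.foundation s ⟨x, (hs x).2 hx⟩
  obtain ⟨hyA, hPy⟩ := (hs y).1 hy
  exact ⟨y, hyA, hPy, fun z hz hzA hPz => hmin z ((hs z).2 ⟨hzA, hPz⟩) hz⟩

theorem mem_induction {A : M} {P : M → Prop} (hP : IsPR M P)
    (h : ∀ x, x ∈ᴹ A → (∀ z, z ∈ᴹ x → z ∈ᴹ A → P z) → P x) : ∀ x, x ∈ᴹ A → P x := by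
  by_contra! hc
  obtain ⟨x, hx, hn, hmin⟩ := exists_minimal hP.not hc
  exact hn (h x hx fun z hz hzA => not_not.1 (hmin z hz hzA))

@[simp] theorem empty_mem_om : (empty : M) ∈ᴹ om := (ModelsPRS.infinity _).2 (.inl rfl)

theorem succ_mem_om {n : M} (h : n ∈ᴹ om) : adj n n ∈ᴹ om :=
  (ModelsPRS.infinity _).2 (.inr ⟨n, h, rfl⟩)

theorem om_induction {P : M → Prop} (hP : IsPR M P) (zero : P empty)
    (succ : ∀ n, n ∈ᴹ om → P n → P (adj n n)) : ∀ n, n ∈ᴹ om → P n := by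
  refine mem_induction hP fun x hx ih => ?_
  rcases (ModelsPRS.infinity x).1 hx with rfl | ⟨m, hm, rfl⟩
  · exact zero
  · exact succ m hm (ih m (by simp) hm)

theorem mem_om_of_mem {n m : M} (hn : n ∈ᴹ om) (hm : m ∈ᴹ n) : m ∈ᴹ om := by
  refine om_induction (P := fun n : M => ∀ m, m ∈ᴹ n → m ∈ᴹ om) (by fun_prop) (by simp) ?_ n hn m hm
  rintro n hn ih m hm
  rcases mem_adj.1 hm with h | rfl
  · exact ih m h
  · exact hn

@[fun_prop]
theorem IsPR.isOrd {f : Γ → M} (hf : IsPR M f) : IsPR M (fun x => IsOrd (f x)) := by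
  unfold IsOrd IsTransSet; fun_prop

theorem isOrd_empty : IsOrd (empty : M) := ⟨fun y hy => by simp at hy, fun y hy => by simp at hy⟩

omit [ModelsPRS M] in
theorem IsOrd.mem {x y : M} (hx : IsOrd x) (hy : y ∈ᴹ x) : IsOrd y :=
  ⟨hx.2 y hy, fun z hz => hx.2 z (hx.1 y hy z hz)⟩

theorem IsOrd.succ {x : M} (hx : IsOrd x) : IsOrd (adj x x) := by
  simp only [IsOrd, IsTransSet, mem_adj]
  grind [IsOrd, IsTransSet]

theorem isOrd_of_mem_om {n : M} (hn : n ∈ᴹ om) : IsOrd n :=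
  om_induction (P := IsOrd) (by fun_prop) isOrd_empty (fun _ _ h => h.succ) n hn

theorem isOrd_om : IsOrd (om : M) :=
  ⟨fun _ hy _ hz => mem_om_of_mem hy hz, fun _ hy => (isOrd_of_mem_om hy).1⟩

theorem IsOrd.trichotomy {α β : M} (hα : IsOrd α) (hβ : IsOrd β) :
    α ∈ᴹ β ∨ α = β ∨ β ∈ᴹ α := by
  by_contra hc
  obtain ⟨x, hx, ⟨y, hy, hxy⟩, hmin⟩ := exists_minimal (A := adj α α)
    (P := fun x => ∃ y, y ∈ᴹ adj β β ∧ ¬ (x ∈ᴹ y ∨ x = y ∨ y ∈ᴹ x)) (by fun_prop)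
    ⟨α, by simp, β, by simp, hc⟩
  obtain ⟨y, hy, hxy, hmin'⟩ := exists_minimal (A := adj β β)
    (P := fun y => ¬ (x ∈ᴹ y ∨ x = y ∨ y ∈ᴹ x)) (by fun_prop) ⟨y, hy, hxy⟩
  have hxtrans := (hα.succ.mem hx).1
  have hytrans := (hβ.succ.mem hy).1
  refine hxy (.inr (.inl (set_ext fun z => ⟨fun hz => ?_, fun hz => ?_⟩)))
  · by_contra hzy
    refine hmin z hz (hα.succ.1 x hx z hz) ⟨y, hy, ?_⟩
    rintro (h | rfl | h)
    · exact hzy h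
    · exact hxy (.inr (.inr hz))
    · exact hxy (.inr (.inr (hxtrans z hz y h)))
  · rcases not_not.1 (hmin' z hz (hβ.succ.1 y hy z hz)) with h | rfl | h
    · exact absurd (.inl (hytrans z hz x h)) hxy
    · exact absurd (.inl hz) hxy
    · exact h

theorem exists_gt_of_mem_om {n m : M} (hn : n ∈ᴹ om) (hm : m ∈ᴹ om) :
    ∃ k, k ∈ᴹ om ∧ n ∈ᴹ k ∧ m ∈ᴹ k := by
  rcases (isOrd_of_mem_om hn).trichotomy (isOrd_of_mem_om hm) with h | rfl | h
  · exact ⟨adj m m, succ_mem_om hm, by simp [h], by simp⟩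
  · exact ⟨adj n n, succ_mem_om hn, by simp, by simp⟩
  · exact ⟨adj n n, succ_mem_om hn, by simp, by simp [h]⟩

/-! ### Unions, functions and pairs -/

theorem exists_sUnion : ∃ G : M → M, IsPR M G ∧ ∀ x z, z ∈ᴹ G x ↔ ∃ y, y ∈ᴹ x ∧ z ∈ᴹ y :=
  IsPR.exists_bUnion (Γ := M) (u := fun x => x) (F := fun _ y => y) (by fun_prop) (by fun_prop)

/-- The union `⋃ x` of the elements of `x`. -/
noncomputable def sUnion (x : M) : M := (exists_sUnion (M := M)).choose x

@[simp] theorem mem_sUnion {x z : M} : z ∈ᴹ sUnion x ↔ ∃ y, y ∈ᴹ x ∧ z ∈ᴹ y :=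
  (exists_sUnion (M := M)).choose_spec.2 x z

@[fun_prop]
theorem IsPR.sUnion {f : Γ → M} (hf : IsPR M f) : IsPR M (fun x => sUnion (f x)) :=
  (exists_sUnion (M := M)).choose_spec.1.comp hf

/-- The union `x ∪ y`. -/
noncomputable def cup (x y : M) : M := sUnion (upair x y)

@[simp] theorem mem_cup {x y z : M} : z ∈ᴹ cup x y ↔ z ∈ᴹ x ∨ z ∈ᴹ y := by simp [cup]

@[fun_prop]
theorem IsPR.cup {f g : Γ → M} (hf : IsPR M f) (hg : IsPR M g) :
    IsPR M (fun x => cup (f x) (g x)) := by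
  unfold ATRSet.cup; fun_prop

theorem IsPR.exists_description {u : Γ → M} {P : Γ → M → Prop} (hu : IsPR M u)
    (hP : IsPR M (fun z : Γ × M => P z.1 z.2)) :
    ∃ G : Γ → M, IsPR M G ∧
      (∀ y x, x ∈ᴹ u y → P y x → (∀ x', x' ∈ᴹ u y → P y x' → x' = x) → G y = x) ∧
      ∀ y, (∀ x, x ∈ᴹ u y → ¬ P y x) → G y = empty := by
  obtain ⟨G, hG, h⟩ := IsPR.exists_sep hu hP
  refine ⟨fun y => ATRSet.sUnion (G y), by fun_prop, fun y x hx hPx huniq => set_ext fun z => ?_,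
    fun y hy => set_ext fun z => ?_⟩
  · simp only [mem_sUnion, h]
    exact ⟨fun ⟨x', hx', hz⟩ => huniq x' hx'.1 hx'.2 ▸ hz, fun hz => ⟨x, ⟨hx, hPx⟩, hz⟩⟩
  · simpa [h] using fun x hx hPx => absurd hPx (hy x hx)

theorem left_mem_sUnion_pair (x y : M) : x ∈ᴹ sUnion (pair x y) := by simp [pair]

theorem right_mem_sUnion_pair (x y : M) : y ∈ᴹ sUnion (pair x y) := by simp [pair]

theorem exists_pairFst : ∃ G : M → M, IsPR M G ∧ ∀ x y, G (pair x y) = x := by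
  obtain ⟨G, hG, h, -⟩ := IsPR.exists_description (Γ := M) (u := fun p => sUnion p)
    (P := fun p x => ∃ y, y ∈ᴹ sUnion p ∧ p = pair x y) (by fun_prop) (by fun_prop)
  exact ⟨G, hG, fun x y => h _ x (left_mem_sUnion_pair x y) ⟨y, right_mem_sUnion_pair x y, rfl⟩
    fun x' _ ⟨_, _, h⟩ => (pair_inj.1 h).1.symm⟩

theorem exists_pairSnd : ∃ G : M → M, IsPR M G ∧ ∀ x y, G (pair x y) = y := by
  obtain ⟨G, hG, h, -⟩ := IsPR.exists_description (Γ := M) (u := fun p => sUnion p)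
    (P := fun p y => ∃ x, x ∈ᴹ sUnion p ∧ p = pair x y) (by fun_prop) (by fun_prop)
  exact ⟨G, hG, fun x y => h _ y (right_mem_sUnion_pair x y) ⟨x, left_mem_sUnion_pair x y, rfl⟩
    fun y' _ ⟨_, _, h⟩ => (pair_inj.1 h).2.symm⟩

/-- The first component of an ordered pair; an unspecified value on sets that are not pairs. -/
noncomputable def pairFst (p : M) : M := (exists_pairFst (M := M)).choose p

/-- The second component of an ordered pair; an unspecified value on sets that are not pairs. -/
noncomputable def pairSnd (p : M) : M := (exists_pairSnd (M := M)).choose p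

@[simp] theorem pairFst_pair (x y : M) : pairFst (pair x y) = x :=
  (exists_pairFst (M := M)).choose_spec.2 x y

@[simp] theorem pairSnd_pair (x y : M) : pairSnd (pair x y) = y :=
  (exists_pairSnd (M := M)).choose_spec.2 x y

namespace IsPR

@[fun_prop]
protected theorem pairFst {f : Γ → M} (hf : IsPR M f) : IsPR M (fun x => pairFst (f x)) :=
  (exists_pairFst (M := M)).choose_spec.1.comp hf

@[fun_prop]
protected theorem pairSnd {f : Γ → M} (hf : IsPR M f) : IsPR M (fun x => pairSnd (f x)) :=
  (exists_pairSnd (M := M)).choose_spec.1.comp hf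

@[fun_prop]
theorem exists_pair {f : Γ → M} {P : Γ → M → M → Prop} (hf : IsPR M f)
    (hP : IsPR M (fun z : Γ × M × M => P z.1 z.2.1 z.2.2)) :
    IsPR M (fun z => ∃ x y, f z = pair x y ∧ P z x y) := by
  have : IsPR M (fun z => P z (pairFst (f z)) (pairSnd (f z))) :=
    hP.comp (f := fun z => (z, pairFst (f z), pairSnd (f z))) (by fun_prop)
  refine congr (Q := fun z => f z = pair (pairFst (f z)) (pairSnd (f z)) ∧
    P z (pairFst (f z)) (pairSnd (f z))) (by fun_prop) fun z => ⟨?_, fun h => ⟨_, _, h⟩⟩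
  rintro ⟨x, y, h, hP⟩
  simpa [h] using hP

end IsPR

theorem right_mem_sUnion_sUnion {x y f : M} (h : pair x y ∈ᴹ f) : y ∈ᴹ sUnion (sUnion f) := by
  obtain ⟨z, hz, hy⟩ := mem_sUnion.1 (right_mem_sUnion_pair x y)
  exact mem_sUnion.2 ⟨z, mem_sUnion.2 ⟨_, h, hz⟩, hy⟩

omit [ModelsPRS M] in
theorem pair_app_mem {f x : M} (h : ∃! y, pair x y ∈ᴹ f) : pair x (app f x) ∈ᴹ f := by
  rw [app, dif_pos h]; exact h.choose_spec.1

omit [ModelsPRS M] in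
theorem app_eq {f x y : M} (h : ∃! y, pair x y ∈ᴹ f) (hy : pair x y ∈ᴹ f) : app f x = y :=
  h.unique (pair_app_mem h) hy

namespace IsPR

@[fun_prop]
theorem existsUnique_pair {f g : Γ → M} (hf : IsPR M f) (hg : IsPR M g) :
    IsPR M (fun x => ∃! y, ATRSet.pair (f x) y ∈ᴹ g x) := by
  refine congr (Q := fun x => ∃ y, y ∈ᴹ ATRSet.sUnion (ATRSet.sUnion (g x)) ∧
    ATRSet.pair (f x) y ∈ᴹ g x ∧ ∀ y', y' ∈ᴹ ATRSet.sUnion (ATRSet.sUnion (g x)) →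
      ATRSet.pair (f x) y' ∈ᴹ g x → y' = y) (by fun_prop) fun x => ⟨?_, ?_⟩
  · rintro ⟨y, hy, huniq⟩
    exact ⟨y, right_mem_sUnion_sUnion hy, hy, fun y' _ => huniq y'⟩
  · rintro ⟨y, -, hy, huniq⟩
    exact ⟨y, hy, fun y' hy' => huniq y' (right_mem_sUnion_sUnion hy') hy'⟩

@[fun_prop]
protected theorem app {f g : Γ → M} (hf : IsPR M f) (hg : IsPR M g) :
    IsPR M (fun x => app (f x) (g x)) := by
  obtain ⟨G, hG, hG_eq, hG_empty⟩ := exists_description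
    (u := fun x => ATRSet.sUnion (ATRSet.sUnion (f x)))
    (P := fun x y => (∃! y, ATRSet.pair (g x) y ∈ᴹ f x) ∧ ATRSet.pair (g x) y ∈ᴹ f x)
    (by fun_prop) (by fun_prop)
  convert hG using 2 with x
  by_cases hx : ∃! y, ATRSet.pair (g x) y ∈ᴹ f x
  · have hmem := pair_app_mem hx
    exact (hG_eq x _ (right_mem_sUnion_sUnion hmem) ⟨hx, hmem⟩
      fun y _ hy => (app_eq hx hy.2).symm).symm
  · rw [hG_empty x fun _ _ h => hx h.1, ATRSet.app, dif_neg hx]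

@[fun_prop]
theorem isFunOn {f g : Γ → M} (hf : IsPR M f) (hg : IsPR M g) :
    IsPR M (fun x => IsFunOn (f x) (g x)) := by
  have h_iff (f A : M) : IsFunOn f A ↔ (∀ p, p ∈ᴹ f → ∃ x y, p = ATRSet.pair x y ∧ x ∈ᴹ A) ∧
      ∀ x, x ∈ᴹ A → ∃! y, ATRSet.pair x y ∈ᴹ f := by
    simp only [IsFunOn, and_comm]
  exact congr (by fun_prop) fun x => h_iff (f x) (g x)

end IsPR

namespace IsFunOn

variable {f g A x y p : M}

omit [ModelsPRS M] in
theorem pair_mem (h : IsFunOn f A) (hx : x ∈ᴹ A) : pair x (app f x) ∈ᴹ f := pair_app_mem (h.2 x hx)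

omit [ModelsPRS M] in
theorem app_eq (h : IsFunOn f A) (hx : x ∈ᴹ A) (hy : pair x y ∈ᴹ f) : app f x = y :=
  ATRSet.app_eq (h.2 x hx) hy

omit [ModelsPRS M] in
theorem mem_iff (h : IsFunOn f A) : p ∈ᴹ f ↔ ∃ x, x ∈ᴹ A ∧ p = pair x (app f x) := by
  refine ⟨fun hp => ?_, ?_⟩
  · obtain ⟨x, y, hx, rfl⟩ := h.1 p hp
    exact ⟨x, hx, by rw [h.app_eq hx hp]⟩
  · rintro ⟨x, hx, rfl⟩
    exact h.pair_mem hx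

theorem ext (hf : IsFunOn f A) (hg : IsFunOn g A) (h : ∀ x, x ∈ᴹ A → app f x = app g x) :
    f = g := by
  refine set_ext fun p => ?_
  rw [hf.mem_iff, hg.mem_iff]
  exact exists_congr fun x => and_congr_right fun hx => by rw [h x hx]

end IsFunOn

theorem exists_fun (A : M) {F : M → M} (hF : IsPR M F) :
    ∃ f, IsFunOn f A ∧ ∀ x, x ∈ᴹ A → app f x = F x := by
  obtain ⟨f, hf⟩ := exists_image A (F := fun x => pair x (F x)) (by fun_prop)
  have hfun : IsFunOn f A := by
    refine ⟨fun p hp => ?_, fun x hx => ⟨F x, (hf _).2 ⟨x, hx, rfl⟩, fun y hy => ?_⟩⟩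
    · obtain ⟨x, hx, rfl⟩ := (hf p).1 hp
      exact ⟨x, _, hx, rfl⟩
    · obtain ⟨x', hx', e⟩ := (hf _).1 hy
      obtain ⟨rfl, rfl⟩ := pair_inj.1 e
      rfl
  exact ⟨f, hfun, fun x hx => hfun.app_eq hx ((hf _).2 ⟨x, hx, rfl⟩)⟩

theorem exists_fun_of_rel (A B : M) {R : M → M → Prop} (hR : IsPR M (fun z : M × M => R z.1 z.2))
    (h : ∀ x, x ∈ᴹ A → ∃ y, y ∈ᴹ B ∧ R x y)
    (huniq : ∀ x y y', x ∈ᴹ A → R x y → R x y' → y = y') :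
    ∃ f, IsFunOn f A ∧ ∀ x, x ∈ᴹ A → app f x ∈ᴹ B ∧ R x (app f x) := by
  obtain ⟨G, hG, hG_eq, -⟩ := IsPR.exists_description (u := fun _ : M => B) (by fun_prop) hR
  obtain ⟨f, hf, hfG⟩ := exists_fun A hG
  refine ⟨f, hf, fun x hx => ?_⟩
  obtain ⟨y, hy, hxy⟩ := h x hx
  rw [hfG x hx, hG_eq x y hy hxy fun y' _ hy' => huniq x y' y hx hy' hxy]
  exact ⟨hy, hxy⟩

/-! ### Transitive sets closed under adjunction -/

/-- `U` is a transitive set that contains the empty set and is closed under adjunction. It serves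
as a bound for quantifiers over hereditarily finite objects built from its elements. -/
structure IsUniv (U : M) : Prop where
  mem_of_mem : ∀ {x y}, x ∈ᴹ U → y ∈ᴹ x → y ∈ᴹ U
  empty : ATRSet.empty ∈ᴹ U
  adj : ∀ {x y}, x ∈ᴹ U → y ∈ᴹ U → adj x y ∈ᴹ U

theorem exists_adj_image₂ :
    ∃ G : M → M, IsPR M G ∧ ∀ w z, z ∈ᴹ G w ↔ ∃ a b, a ∈ᴹ w ∧ b ∈ᴹ w ∧ z = adj a b := by
  obtain ⟨F, hF, hF_mem⟩ := IsPR.exists_image (Γ := M × M) (u := fun z => z.1)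
    (F := fun z b => adj z.2 b) (by fun_prop) (by fun_prop)
  obtain ⟨G, hG, hG_mem⟩ := IsPR.exists_bUnion (Γ := M) (u := fun w => w)
    (F := fun w a => F (w, a)) (by fun_prop) (by fun_prop)
  refine ⟨G, hG, fun w z => ?_⟩
  simp only [hG_mem, hF_mem]
  grind

theorem exists_univ_stage : ∃ R : M → M → M, IsPR M (fun z : M × M => R z.1 z.2) ∧
    ∀ n x z, z ∈ᴹ R n x ↔ z = empty ∨ z = x ∨ (∃ v y, v ∈ᴹ n ∧ y ∈ᴹ R v x ∧ z ∈ᴹ y) ∨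
      ∃ v w a b, v ∈ᴹ n ∧ w ∈ᴹ n ∧ a ∈ᴹ R v x ∧ b ∈ᴹ R w x ∧ z = adj a b := by
  obtain ⟨G, hG, hG_mem⟩ := exists_adj_image₂ (M := M)
  obtain ⟨R, hR, h⟩ := IsPR.exists_recursion (M := M) (Γ := M)
    (h := fun w _ x => cup (upair empty x) (cup (sUnion w) (G w))) (by fun_prop)
  refine ⟨R, hR, fun n x z => ?_⟩
  obtain ⟨w, hw, e⟩ := h n x
  simp only [e, mem_cup, mem_upair, mem_sUnion, hG_mem, hw, or_assoc]
  grind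

theorem exists_univ : ∃ T : M → M, IsPR M T ∧ ∀ x, x ∈ᴹ T x ∧ IsUniv (T x) := by
  obtain ⟨R, hR, h⟩ := exists_univ_stage (M := M)
  obtain ⟨T, hT, hT_mem⟩ := IsPR.exists_bUnion (Γ := M) (u := fun _ => (om : M))
    (F := fun x n => R n x) (by fun_prop)
    (hR.comp (f := fun z : M × M => (z.2, z.1)) (by fun_prop))
  refine ⟨T, hT, fun x => ⟨(hT_mem x x).2 ⟨empty, by simp, (h _ _ _).2 (by simp)⟩,
    fun {y z} hy hz => ?_, (hT_mem x empty).2 ⟨empty, by simp, (h _ _ _).2 (by simp)⟩,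
    fun {y z} hy hz => ?_⟩⟩
  · obtain ⟨n, hn, hy⟩ := (hT_mem _ _).1 hy
    exact (hT_mem _ _).2 ⟨adj n n, succ_mem_om hn,
      (h _ _ _).2 (.inr (.inr (.inl ⟨n, y, by simp, hy, hz⟩)))⟩
  · obtain ⟨n, hn, hy⟩ := (hT_mem _ _).1 hy
    obtain ⟨m, hm, hz⟩ := (hT_mem _ _).1 hz
    obtain ⟨k, hk, hnk, hmk⟩ := exists_gt_of_mem_om hn hm
    exact (hT_mem _ _).2 ⟨k, hk,
      (h _ _ _).2 (.inr (.inr (.inr ⟨n, m, y, z, hnk, hmk, hy, hz, rfl⟩)))⟩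

/-- A transitive set that contains `x` and is closed under adjunction, given by a primitive
recursive function. -/
noncomputable def univ (x : M) : M := (exists_univ (M := M)).choose x

@[fun_prop]
theorem IsPR.univ {f : Γ → M} (hf : IsPR M f) : IsPR M (fun x => univ (f x)) :=
  (exists_univ (M := M)).choose_spec.1.comp hf

theorem mem_univ_self (x : M) : x ∈ᴹ univ x := ((exists_univ (M := M)).choose_spec.2 x).1

theorem isUniv_univ (x : M) : IsUniv (univ x) := ((exists_univ (M := M)).choose_spec.2 x).2

namespace IsUniv

variable {U : M} (hU : IsUniv U)
include hU

omit [ModelsPRS M] in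
theorem upair {x y : M} (hx : x ∈ᴹ U) (hy : y ∈ᴹ U) : upair x y ∈ᴹ U :=
  hU.adj (hU.adj hU.empty hx) hy

omit [ModelsPRS M] in
theorem pair {x y : M} (hx : x ∈ᴹ U) (hy : y ∈ᴹ U) : pair x y ∈ᴹ U :=
  hU.upair (hU.upair hx hx) (hU.upair hx hy)

theorem pair_mem_iff {x y : M} : ATRSet.pair x y ∈ᴹ U ↔ x ∈ᴹ U ∧ y ∈ᴹ U := by
  refine ⟨fun h => ?_, fun h => hU.pair h.1 h.2⟩
  have hxy : ATRSet.upair x y ∈ᴹ U := hU.mem_of_mem h (by simp [ATRSet.pair])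
  exact ⟨hU.mem_of_mem hxy (by simp), hU.mem_of_mem hxy (by simp)⟩

theorem of_mem_om : ∀ n, n ∈ᴹ om → n ∈ᴹ U :=
  om_induction (P := fun n => n ∈ᴹ U) (by fun_prop) hU.empty (fun _ _ h => hU.adj h h)

theorem finite_image_mem {F : M → M} (hF : IsPR M F) {n a : M} (hn : n ∈ᴹ om)
    (hFU : ∀ i, i ∈ᴹ n → F i ∈ᴹ U) (ha : ∀ x, x ∈ᴹ a ↔ ∃ i, i ∈ᴹ n ∧ x = F i) : a ∈ᴹ U := by
  obtain ⟨G, hG, hG_mem⟩ := IsPR.exists_image (Γ := M) (u := fun n => n) (F := fun _ => F)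
    (by fun_prop) (by fun_prop)
  obtain rfl : a = G n := set_ext fun x => (ha x).trans (hG_mem n x).symm
  refine om_induction (P := fun n => (∀ i, i ∈ᴹ n → F i ∈ᴹ U) → G n ∈ᴹ U) (by fun_prop)
    (fun _ => ?_) (fun n _ ih hFU => ?_) n hn hFU
  · rw [show G ATRSet.empty = ATRSet.empty from set_ext fun x => by simp [hG_mem]]
    exact hU.empty
  · rw [show G (ATRSet.adj n n) = ATRSet.adj (G n) (F n) from set_ext fun x => by
      simp [hG_mem, or_and_right, exists_or]]
    exact hU.adj (ih fun i hi => hFU i (by simp [hi])) (hFU n (by simp))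

theorem finite_fun_mem {n e : M} (hn : n ∈ᴹ om) (he : IsFunOn e n)
    (heU : ∀ i, i ∈ᴹ n → app e i ∈ᴹ U) : e ∈ᴹ U :=
  hU.finite_image_mem (F := fun i => ATRSet.pair i (app e i)) (by fun_prop) hn
    (fun i hi => hU.pair (hU.of_mem_om i (mem_om_of_mem hn hi)) (heU i hi)) fun _ => he.mem_iff

end IsUniv

end

section

variable {M : Type u} [SetStructure M]

/-! ### Linear orders and enumerations of finite subsets -/

namespace ClassOrder.IsLinear

variable {X : ClassOrder M} (hX : X.IsLinear) {x y z : M}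
include hX

omit [SetStructure M] in
theorem irrefl (hx : X.mem x) : ¬ X.lt x x := hX.1 x hx

omit [SetStructure M] in
theorem trans (hx : X.mem x) (hy : X.mem y) (hz : X.mem z) : X.lt x y → X.lt y z → X.lt x z :=
  hX.2.1 x y z hx hy hz

omit [SetStructure M] in
theorem trichotomy (hx : X.mem x) (hy : X.mem y) : X.lt x y ∨ x = y ∨ X.lt y x := hX.2.2 x y hx hy

omit [SetStructure M] in
theorem asymm (hx : X.mem x) (hy : X.mem y) (h : X.lt x y) : ¬ X.lt y x :=
  fun h' => hX.irrefl hx (hX.trans hx hy hx h h')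

end ClassOrder.IsLinear

namespace NatHom

variable {m n f g i j : M}

theorem dom_mem_om (h : NatHom m n f) : m ∈ᴹ om := h.1

theorem cod_mem_om (h : NatHom m n f) : n ∈ᴹ om := h.2.1

theorem isFunOn (h : NatHom m n f) : IsFunOn f m := h.2.2.1

theorem app_mem (h : NatHom m n f) (hi : i ∈ᴹ m) : app f i ∈ᴹ n := h.2.2.2.1 i hi

theorem app_mem_app (h : NatHom m n f) (hi : i ∈ᴹ m) (hj : j ∈ᴹ m) (hij : i ∈ᴹ j) :
    app f i ∈ᴹ app f j := h.2.2.2.2 i j hi hj hij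

end NatHom

/-- `a` is a finite subset of `X`. -/
def FinSub (X : ClassOrder M) (a : M) : Prop := ∃ n e, Enum X a n e

namespace Enum

variable {X : ClassOrder M} {a n e x i j : M}

theorem size_mem_om (h : Enum X a n e) : n ∈ᴹ om := h.1

theorem isFunOn (h : Enum X a n e) : IsFunOn e n := h.2.1

theorem mem (h : Enum X a n e) (hx : x ∈ᴹ a) : X.mem x := h.2.2.1 x hx

theorem mem_iff (h : Enum X a n e) : x ∈ᴹ a ↔ ∃ i, i ∈ᴹ n ∧ x = app e i := h.2.2.2.1 x

theorem app_mem (h : Enum X a n e) (hi : i ∈ᴹ n) : app e i ∈ᴹ a := h.mem_iff.2 ⟨i, hi, rfl⟩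

theorem lt (h : Enum X a n e) (hi : i ∈ᴹ n) (hj : j ∈ᴹ n) (hij : i ∈ᴹ j) :
    X.lt (app e i) (app e j) := h.2.2.2.2 i j hi hj hij

theorem finSub (h : Enum X a n e) : FinSub X a := ⟨n, e, h⟩

end Enum

variable [ModelsPRS M] {X Y : ClassOrder M} {a n e : M}

theorem NatHom.ext {m n f g : M} (hf : NatHom m n f) (hg : NatHom m n g)
    (h : ∀ i, i ∈ᴹ m → app f i = app g i) : f = g :=
  hf.isFunOn.ext hg.isFunOn h

theorem isLinear_ordOrder {α : M} (hα : IsOrd α) : (ordOrder α).IsLinear :=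
  ⟨fun x _ => not_mem_self x, fun x _ z _ _ hz hxy hyz => hα.2 z hz _ hyz x hxy,
    fun _ _ hx hy => (hα.mem hx).trichotomy (hα.mem hy)⟩

theorem NatHom.app_eq_self {m n f : M} (hf : NatHom m n f)
    (hsurj : ∀ j, j ∈ᴹ n → ∃ i, i ∈ᴹ m ∧ app f i = j) : ∀ i, i ∈ᴹ m → app f i = i := by
  have hm := isOrd_of_mem_om hf.dom_mem_om
  have hn := isOrd_of_mem_om hf.cod_mem_om
  refine mem_induction (P := fun i => app f i = i) (by fun_prop) fun i hi ih => ?_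
  replace ih : ∀ j, j ∈ᴹ i → app f j = j := fun j hj => ih j hj (hm.1 i hi j hj)
  rcases (hm.mem hi).trichotomy (hn.mem (hf.app_mem hi)) with hlt | heq | hgt
  · obtain ⟨j, hj, hji⟩ := hsurj i (hn.1 _ (hf.app_mem hi) i hlt)
    rcases (hm.mem hi).trichotomy (hm.mem hj) with hij | rfl | hij
    · have hlt' := hf.app_mem_app hi hj hij
      rw [hji] at hlt'
      exact absurd hlt (not_mem_of_mem hlt')
    · exact hji
    · exact absurd ((ih j hij).symm.trans hji ▸ hij) (not_mem_self _)
  · exact heq.symm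
  · have := hf.app_mem_app (hm.1 i hi _ hgt) hi hgt
    rw [ih _ hgt] at this
    exact absurd this (not_mem_self _)

theorem NatHom.eq_of_surj {m n f : M} (hf : NatHom m n f)
    (hsurj : ∀ j, j ∈ᴹ n → ∃ i, i ∈ᴹ m ∧ app f i = j) : m = n := by
  refine set_ext fun i => ⟨fun hi => hf.app_eq_self hsurj i hi ▸ hf.app_mem hi, fun hi => ?_⟩
  obtain ⟨j, hj, rfl⟩ := hsurj i hi
  rwa [hf.app_eq_self hsurj j hj]

namespace Enum

theorem lt_iff (h : Enum X a n e) (hX : X.IsLinear) {i j : M} (hi : i ∈ᴹ n) (hj : j ∈ᴹ n) :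
    X.lt (app e i) (app e j) ↔ i ∈ᴹ j := by
  refine ⟨fun hlt => ?_, h.lt hi hj⟩
  have hn := isOrd_of_mem_om h.size_mem_om
  have hi' := h.mem (h.app_mem hi)
  have hj' := h.mem (h.app_mem hj)
  rcases (hn.mem hi).trichotomy (hn.mem hj) with hij | rfl | hij
  · exact hij
  · exact absurd hlt (hX.irrefl hi')
  · exact absurd (h.lt hj hi hij) (hX.asymm hi' hj' hlt)

theorem inj (h : Enum X a n e) (hX : X.IsLinear) {i j : M} (hi : i ∈ᴹ n) (hj : j ∈ᴹ n)
    (hij : app e i = app e j) : i = j := by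
  have hn := isOrd_of_mem_om h.size_mem_om
  have hirrefl := hX.irrefl (h.mem (h.app_mem hi))
  rcases (hn.mem hi).trichotomy (hn.mem hj) with hlt | heq | hgt
  · exact absurd (hij.symm ▸ h.lt hi hj hlt :) hirrefl
  · exact heq
  · exact absurd (hij.symm ▸ h.lt hj hi hgt :) hirrefl

theorem image (h : Enum X a n e) {F : M → M} (hF : IsPR M F) (hmem : ∀ x, x ∈ᴹ a → Y.mem (F x))
    (hlt : ∀ x y, x ∈ᴹ a → y ∈ᴹ a → X.lt x y → Y.lt (F x) (F y)) {b : M}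
    (hb : ∀ y, y ∈ᴹ b ↔ ∃ x, x ∈ᴹ a ∧ y = F x) :
    ∃ e', Enum Y b n e' ∧ ∀ i, i ∈ᴹ n → app e' i = F (app e i) := by
  obtain ⟨e', he', happ⟩ := exists_fun n (F := fun i => F (app e i)) (by fun_prop)
  refine ⟨e', ⟨h.size_mem_om, he', fun y hy => ?_, fun y => ?_, fun i j hi hj hij => ?_⟩, happ⟩
  · obtain ⟨x, hx, rfl⟩ := (hb y).1 hy
    exact hmem x hx
  · rw [hb]
    constructor
    · rintro ⟨x, hx, rfl⟩
      obtain ⟨i, hi, rfl⟩ := h.mem_iff.1 hx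
      exact ⟨i, hi, (happ i hi).symm⟩
    · rintro ⟨i, hi, rfl⟩
      exact ⟨_, h.app_mem hi, happ i hi⟩
  · rw [happ i hi, happ j hj]
    exact hlt _ _ (h.app_mem hi) (h.app_mem hj) (h.lt hi hj hij)

theorem fun_mem_univ (h : Enum X a n e) {U : M} (hU : IsUniv U) (ha : ∀ x, x ∈ᴹ a → x ∈ᴹ U) :
    e ∈ᴹ U :=
  hU.finite_fun_mem h.size_mem_om h.isFunOn fun _ hi => ha _ (h.app_mem hi)

theorem set_mem_univ (h : Enum X a n e) {U : M} (hU : IsUniv U) (ha : ∀ x, x ∈ᴹ a → x ∈ᴹ U) :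
    a ∈ᴹ U :=
  hU.finite_image_mem (F := app e) (by fun_prop) h.size_mem_om
    (fun _ hi => ha _ (h.app_mem hi)) fun _ => h.mem_iff

open Classical in
theorem append (h : Enum X a n e) {y : M} (hy : X.mem y) (hlt : ∀ x, x ∈ᴹ a → X.lt x y) :
    ∃ e', Enum X (adj a y) (adj n n) e' := by
  obtain ⟨e', he', happ⟩ := exists_fun (adj n n) (F := fun i => if i ∈ᴹ n then app e i else y)
    (by fun_prop)
  have happ_of_mem : ∀ i, i ∈ᴹ n → app e' i = app e i := fun i hi => by
    rw [happ i (by simp [hi]), if_pos hi]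
  have happ_last : app e' n = y := by rw [happ n (by simp), if_neg (not_mem_self n)]
  refine ⟨e', succ_mem_om h.size_mem_om, he', fun x hx => ?_, fun x => ?_,
    fun i j hi hj hij => ?_⟩
  · rcases mem_adj.1 hx with hx | rfl
    · exact h.mem hx
    · exact hy
  · simp only [mem_adj, or_and_right, exists_or, exists_eq_left, happ_last, h.mem_iff]
    exact or_congr_left (exists_congr fun i => and_congr_right fun hi => by rw [happ_of_mem i hi])
  · rcases mem_adj.1 hj with hj | rfl
    · have hi' := (isOrd_of_mem_om h.size_mem_om).1 _ hj _ hij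
      rw [happ_of_mem i hi', happ_of_mem j hj]
      exact h.lt hi' hj hij
    · rw [happ_of_mem i hij, happ_last]
      exact hlt _ (h.app_mem hij)

theorem restrict (h : Enum X a (adj n n) e) (hn : n ∈ᴹ om) : ∃ a' e', Enum X a' n e' ∧
    a = adj a' (app e n) ∧ ∀ x, x ∈ᴹ a' → X.lt x (app e n) := by
  obtain ⟨a', ha'⟩ := exists_image n (F := app e) (by fun_prop)
  obtain ⟨e', he', happ⟩ := exists_fun n (F := app e) (by fun_prop)
  refine ⟨a', e', ⟨hn, he', fun x hx => ?_, fun x => ?_, fun i j hi hj hij => ?_⟩,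
    set_ext fun x => ?_, fun x hx => ?_⟩
  · obtain ⟨i, hi, rfl⟩ := (ha' x).1 hx
    exact h.mem (h.app_mem (by simp [hi]))
  · rw [ha']
    exact exists_congr fun i => and_congr_right fun hi => by rw [happ i hi]
  · rw [happ i hi, happ j hj]
    exact h.lt (by simp [hi]) (by simp [hj]) hij
  · simp only [h.mem_iff, mem_adj, ha', or_and_right, exists_or, exists_eq_left]
  · obtain ⟨i, hi, rfl⟩ := (ha' x).1 hx
    exact h.lt (by simp [hi]) (by simp) hi

theorem exists_natHom (h : Enum X a n e) {b m e' : M} (h' : Enum X b m e') (hX : X.IsLinear)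
    (hab : ∀ x, x ∈ᴹ a → x ∈ᴹ b) :
    ∃ f, NatHom n m f ∧ ∀ i, i ∈ᴹ n → app e' (app f i) = app e i := by
  obtain ⟨f, hf, happ⟩ := exists_fun_of_rel n m (R := fun i j => j ∈ᴹ m ∧ app e' j = app e i)
    (by fun_prop)
    (fun i hi => by
      obtain ⟨j, hj, e⟩ := h'.mem_iff.1 (hab _ (h.app_mem hi))
      exact ⟨j, hj, hj, e.symm⟩)
    (fun i j j' _ hj hj' => h'.inj hX hj.1 hj'.1 (hj.2.trans hj'.2.symm))
  refine ⟨f, ⟨h.size_mem_om, h'.size_mem_om, hf, fun i hi => (happ i hi).1,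
    fun i j hi hj hij => ?_⟩, fun i hi => (happ i hi).2.2⟩
  rw [← h'.lt_iff hX (happ i hi).1 (happ j hj).1, (happ i hi).2.2, (happ j hj).2.2]
  exact h.lt hi hj hij

theorem unique (h : Enum X a n e) {m e' : M} (h' : Enum X a m e') (hX : X.IsLinear) :
    n = m ∧ e = e' := by
  obtain ⟨f, hf, hcomm⟩ := h.exists_natHom h' hX fun _ => id
  have hsurj : ∀ j, j ∈ᴹ m → ∃ i, i ∈ᴹ n ∧ app f i = j := fun j hj => by
    obtain ⟨i, hi, hij⟩ := h.mem_iff.1 (h'.app_mem hj)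
    exact ⟨i, hi, h'.inj hX (hf.app_mem hi) hj ((hcomm i hi).trans hij.symm)⟩
  obtain rfl := hf.eq_of_surj hsurj
  exact ⟨rfl, h.isFunOn.ext h'.isFunOn fun i hi => by
    rw [← hcomm i hi, hf.app_eq_self hsurj i hi]⟩

theorem natHom_unique {m f g c e' : M} (he' : Enum X c m e') (hX : X.IsLinear)
    (hf : NatHom n m f) (hg : NatHom n m g)
    (h : ∀ i, i ∈ᴹ n → app e' (app f i) = app e' (app g i)) : f = g :=
  hf.ext hg fun i hi => he'.inj hX (hf.app_mem hi) (hg.app_mem hi) (h i hi)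

end Enum

theorem finSub_empty : FinSub X (empty : M) := by
  obtain ⟨e, he, -⟩ := exists_fun (empty : M) (F := fun x => x) (by fun_prop)
  exact ⟨empty, e, by simp, he, by simp, by simp, by simp⟩

theorem FinSub.append (ha : FinSub X a) {y : M} (hy : X.mem y) (hlt : ∀ x, x ∈ᴹ a → X.lt x y) :
    FinSub X (adj a y) := by
  obtain ⟨n, e, ha⟩ := ha
  obtain ⟨e', h⟩ := ha.append hy hlt
  exact h.finSub

omit [ModelsPRS M] in
theorem FinSub.mem (ha : FinSub X a) {x : M} (hx : x ∈ᴹ a) : X.mem x := by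
  obtain ⟨n, e, ha⟩ := ha
  exact ha.mem hx

/-! ### Primitive recursive orders -/

variable {Γ Δ : Type*} [TupleCoded M Γ] [TupleCoded M Δ]

/-- A family of orders whose underlying classes and relations are uniformly primitive recursive. -/
@[fun_prop]
structure IsPROrder (X : Γ → ClassOrder M) : Prop where
  mem : IsPR M (fun z : Γ × M => (X z.1).mem z.2)
  lt : IsPR M (fun z : Γ × M × M => (X z.1).lt z.2.1 z.2.2)

@[fun_prop]
theorem IsPROrder.comp {X : Δ → ClassOrder M} {f : Γ → Δ} (hX : IsPROrder X) (hf : IsPR M f) :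
    IsPROrder (fun z => X (f z)) :=
  ⟨hX.mem.comp (f := fun z : Γ × M => (f z.1, z.2)) (by fun_prop),
    hX.lt.comp (f := fun z : Γ × M × M => (f z.1, z.2)) (by fun_prop)⟩

namespace IsPR

variable {X Y : Γ → ClassOrder M} {x y a n e : Γ → M}

@[fun_prop]
theorem order_mem (hX : IsPROrder X) (hx : IsPR M x) : IsPR M (fun z => (X z).mem (x z)) :=
  hX.mem.comp (f := fun z => (z, x z)) (by fun_prop)

@[fun_prop]
theorem order_lt (hX : IsPROrder X) (hx : IsPR M x) (hy : IsPR M y) :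
    IsPR M (fun z => (X z).lt (x z) (y z)) :=
  hX.lt.comp (f := fun z => (z, x z, y z)) (by fun_prop)

@[fun_prop]
theorem isPROrder_ordOrder (hx : IsPR M x) : IsPROrder (fun z => ordOrder (x z)) :=
  ⟨by unfold ordOrder; fun_prop, by unfold ordOrder; fun_prop⟩

@[fun_prop]
theorem isPROrder_add (hX : IsPROrder X) (hY : IsPROrder Y) :
    IsPROrder (fun z => (X z).add (Y z)) := by
  refine ⟨?_, ?_⟩
  · refine congr (Q := fun z : Γ × M =>
      (∃ c x, z.2 = ATRSet.pair c x ∧ c = empty ∧ (X z.1).mem x) ∨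
      (∃ c y, z.2 = ATRSet.pair c y ∧ c = ATRSet.adj empty empty ∧ (Y z.1).mem y))
      (by fun_prop) fun z => ?_
    simp only [ClassOrder.add]
    grind
  · refine congr (Q := fun z : Γ × M × M =>
      ∃ c x, z.2.1 = ATRSet.pair c x ∧ ∃ d y, z.2.2 = ATRSet.pair d y ∧
        (c = empty ∧ d = empty ∧ (X z.1).lt x y ∨ c = empty ∧ d = ATRSet.adj empty empty ∨
          c = ATRSet.adj empty empty ∧ d = ATRSet.adj empty empty ∧ (Y z.1).lt x y))
      (by fun_prop) fun z => ?_
    simp only [ClassOrder.add]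
    grind

@[fun_prop]
theorem enum (hX : IsPROrder X) (ha : IsPR M a) (hn : IsPR M n) (he : IsPR M e) :
    IsPR M (fun z => Enum (X z) (a z) (n z) (e z)) := by
  refine congr (Q := fun z => n z ∈ᴹ om ∧ IsFunOn (e z) (n z) ∧ (∀ x, x ∈ᴹ a z → (X z).mem x) ∧
    ((∀ x, x ∈ᴹ a z → ∃ i, i ∈ᴹ n z ∧ x = ATRSet.app (e z) i) ∧
      ∀ i, i ∈ᴹ n z → ATRSet.app (e z) i ∈ᴹ a z) ∧
    ∀ i, i ∈ᴹ n z → ∀ j, j ∈ᴹ n z → i ∈ᴹ j →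
      (X z).lt (ATRSet.app (e z) i) (ATRSet.app (e z) j)) (by fun_prop) fun z => ?_
  unfold Enum
  grind

@[fun_prop]
theorem finSub (hX : IsPROrder X) (ha : IsPR M a) : IsPR M (fun z => FinSub (X z) (a z)) := by
  refine congr (Q := fun z => ∃ n, n ∈ᴹ om ∧ ∃ e, e ∈ᴹ ATRSet.univ (a z) ∧ Enum (X z) (a z) n e)
    (by fun_prop) fun z => ⟨fun ⟨n, e, h⟩ => ⟨n, h.size_mem_om, e, ?_, h⟩,
      fun ⟨n, _, e, _, h⟩ => ⟨n, e, h⟩⟩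
  have hU := isUniv_univ (a z)
  exact h.fun_mem_univ hU fun x hx => hU.mem_of_mem (mem_univ_self _) hx

end IsPR

/-- `X` is a linear order with primitive recursive order relation on a primitive recursive
subclass of a set. -/
structure SmallLinear (X : ClassOrder M) : Prop where
  isLinear : X.IsLinear
  bdd : ∃ A, ∀ x, X.mem x → x ∈ᴹ A
  pr_mem : IsPR M X.mem
  pr_lt : IsPR M (fun z : M × M => X.lt z.1 z.2)

namespace SmallLinear

@[fun_prop]
theorem isPROrder (hX : SmallLinear X) : IsPROrder (fun _ : Γ => X) :=
  ⟨hX.pr_mem.comp (by fun_prop), hX.pr_lt.comp (f := fun z : Γ × M × M => z.2) (by fun_prop)⟩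

theorem finSub_induction (hX : SmallLinear X) {P : M → Prop} (hP : IsPR M P) (empty : P empty)
    (adj : ∀ a y, FinSub X a → X.mem y → (∀ x, x ∈ᴹ a → X.lt x y) → P a → P (adj a y)) :
    ∀ a, FinSub X a → P a := by
  obtain ⟨A, hA⟩ := hX.bdd
  have hU := isUniv_univ A
  have hAU : ∀ x, X.mem x → x ∈ᴹ univ A := fun x hx => hU.mem_of_mem (mem_univ_self A) (hA x hx)
  have h_size : ∀ n, n ∈ᴹ om → ∀ a, a ∈ᴹ univ A → ∀ e, e ∈ᴹ univ A → Enum X a n e → P a := by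
    refine om_induction
      (P := fun n => ∀ a, a ∈ᴹ univ A → ∀ e, e ∈ᴹ univ A → Enum X a n e → P a)
      (by fun_prop (disch := assumption)) (fun a _ e _ h => ?_) (fun n hn ih a _ e _ h => ?_)
    · rwa [show a = ATRSet.empty from set_ext fun x => by simp [h.mem_iff]]
    · obtain ⟨a', e', h', rfl, hlt⟩ := h.restrict hn
      have ha'U : ∀ x, x ∈ᴹ a' → x ∈ᴹ univ A := fun x hx => hAU x (h'.mem hx)
      exact adj _ _ h'.finSub (h.mem (by simp)) hlt
        (ih a' (h'.set_mem_univ hU ha'U) e' (h'.fun_mem_univ hU ha'U) h')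
  rintro a ⟨n, e, h⟩
  have haU : ∀ x, x ∈ᴹ a → x ∈ᴹ univ A := fun x hx => hAU x (h.mem hx)
  exact h_size n h.size_mem_om a (h.set_mem_univ hU haU) e (h.fun_mem_univ hU haU) h

theorem finSub_adj (hX : SmallLinear X) {x : M} (ha : FinSub X a) (hx : X.mem x) :
    FinSub X (adj a x) := by
  refine hX.finSub_induction (P := fun a => FinSub X (adj a x))
    (by fun_prop (disch := assumption))
    (finSub_empty.append hx (by simp)) (fun a y ha hy hlt ih => ?_) a ha
  rcases hX.isLinear.trichotomy hx hy with hxy | rfl | hyx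
  · rw [show adj (adj a y) x = adj (adj a x) y from set_ext fun z => by simp [or_right_comm]]
    refine ih.append hy fun z hz => ?_
    rcases mem_adj.1 hz with hz | rfl
    · exact hlt z hz
    · exact hxy
  · rwa [show adj (adj a x) x = adj a x from set_ext fun z => by simp]
  · refine (ha.append hy hlt).append hx fun z hz => ?_
    rcases mem_adj.1 hz with hz | rfl
    · exact hX.isLinear.trans (ha.mem hz) hy hx (hlt z hz) hyx
    · exact hyx

theorem finSub_cup (hX : SmallLinear X) {b : M} (ha : FinSub X a) (hb : FinSub X b) :
    FinSub X (cup a b) := by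
  refine hX.finSub_induction (P := fun b => FinSub X (cup a b))
    (by fun_prop (disch := assumption)) ?_ (fun b y _ hy _ ih => ?_) b hb
  · rwa [show cup a empty = a from set_ext fun z => by simp]
  · rw [show cup a (adj b y) = adj (cup a b) y from set_ext fun z => by simp [or_assoc]]
    exact hX.finSub_adj ih hy

end SmallLinear

theorem smallLinear_ordOrder {α : M} (hα : IsOrd α) : SmallLinear (ordOrder α) :=
  ⟨isLinear_ordOrder hα, ⟨α, fun _ h => h⟩, by unfold ordOrder; fun_prop,
    by unfold ordOrder; fun_prop⟩

/-! ### Sums of two orders -/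

@[simp] theorem add_mem_left {x : M} : (X.add Y).mem (pair empty x) ↔ X.mem x := by
  simp [ClassOrder.add, empty_ne_one]

@[simp] theorem add_mem_right {x : M} : (X.add Y).mem (pair (adj empty empty) x) ↔ Y.mem x := by
  simp [ClassOrder.add, empty_ne_one.symm]

@[simp] theorem add_lt_left {x y : M} :
    (X.add Y).lt (pair empty x) (pair empty y) ↔ X.lt x y := by
  simp [ClassOrder.add, empty_ne_one]

@[simp] theorem add_lt_right {x y : M} :
    (X.add Y).lt (pair (adj empty empty) x) (pair (adj empty empty) y) ↔ Y.lt x y := by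
  simp [ClassOrder.add, empty_ne_one.symm]

@[simp] theorem add_lt_left_right {x y : M} :
    (X.add Y).lt (pair empty x) (pair (adj empty empty) y) := by
  simp [ClassOrder.add]

@[simp] theorem not_add_lt_right_left {x y : M} :
    ¬ (X.add Y).lt (pair (adj empty empty) x) (pair empty y) := by
  simp [ClassOrder.add, empty_ne_one, empty_ne_one.symm]

theorem ClassOrder.IsLinear.add (hX : X.IsLinear) (hY : Y.IsLinear) : (X.add Y).IsLinear := by
  refine ⟨?_, ?_, ?_⟩
  · rintro _ (⟨x, hx, rfl⟩ | ⟨x, hx, rfl⟩)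
    · simpa using hX.irrefl hx
    · simpa using hY.irrefl hx
  · rintro _ _ _ (⟨x, hx, rfl⟩ | ⟨x, hx, rfl⟩) (⟨y, hy, rfl⟩ | ⟨y, hy, rfl⟩)
      (⟨z, hz, rfl⟩ | ⟨z, hz, rfl⟩)
    · simpa using hX.trans hx hy hz
    iterate 6 simp
    · simpa using hY.trans hx hy hz
  · rintro _ _ (⟨x, hx, rfl⟩ | ⟨x, hx, rfl⟩) (⟨y, hy, rfl⟩ | ⟨y, hy, rfl⟩)
    · simpa using hX.trichotomy hx hy
    iterate 2 simp
    · simpa using hY.trichotomy hx hy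

theorem SmallLinear.add (hX : SmallLinear X) (hY : SmallLinear Y) : SmallLinear (X.add Y) := by
  obtain ⟨A, hA⟩ := hX.bdd
  obtain ⟨B, hB⟩ := hY.bdd
  refine ⟨hX.isLinear.add hY.isLinear, ⟨univ (pair A B), ?_⟩,
    IsPR.order_mem (IsPR.isPROrder_add hX.isPROrder hY.isPROrder) (by fun_prop),
    IsPR.order_lt (IsPR.isPROrder_add hX.isPROrder hY.isPROrder) (by fun_prop) (by fun_prop)⟩
  have hU := isUniv_univ (pair A B)
  obtain ⟨hAU, hBU⟩ := hU.pair_mem_iff.1 (mem_univ_self (pair A B))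
  rintro z (⟨x, hx, rfl⟩ | ⟨x, hx, rfl⟩)
  · exact hU.pair hU.empty (hU.mem_of_mem hAU (hA x hx))
  · exact hU.pair (hU.adj hU.empty hU.empty) (hU.mem_of_mem hBU (hB x hx))

end

section

variable {M : Type u} [SetStructure M]

/-! ### The extension of a predilator to linear orders -/

namespace InclHom

variable {X : ClassOrder M} {a b m n f : M}

theorem natHom (h : InclHom X a b m n f) : NatHom m n f := h.1

theorem enum_left (h : InclHom X a b m n f) : ∃ e, Enum X a m e :=
  let ⟨e, _, he, _⟩ := h.2; ⟨e, he⟩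

theorem enum_right (h : InclHom X a b m n f) : ∃ e, Enum X b n e :=
  let ⟨_, e, _, he, _⟩ := h.2; ⟨e, he⟩

theorem subset (h : InclHom X a b m n f) {x : M} (hx : x ∈ᴹ a) : x ∈ᴹ b := by
  obtain ⟨hf, e₁, e₂, he₁, he₂, hfe⟩ := h
  obtain ⟨i, hi, rfl⟩ := he₁.mem_iff.1 hx
  exact hfe i hi ▸ he₂.app_mem (hf.app_mem hi)

variable [ModelsPRS M]

theorem unique (h : InclHom X a b m n f) {m' n' f' : M} (h' : InclHom X a b m' n' f')
    (hX : X.IsLinear) : m = m' ∧ n = n' ∧ f = f' := by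
  obtain ⟨hf, e₁, e₂, he₁, he₂, hfe⟩ := h
  obtain ⟨hf', e₁', e₂', he₁', he₂', hfe'⟩ := h'
  obtain ⟨rfl, rfl⟩ := he₁.unique he₁' hX
  obtain ⟨rfl, rfl⟩ := he₂.unique he₂' hX
  exact ⟨rfl, rfl, he₂.natHom_unique hX hf hf' fun i hi => (hfe i hi).trans (hfe' i hi).symm⟩

theorem app_comp (h : InclHom X a b m n f) (hX : X.IsLinear) {c k g l : M}
    (hg : InclHom X b c n k g) (hl : InclHom X a c m k l) :
    ∀ i, i ∈ᴹ m → app l i = app g (app f i) := by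
  obtain ⟨hf, e₁, e₂, he₁, he₂, hfe⟩ := h
  obtain ⟨hg, e₂', e₃, he₂', he₃, hge⟩ := hg
  obtain ⟨hl, e₁', e₃', he₁', he₃', hle⟩ := hl
  obtain ⟨-, rfl⟩ := he₁.unique he₁' hX
  obtain ⟨-, rfl⟩ := he₂.unique he₂' hX
  obtain ⟨-, rfl⟩ := he₃.unique he₃' hX
  intro i hi
  refine he₃.inj hX (hl.app_mem hi) (hg.app_mem (hf.app_mem hi)) ?_
  rw [hle i hi, hge _ (hf.app_mem hi), hfe i hi]

theorem image (h : InclHom X a b m n f) {Y : ClassOrder M} {F : M → M} (hF : IsPR M F)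
    (hmem : ∀ x, x ∈ᴹ b → Y.mem (F x))
    (hlt : ∀ x y, x ∈ᴹ b → y ∈ᴹ b → X.lt x y → Y.lt (F x) (F y))
    {a' b' : M} (ha' : ∀ y, y ∈ᴹ a' ↔ ∃ x, x ∈ᴹ a ∧ y = F x)
    (hb' : ∀ y, y ∈ᴹ b' ↔ ∃ x, x ∈ᴹ b ∧ y = F x) :
    InclHom Y a' b' m n f := by
  have hab : ∀ x, x ∈ᴹ a → x ∈ᴹ b := fun x => h.subset
  obtain ⟨hf, e, e', he, he', hfe⟩ := h
  obtain ⟨e₁, he₁, he₁_app⟩ := he.image hF (fun x hx => hmem x (hab x hx))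
    (fun x y hx hy => hlt x y (hab x hx) (hab y hy)) ha'
  obtain ⟨e₂, he₂, he₂_app⟩ := he'.image hF hmem hlt hb'
  exact ⟨hf, e₁, e₂, he₁, he₂, fun i hi => by
    rw [he₂_app _ (hf.app_mem hi), hfe i hi, he₁_app i hi]⟩

end InclHom

namespace Predil

/-- The axioms of a predilator that suffice for the extension to linear orders. -/
structure IsWeakPredilator (D : Predil M) : Prop where
  linear : ∀ {n}, n ∈ᴹ om → (D.ob n).IsLinear
  map_fun : ∀ {m n f σ}, NatHom m n f → D.El m σ → ∃! τ, D.map m n f σ τ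
  map_mem : ∀ {m n f σ τ}, NatHom m n f → D.El m σ → D.map m n f σ τ → D.El n τ
  map_lt : ∀ {m n f σ σ' τ τ'}, NatHom m n f → D.El m σ → D.El m σ' →
    D.map m n f σ τ → D.map m n f σ' τ' → D.lt m σ σ' → D.lt n τ τ'
  map_comp : ∀ {k m n f g h ρ σ τ}, NatHom k m f → NatHom m n g → NatHom k n h →
    (∀ i, i ∈ᴹ k → app h i = app g (app f i)) → D.El k ρ →
    D.map k m f ρ σ → D.map m n g σ τ → D.map k n h ρ τ
  supp_sub : ∀ {n σ i}, n ∈ᴹ om → D.El n σ → D.supp n σ i → i ∈ᴹ n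
  supp_nat : ∀ {m n f σ τ}, NatHom m n f → D.El m σ → D.map m n f σ τ →
    ∀ j, D.supp n τ j ↔ ∃ i, D.supp m σ i ∧ app f i = j

theorem IsPredilator.isWeakPredilator {D : Predil M} (h : D.IsPredilator) : D.IsWeakPredilator :=
  ⟨h.linear _, h.map_fun _ _ _ _, h.map_mem _ _ _ _ _, h.map_lt _ _ _ _ _ _ _,
    h.map_comp _ _ _ _ _ _ _ _ _, h.supp_sub _ _ _, h.supp_nat _ _ _ _ _⟩

namespace IsWeakPredilator

variable {D : Predil M} (hD : D.IsWeakPredilator) {m n f σ σ' τ τ' : M}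
include hD

theorem map_lt_iff (hf : NatHom m n f) (hσ : D.El m σ) (hσ' : D.El m σ')
    (hτ : D.map m n f σ τ) (hτ' : D.map m n f σ' τ') : D.lt m σ σ' ↔ D.lt n τ τ' := by
  refine ⟨hD.map_lt hf hσ hσ' hτ hτ', fun hlt => ?_⟩
  have hEl := hD.map_mem hf hσ hτ
  have hEl' := hD.map_mem hf hσ' hτ'
  have hlin := hD.linear hf.cod_mem_om
  rcases (hD.linear hf.dom_mem_om).trichotomy hσ hσ' with h | rfl | h
  · exact h
  · rw [(hD.map_fun hf hσ).unique hτ hτ'] at hlt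
    exact absurd hlt (hlin.irrefl hEl')
  · exact absurd (hD.map_lt hf hσ' hσ hτ' hτ h) (hlin.asymm hEl hEl' hlt)

theorem map_inj (hf : NatHom m n f) (hσ : D.El m σ) (hσ' : D.El m σ')
    (hτ : D.map m n f σ τ) (hτ' : D.map m n f σ' τ) : σ = σ' := by
  have hirrefl := (hD.linear hf.cod_mem_om).irrefl (hD.map_mem hf hσ hτ)
  rcases (hD.linear hf.dom_mem_om).trichotomy hσ hσ' with h | h | h
  · exact absurd (hD.map_lt hf hσ hσ' hτ hτ' h) hirrefl
  · exact h
  · exact absurd (hD.map_lt hf hσ' hσ hτ' hτ h) hirrefl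

end IsWeakPredilator

@[simp] theorem extSupp_pair [ModelsPRS M] {σ a x : M} : extSupp (pair σ a) x ↔ x ∈ᴹ a := by
  simp [extSupp]

theorem mem_of_extSupp [ModelsPRS M] {D : Predil M} {X : ClassOrder M} {p x : M}
    (hp : (D.ext X).mem p) (hx : extSupp p x) : X.mem x := by
  obtain ⟨σ, a, n, e, rfl, he, -⟩ := hp
  exact he.mem (extSupp_pair.1 hx)

theorem exists_finSub_extSupp [ModelsPRS M] {D : Predil M} {X : ClassOrder M} {p : M}
    (hp : (D.ext X).mem p) : ∃ a, FinSub X a ∧ ∀ x, extSupp p x ↔ x ∈ᴹ a := by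
  obtain ⟨σ, a, n, e, rfl, he, -⟩ := hp
  exact ⟨a, he.finSub, fun x => extSupp_pair⟩

/-- The element `p` of `D(X)` has support contained in the finite subset `c` of `X`, and it is the
image of the element `v` of `D(n)`, for `n = |c|`, under the increasing enumeration of `c`. -/
def IsValue (D : Predil M) (X : ClassOrder M) (c n p v : M) : Prop :=
  ∃ σ a k f, p = pair σ a ∧ D.Tr σ k ∧ InclHom X a c k n f ∧ D.map k n f σ v

section

variable {D : Predil M} {X : ClassOrder M} {c n p q v w : M}

namespace IsValue

theorem size_mem_om (h : D.IsValue X c n p v) : n ∈ᴹ om := by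
  obtain ⟨σ, a, k, f, -, -, hf, -⟩ := h
  exact hf.natHom.cod_mem_om

theorem mem (h : D.IsValue X c n p v) : (D.ext X).mem p := by
  obtain ⟨σ, a, k, f, rfl, hσ, hf, -⟩ := h
  obtain ⟨e, he⟩ := hf.enum_left
  exact ⟨σ, a, k, e, rfl, he, hσ⟩

theorem el (h : D.IsValue X c n p v) (hD : D.IsWeakPredilator) : D.El n v := by
  obtain ⟨σ, a, k, f, -, hσ, hf, hv⟩ := h
  exact hD.map_mem hf.natHom hσ.2.1 hv

variable [ModelsPRS M]

theorem map (h : D.IsValue X c n p v) {d m g : M} (h' : D.IsValue X d m p w)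
    (hg : InclHom X c d n m g) (hD : D.IsWeakPredilator) (hX : X.IsLinear) :
    D.map n m g v w := by
  obtain ⟨σ, a, k, f, rfl, hσ, hf, hv⟩ := h
  obtain ⟨τ, b, l, f', hp, -, hf', hw⟩ := h'
  obtain ⟨rfl, rfl⟩ := pair_inj.1 hp
  obtain ⟨w', hw', -⟩ := hD.map_fun hg.natHom (hD.map_mem hf.natHom hσ.2.1 hv)
  obtain ⟨e, he⟩ := hf.enum_left
  obtain ⟨e', he'⟩ := hf'.enum_left
  obtain ⟨rfl, -⟩ := he.unique he' hX
  have hw'' := hD.map_comp hf.natHom hg.natHom hf'.natHom (hf.app_comp hX hg hf') hσ.2.1 hv hw'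
  rwa [(hD.map_fun hf'.natHom hσ.2.1).unique hw hw'']

theorem extSupp_iff (h : D.IsValue X c n p v) (hD : D.IsWeakPredilator) {e : M}
    (he : Enum X c n e) (hX : X.IsLinear) {x : M} :
    extSupp p x ↔ ∃ i, D.supp n v i ∧ app e i = x := by
  obtain ⟨σ, a, k, f, rfl, hσ, ⟨hf, e', e'', he', he'', hfe⟩, hv⟩ := h
  obtain ⟨-, rfl⟩ := he.unique he'' hX
  simp only [extSupp_pair, he'.mem_iff, hD.supp_nat hf hσ.2.1 hv]
  constructor
  · rintro ⟨i, hi, rfl⟩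
    exact ⟨_, ⟨i, hσ.2.2 i hi, rfl⟩, hfe i hi⟩
  · rintro ⟨-, ⟨i, hi, rfl⟩, rfl⟩
    have hi' := hD.supp_sub hσ.1 hσ.2.1 hi
    exact ⟨i, hi', hfe i hi'⟩

theorem injective (h : D.IsValue X c n p v) (h' : D.IsValue X c n q v) (hD : D.IsWeakPredilator)
    (hX : X.IsLinear) : p = q := by
  have hsupp : ∀ x, extSupp p x ↔ extSupp q x := fun x => by
    obtain ⟨σ, a, k, f, -, -, hf, -⟩ := id h
    obtain ⟨e, he⟩ := hf.enum_right
    rw [h.extSupp_iff hD he hX, h'.extSupp_iff hD he hX]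
  obtain ⟨σ, a, k, f, rfl, hσ, hf, hv⟩ := h
  obtain ⟨τ, b, m, g, rfl, hτ, hg, hw⟩ := h'
  obtain rfl : a = b := set_ext fun x => by simpa using hsupp x
  obtain ⟨rfl, -, rfl⟩ := hf.unique hg hX
  rw [hD.map_inj hf.natHom hσ.2.1 hτ.2.1 hv hw]

end IsValue

variable [ModelsPRS M]

theorem exists_isValue (hD : D.IsWeakPredilator) (hX : X.IsLinear) (hp : (D.ext X).mem p) {e : M}
    (hc : Enum X c n e) (hpc : ∀ x, extSupp p x → x ∈ᴹ c) : ∃ v, D.IsValue X c n p v := by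
  obtain ⟨σ, a, k, e', rfl, ha, hσ⟩ := hp
  obtain ⟨f, hf, hfe⟩ := ha.exists_natHom hc hX fun x hx => hpc x (extSupp_pair.2 hx)
  obtain ⟨v, hv, -⟩ := hD.map_fun hf hσ.2.1
  exact ⟨v, σ, a, k, f, rfl, hσ, ⟨hf, e', e, ha, hc, hfe⟩, hv⟩

theorem ext_lt_pair_iff (hX : SmallLinear X) {σ a τ b : M}
    (hp : (D.ext X).mem (pair σ a)) (hq : (D.ext X).mem (pair τ b)) :
    (D.ext X).lt (pair σ a) (pair τ b) ↔ ∃ n v w, D.IsValue X (cup a b) n (pair σ a) v ∧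
      D.IsValue X (cup a b) n (pair τ b) w ∧ D.lt n v w := by
  obtain ⟨σ', a', k, e, hpair, he, hσ⟩ := hp
  obtain ⟨rfl, rfl⟩ := pair_inj.1 hpair
  obtain ⟨τ', b', m, e', hpair, he', hτ⟩ := hq
  obtain ⟨rfl, rfl⟩ := pair_inj.1 hpair
  constructor
  · rintro ⟨σ₁, a₁, τ₁, b₁, h₁, h₂, c, k₁, m₁, n, f, g, v, w, hc, hf, hg, hv, hw, hlt⟩
    obtain ⟨rfl, rfl⟩ := pair_inj.1 h₁
    obtain ⟨rfl, rfl⟩ := pair_inj.1 h₂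
    obtain rfl : c = cup a b := set_ext fun x => by rw [hc, mem_cup]
    obtain ⟨e₁, he₁⟩ := hf.enum_left
    obtain ⟨e₂, he₂⟩ := hg.enum_left
    obtain ⟨rfl, -⟩ := he.unique he₁ hX.isLinear
    obtain ⟨rfl, -⟩ := he'.unique he₂ hX.isLinear
    exact ⟨n, v, w, ⟨σ, a, k, f, rfl, hσ, hf, hv⟩, ⟨τ, b, m, g, rfl, hτ, hg, hw⟩, hlt⟩
  · rintro ⟨n, v, w, ⟨σ₁, a₁, k₁, f, h₁, -, hf, hv⟩, ⟨τ₁, b₁, m₁, g, h₂, -, hg, hw⟩, hlt⟩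
    obtain ⟨rfl, rfl⟩ := pair_inj.1 h₁
    obtain ⟨rfl, rfl⟩ := pair_inj.1 h₂
    exact ⟨σ, a, τ, b, rfl, rfl, cup a b, k₁, m₁, n, f, g, v, w, fun x => mem_cup, hf, hg, hv, hw,
      hlt⟩

theorem IsValue.lt_iff (hv : D.IsValue X c n p v) (hw : D.IsValue X c n q w)
    (hD : D.IsWeakPredilator) (hX : SmallLinear X) : (D.ext X).lt p q ↔ D.lt n v w := by
  obtain ⟨σ, a, k, f, rfl, -, hf, -⟩ := id hv
  obtain ⟨τ, b, m, g, rfl, -, hg, -⟩ := id hw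
  obtain ⟨e₁, he₁⟩ := hf.enum_left
  obtain ⟨e₂, he₂⟩ := hg.enum_left
  obtain ⟨e, he⟩ := hf.enum_right
  obtain ⟨n', e', he'⟩ := hX.finSub_cup he₁.finSub he₂.finSub
  obtain ⟨h, hh, hhe⟩ := he'.exists_natHom he hX.isLinear fun x hx =>
    (mem_cup.1 hx).elim hf.subset hg.subset
  have hincl : InclHom X (cup a b) c n' n h := ⟨hh, e', e, he', he, hhe⟩
  have h_iff : ∀ {v' w'}, D.IsValue X (cup a b) n' (pair σ a) v' →
      D.IsValue X (cup a b) n' (pair τ b) w' → (D.lt n' v' w' ↔ D.lt n v w) := fun hv' hw' =>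
    hD.map_lt_iff hh (hv'.el hD) (hw'.el hD) (hv'.map hv hincl hD hX.isLinear)
      (hw'.map hw hincl hD hX.isLinear)
  rw [ext_lt_pair_iff hX hv.mem hw.mem]
  constructor
  · rintro ⟨n₁, v', w', hv', hw', hlt⟩
    obtain ⟨σ₁, a₁, k₁, f₁, -, -, hf₁, -⟩ := id hv'
    obtain ⟨e₃, he₃⟩ := hf₁.enum_right
    obtain ⟨rfl, -⟩ := he'.unique he₃ hX.isLinear
    exact (h_iff hv' hw').1 hlt
  · intro hlt
    obtain ⟨v', hv'⟩ := exists_isValue hD hX.isLinear hv.mem he' fun x hx => by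
      simp [extSupp_pair.1 hx]
    obtain ⟨w', hw'⟩ := exists_isValue hD hX.isLinear hw.mem he' fun x hx => by
      simp [extSupp_pair.1 hx]
    exact ⟨n', v', w', hv', hw', (h_iff hv' hw').2 hlt⟩

theorem exists_isValue₃ (hD : D.IsWeakPredilator) (hX : SmallLinear X) {r : M}
    (hp : (D.ext X).mem p) (hq : (D.ext X).mem q) (hr : (D.ext X).mem r) :
    ∃ c n u v w, D.IsValue X c n p u ∧ D.IsValue X c n q v ∧ D.IsValue X c n r w := by
  obtain ⟨a, ha, hpa⟩ := exists_finSub_extSupp hp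
  obtain ⟨b, hb, hqb⟩ := exists_finSub_extSupp hq
  obtain ⟨c, hc, hrc⟩ := exists_finSub_extSupp hr
  obtain ⟨n, e, he⟩ := hX.finSub_cup (hX.finSub_cup ha hb) hc
  obtain ⟨u, hu⟩ := exists_isValue hD hX.isLinear hp he (by simp_all)
  obtain ⟨v, hv⟩ := exists_isValue hD hX.isLinear hq he (by simp_all)
  obtain ⟨w, hw⟩ := exists_isValue hD hX.isLinear hr he (by simp_all)
  exact ⟨_, n, u, v, w, hu, hv, hw⟩

theorem IsWeakPredilator.ext_isLinear (hD : D.IsWeakPredilator) (hX : SmallLinear X) :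
    (D.ext X).IsLinear := by
  refine ⟨fun p hp => ?_, fun p q r hp hq hr => ?_, fun p q hp hq => ?_⟩
  · obtain ⟨c, n, u, -, -, hu, -, -⟩ := exists_isValue₃ hD hX hp hp hp
    rw [hu.lt_iff hu hD hX]
    exact (hD.linear hu.size_mem_om).irrefl (hu.el hD)
  · obtain ⟨c, n, u, v, w, hu, hv, hw⟩ := exists_isValue₃ hD hX hp hq hr
    rw [hu.lt_iff hv hD hX, hv.lt_iff hw hD hX, hu.lt_iff hw hD hX]
    exact (hD.linear hu.size_mem_om).trans (hu.el hD) (hv.el hD) (hw.el hD)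
  · obtain ⟨c, n, u, v, -, hu, hv, -⟩ := exists_isValue₃ hD hX hp hq hq
    rw [hu.lt_iff hv hD hX, hv.lt_iff hu hD hX]
    refine ((hD.linear hu.size_mem_om).trichotomy (hu.el hD) (hv.el hD)).imp_right
      (Or.imp_left ?_)
    rintro rfl
    exact hu.injective hv hD hX.isLinear

end

/-- The action of the extended functor on a function `F` rather than on a graph: `q` is the value
on `p`. -/
def ExtImage (F : M → M) (p q : M) : Prop := extMap (fun x y => y = F x) p q

section

variable [ModelsPRS M] {D : Predil M} {X Y : ClassOrder M} {F G H : M → M} {σ a p p' q q' r x y : M}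

theorem extImage_pair : ExtImage F (pair σ a) q ↔
    ∃ b, q = pair σ b ∧ ∀ y, y ∈ᴹ b ↔ ∃ x, x ∈ᴹ a ∧ y = F x := by
  simp only [ExtImage, extMap, pair_inj]
  grind

theorem ExtImage.extSupp_iff (h : ExtImage F p q) :
    extSupp q y ↔ ∃ x, extSupp p x ∧ y = F x := by
  obtain ⟨σ, a, b, rfl, rfl, hb⟩ := h
  simp only [extSupp_pair, hb]

theorem ExtImage.unique (h : ExtImage F p q) (h' : ExtImage F p q') : q = q' := by
  obtain ⟨σ, a, b, rfl, rfl, hb⟩ := h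
  obtain ⟨b', rfl, hb'⟩ := extImage_pair.1 h'
  rw [set_ext fun y => (hb y).trans (hb' y).symm]

theorem ExtImage.comp (h : ExtImage F p q) (h' : ExtImage G q r)
    (hH : ∀ x, Predil.extSupp p x → H x = G (F x)) : ExtImage H p r := by
  obtain ⟨σ, a, b, rfl, rfl, hb⟩ := h
  obtain ⟨c, rfl, hc⟩ := extImage_pair.1 h'
  simp only [extSupp_pair] at hH
  refine ⟨σ, a, c, rfl, rfl, fun z => ?_⟩
  simp only [hc, hb]
  grind

theorem ExtImage.symm (h : ExtImage F p q) (hG : ∀ x, Predil.extSupp p x → G (F x) = x) :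
    ExtImage G q p := by
  obtain ⟨σ, a, b, rfl, rfl, hb⟩ := h
  simp only [extSupp_pair] at hG
  refine ⟨σ, b, a, rfl, rfl, fun z => ?_⟩
  simp only [hb]
  grind

theorem exists_extImage (hF : IsPR M F) :
    ∃ A : M → M, IsPR M A ∧ ∀ σ a, ExtImage F (pair σ a) (A (pair σ a)) := by
  obtain ⟨B, hB, hB_mem⟩ := IsPR.exists_image (M := M) (Γ := M) (u := fun p => pairSnd p)
    (F := fun _ x => F x) (by fun_prop) (by fun_prop)
  refine ⟨fun p => pair (pairFst p) (B p), by fun_prop, fun σ a => extImage_pair.2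
    ⟨B (pair σ a), ?_, ?_⟩⟩
  · simp only [pairFst_pair]
  · simpa using hB_mem (pair σ a)

theorem exists_extImage_of_ext_mem (hF : IsPR M F) (hp : (D.ext X).mem p) :
    ∃ q, ExtImage F p q := by
  obtain ⟨A, -, hA⟩ := exists_extImage hF
  obtain ⟨σ, a, n, e, rfl, -, -⟩ := hp
  exact ⟨_, hA σ a⟩

theorem ExtImage.ext_mem (h : ExtImage F p q) (hF : IsPR M F) (hp : (D.ext X).mem p)
    (hmem : ∀ x, Predil.extSupp p x → Y.mem (F x))
    (hlt : ∀ x y, Predil.extSupp p x → Predil.extSupp p y → X.lt x y → Y.lt (F x) (F y)) :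
    (D.ext Y).mem q := by
  obtain ⟨σ, a, k, e, rfl, he, hσ⟩ := hp
  obtain ⟨b, rfl, hb⟩ := extImage_pair.1 h
  simp only [extSupp_pair] at hmem hlt
  obtain ⟨e', he', -⟩ := he.image hF hmem hlt hb
  exact ⟨σ, b, k, e', rfl, he', hσ⟩

theorem ExtImage.ext_lt (h : ExtImage F p q) (h' : ExtImage F p' q') (hF : IsPR M F)
    (hpp' : (D.ext X).lt p p')
    (hmem : ∀ x, Predil.extSupp p x ∨ Predil.extSupp p' x → Y.mem (F x))
    (hlt : ∀ x y, Predil.extSupp p x ∨ Predil.extSupp p' x →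
      Predil.extSupp p y ∨ Predil.extSupp p' y → X.lt x y → Y.lt (F x) (F y)) :
    (D.ext Y).lt q q' := by
  obtain ⟨σ, a, τ, b, rfl, rfl, c, k, m, n, f, g, v, w, hc, hf, hg, hv, hw, hvw⟩ := hpp'
  obtain ⟨a', rfl, ha'⟩ := extImage_pair.1 h
  obtain ⟨b', rfl, hb'⟩ := extImage_pair.1 h'
  obtain ⟨c', hc'⟩ := exists_image c hF
  simp only [extSupp_pair, ← hc] at hmem hlt
  refine ⟨σ, a', τ, b', rfl, rfl, c', k, m, n, f, g, v, w, fun x => ?_,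
    hf.image hF hmem hlt ha' hc', hg.image hF hmem hlt hb' hc', hv, hw, hvw⟩
  rw [hc', ha', hb']
  simp only [hc, or_and_right, exists_or]

theorem extImage_id (hp : (D.ext X).mem p) : ExtImage (fun x => x) p p := by
  obtain ⟨σ, a, n, e, rfl, -, -⟩ := hp
  exact extImage_pair.2 ⟨a, rfl, by simp⟩

theorem ext_mem_of_extSupp (h : (D.ext X).mem p) (hmem : ∀ x, extSupp p x → Y.mem x)
    (hlt : ∀ x y, extSupp p x → extSupp p y → X.lt x y → Y.lt x y) : (D.ext Y).mem p :=
  (extImage_id h).ext_mem (by fun_prop) h hmem hlt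

theorem ext_lt_of_extSupp (hp : (D.ext X).mem p) (hq : (D.ext X).mem q) (h : (D.ext X).lt p q)
    (hmem : ∀ x, extSupp p x ∨ extSupp q x → Y.mem x)
    (hlt : ∀ x y, extSupp p x ∨ extSupp q x → extSupp p y ∨ extSupp q y → X.lt x y → Y.lt x y) :
    (D.ext Y).lt p q :=
  (extImage_id hp).ext_lt (extImage_id hq) (by fun_prop) h hmem hlt

end

end Predil

/-! ### Embeddings -/

/-- `F` is an embedding of the order `X` into the order `Y`. -/
structure ClassOrder.IsEmbedding (X Y : ClassOrder M) (F : M → M) : Prop where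
  mem : ∀ {x}, X.mem x → Y.mem (F x)
  lt : ∀ {x y}, X.mem x → X.mem y → X.lt x y → Y.lt (F x) (F y)

namespace ClassOrder.IsEmbedding

variable {X Y : ClassOrder M} {F : M → M} (h : X.IsEmbedding Y F)
include h

section

variable {x y : M}

omit [SetStructure M] in
theorem lt_iff (hX : X.IsLinear) (hY : Y.IsLinear) (hx : X.mem x) (hy : X.mem y) :
    Y.lt (F x) (F y) ↔ X.lt x y := by
  refine ⟨fun hlt => ?_, h.lt hx hy⟩
  rcases hX.trichotomy hx hy with hxy | rfl | hyx
  · exact hxy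
  · exact absurd hlt (hY.irrefl (h.mem hx))
  · exact absurd (h.lt hy hx hyx) (hY.asymm (h.mem hx) (h.mem hy) hlt)

omit [SetStructure M] in
theorem inj (hX : X.IsLinear) (hY : Y.IsLinear) (hx : X.mem x) (hy : X.mem y) (hxy : F x = F y) :
    x = y := by
  have hirrefl := hY.irrefl (h.mem hx)
  rcases hX.trichotomy hx hy with hlt | heq | hlt
  · have := h.lt hx hy hlt
    exact absurd (hxy ▸ this) hirrefl
  · exact heq
  · have := h.lt hy hx hlt
    exact absurd (hxy ▸ this) hirrefl

end

variable [ModelsPRS M] {D : Predil M} {p p' q q' : M}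

theorem ext_mem (hF : IsPR M F) (hp : (D.ext X).mem p) (hq : Predil.ExtImage F p q) :
    (D.ext Y).mem q :=
  hq.ext_mem hF hp (fun _ hx => h.mem (Predil.mem_of_extSupp hp hx)) fun _ _ hx hy =>
    h.lt (Predil.mem_of_extSupp hp hx) (Predil.mem_of_extSupp hp hy)

theorem ext_lt (hF : IsPR M F) (hp : (D.ext X).mem p) (hp' : (D.ext X).mem p')
    (hq : Predil.ExtImage F p q) (hq' : Predil.ExtImage F p' q') (hlt : (D.ext X).lt p p') :
    (D.ext Y).lt q q' := by
  have hmem : ∀ x, Predil.extSupp p x ∨ Predil.extSupp p' x → X.mem x := fun _ hx =>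
    hx.elim (Predil.mem_of_extSupp hp) (Predil.mem_of_extSupp hp')
  exact hq.ext_lt hq' hF hlt (fun x hx => h.mem (hmem x hx)) fun x y hx hy =>
    h.lt (hmem x hx) (hmem y hy)

end ClassOrder.IsEmbedding

end

section

variable {M : Type u} [SetStructure M]

/-! ### Initial segments -/

/-- `X` is an initial segment of `Y`. -/
structure ClassOrder.IsInitial (X Y : ClassOrder M) : Prop where
  mem : ∀ {x}, X.mem x → Y.mem x
  lt_iff : ∀ {x y}, X.mem x → X.mem y → (X.lt x y ↔ Y.lt x y)
  down : ∀ {x y}, Y.mem x → X.mem y → Y.lt x y → X.mem x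

omit [SetStructure M] in
theorem ClassOrder.IsInitial.refl (X : ClassOrder M) : X.IsInitial X :=
  ⟨id, fun _ _ => Iff.rfl, fun h _ _ => h⟩

omit [SetStructure M] in
theorem ClassOrder.IsEmbedding.of_isInitial {X Y Z : ClassOrder M} {F : M → M}
    (hF : X.IsEmbedding Y F) (hYZ : Y.IsInitial Z) : X.IsEmbedding Z F :=
  ⟨fun hx => hYZ.mem (hF.mem hx), fun hx hy hxy =>
    (hYZ.lt_iff (hF.mem hx) (hF.mem hy)).1 (hF.lt hx hy hxy)⟩

namespace Predil

/-- `D'(n)` is an initial segment of `D(n)`, naturally in `n`, and `D'` contains all elements of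
`D` that it contains up to the action of morphisms. -/
structure IsInitial (D' D : Predil M) : Prop where
  ob : ∀ {n}, n ∈ᴹ om → (D'.ob n).IsInitial (D.ob n)
  map_iff : ∀ {m n f σ τ}, NatHom m n f → D'.El m σ → (D'.map m n f σ τ ↔ D.map m n f σ τ)
  supp_iff : ∀ {n σ i}, n ∈ᴹ om → D'.El n σ → (D'.supp n σ i ↔ D.supp n σ i)
  reflect : ∀ {m n f σ τ}, NatHom m n f → D.El m σ → D.map m n f σ τ → D'.El n τ → D'.El m σ

namespace IsInitial

protected theorem refl (D : Predil M) : D.IsInitial D :=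
  ⟨fun _ => .refl _, fun _ _ => Iff.rfl, fun _ _ => Iff.rfl, fun _ hσ _ _ => hσ⟩

variable {D' D : Predil M} (h : D'.IsInitial D) {X : ClassOrder M}
include h

theorem tr {σ n : M} (hσ : D'.Tr σ n) : D.Tr σ n :=
  ⟨hσ.1, (h.ob hσ.1).mem hσ.2.1, fun i hi => (h.supp_iff hσ.1 hσ.2.1).1 (hσ.2.2 i hi)⟩

theorem isValue {c n p v : M} (hv : D'.IsValue X c n p v) : D.IsValue X c n p v := by
  obtain ⟨σ, a, k, f, hp, hσ, hf, hm⟩ := hv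
  exact ⟨σ, a, k, f, hp, h.tr hσ, hf, (h.map_iff hf.natHom hσ.2.1).1 hm⟩

theorem ext_mem {p : M} (hp : (D'.ext X).mem p) : (D.ext X).mem p := by
  obtain ⟨σ, a, n, e, hp, he, hσ⟩ := hp
  exact ⟨σ, a, n, e, hp, he, h.tr hσ⟩

theorem ext [ModelsPRS M] (hD' : D'.IsWeakPredilator) (hD : D.IsWeakPredilator)
    (hX : SmallLinear X) : (D'.ext X).IsInitial (D.ext X) := by
  refine ⟨h.ext_mem, fun {p q} hp hq => ?_, fun {p q} hp hq hpq => ?_⟩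
  · obtain ⟨c, n, u, v, -, hu, hv, -⟩ := exists_isValue₃ hD' hX hp hq hq
    rw [hu.lt_iff hv hD' hX, (h.isValue hu).lt_iff (h.isValue hv) hD hX]
    exact (h.ob hu.size_mem_om).lt_iff (hu.el hD') (hv.el hD')
  · obtain ⟨a, ha, hpa⟩ := exists_finSub_extSupp hp
    obtain ⟨b, hb, hqb⟩ := exists_finSub_extSupp hq
    obtain ⟨n, e, he⟩ := hX.finSub_cup ha hb
    obtain ⟨u, hu⟩ := exists_isValue hD hX.isLinear hp he (by simp_all)
    obtain ⟨v, hv⟩ := exists_isValue hD' hX.isLinear hq he (by simp_all)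
    have hu' : D'.El n u := (h.ob hu.size_mem_om).down (hu.el hD) (hv.el hD')
      ((hu.lt_iff (h.isValue hv) hD hX).1 hpq)
    obtain ⟨σ, a, k, f, rfl, hσ, hf, hσu⟩ := hu
    obtain ⟨e', he'⟩ := hf.enum_left
    have hσ' := h.reflect hf.natHom hσ.2.1 hσu hu'
    exact ⟨σ, a, k, e', rfl, he', hσ.1, hσ', fun i hi => (h.supp_iff hσ.1 hσ').2 (hσ.2.2 i hi)⟩

end IsInitial

end Predil

/-! ### Shifts -/

variable [ModelsPRS M] {Γ : Type*} [TupleCoded M Γ]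

open Classical in
/-- The function `γ + f`, which is given by a formula that does not depend on `γ`. -/
noncomputable def addFun (f x : M) : M :=
  if pairFst x = empty then x else pair (adj empty empty) (app f (pairSnd x))

@[fun_prop]
theorem IsPR.addFun {f x : Γ → M} (hf : IsPR M f) (hx : IsPR M x) :
    IsPR M (fun z => addFun (f z) (x z)) := by
  unfold ATRSet.addFun
  fun_prop

@[simp] theorem addFun_left {f x : M} : addFun f (pair empty x) = pair empty x := by simp [addFun]

@[simp] theorem addFun_right {f x : M} :
    addFun f (pair (adj empty empty) x) = pair (adj empty empty) (app f x) := by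
  simp [addFun, empty_ne_one.symm]

section

variable {γ m n f x y : M}

omit [ModelsPRS M] in
theorem ordOrder_add_cases (hx : ((ordOrder γ).add (ordOrder m)).mem x) :
    (∃ z, z ∈ᴹ γ ∧ x = pair empty z) ∨ ∃ i, i ∈ᴹ m ∧ x = pair (adj empty empty) i := hx

theorem isEmbedding_addFun (hf : NatHom m n f) :
    ((ordOrder γ).add (ordOrder m)).IsEmbedding ((ordOrder γ).add (ordOrder n)) (addFun f) where
  mem hx := by
    obtain ⟨z, hz, rfl⟩ | ⟨i, hi, rfl⟩ := ordOrder_add_cases hx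
    · rw [addFun_left]
      exact add_mem_left.2 hz
    · rw [addFun_right]
      exact add_mem_right.2 (hf.app_mem hi)
  lt hx hy hxy := by
    obtain ⟨z, -, rfl⟩ | ⟨i, hi, rfl⟩ := ordOrder_add_cases hx <;>
      obtain ⟨w, -, rfl⟩ | ⟨j, hj, rfl⟩ := ordOrder_add_cases hy
    · simpa using hxy
    · simp
    · simp at hxy
    · simp only [addFun_right, add_lt_right] at hxy ⊢
      exact hf.app_mem_app hi hj hxy

theorem smallLinear_ordOrder_add (hγ : IsOrd γ) (hn : n ∈ᴹ om) :
    SmallLinear ((ordOrder γ).add (ordOrder n)) :=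
  (smallLinear_ordOrder hγ).add (smallLinear_ordOrder (isOrd_of_mem_om hn))

namespace Predil

theorem addMap_iff :
    addMap γ m f x y ↔ ((ordOrder γ).add (ordOrder m)).mem x ∧ y = addFun f x := by
  constructor
  · rintro (⟨z, hz, rfl, rfl⟩ | ⟨i, hi, rfl, rfl⟩)
    exacts [⟨.inl ⟨z, hz, rfl⟩, by simp⟩, ⟨.inr ⟨i, hi, rfl⟩, by simp⟩]
  · rintro ⟨hx, rfl⟩
    obtain ⟨z, hz, rfl⟩ | ⟨i, hi, rfl⟩ := ordOrder_add_cases hx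
    exacts [.inl ⟨z, hz, rfl, by simp⟩, .inr ⟨i, hi, rfl, by simp⟩]

variable {D D' : Predil M} {p q : M}

theorem shift_map_iff (hp : (D.shift γ).El m p) :
    (D.shift γ).map m n f p q ↔ ExtImage (addFun f) p q := by
  obtain ⟨σ, a, k, e, rfl, -, -⟩ := id hp
  have h_image : ∀ y, (∃ x, x ∈ᴹ a ∧ addMap γ m f x y) ↔ ∃ x, x ∈ᴹ a ∧ y = addFun f x := fun y =>
    exists_congr fun x => and_congr_right fun hx =>
      addMap_iff.trans (and_iff_right (mem_of_extSupp hp (extSupp_pair.2 hx)))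
  rw [extImage_pair]
  simp only [Predil.shift, extMap, pair_inj, ← h_image]
  grind

theorem IsWeakPredilator.shift (hD : D.IsWeakPredilator) (hγ : IsOrd γ) :
    (D.shift γ).IsWeakPredilator where
  linear hn := hD.ext_isLinear (smallLinear_ordOrder_add hγ hn)
  map_fun {m n f p} _ hp := by
    obtain ⟨q, hq⟩ := exists_extImage_of_ext_mem (F := addFun f) (by fun_prop) hp
    exact ⟨q, (shift_map_iff hp).2 hq, fun q' hq' => ((shift_map_iff hp).1 hq').unique hq⟩
  map_mem hf hp hq := (isEmbedding_addFun hf).ext_mem (by fun_prop) hp ((shift_map_iff hp).1 hq)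
  map_lt hf hp hp' hq hq' := (isEmbedding_addFun hf).ext_lt (by fun_prop) hp hp'
    ((shift_map_iff hp).1 hq) ((shift_map_iff hp').1 hq')
  map_comp {k m n f g h p q r} hf _ _ hfg hp hq hr := by
    have hpq := (shift_map_iff hp).1 hq
    have hqr := (shift_map_iff ((isEmbedding_addFun hf).ext_mem (by fun_prop) hp hpq)).1 hr
    refine (shift_map_iff hp).2 (hpq.comp hqr fun x hx => ?_)
    obtain ⟨w, -, rfl⟩ | ⟨i, hi, rfl⟩ := ordOrder_add_cases (mem_of_extSupp hp hx)
    · simp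
    · simp [hfg i hi]
  supp_sub _ _ hi := hi.1
  supp_nat {m n f p q} hf hp hq j := by
    simp only [Predil.shift, ((shift_map_iff hp).1 hq).extSupp_iff]
    constructor
    · rintro ⟨-, x, hx, hxj⟩
      obtain ⟨z, -, rfl⟩ | ⟨i, hi, rfl⟩ := ordOrder_add_cases (mem_of_extSupp hp hx)
      · simp [empty_ne_one.symm] at hxj
      · exact ⟨i, ⟨hi, hx⟩, by simp_all⟩
    · rintro ⟨i, ⟨hi, hip⟩, rfl⟩
      exact ⟨hf.app_mem hi, _, hip, by simp⟩

theorem IsInitial.shift (h : D'.IsInitial D) (hD' : D'.IsWeakPredilator)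
    (hD : D.IsWeakPredilator) (hγ : IsOrd γ) : (D'.shift γ).IsInitial (D.shift γ) where
  ob hn := h.ext hD' hD (smallLinear_ordOrder_add hγ hn)
  map_iff _ _ := Iff.rfl
  supp_iff _ _ := Iff.rfl
  reflect {m n f p q} hf hp hpq hq := by
    obtain ⟨σ, a, k, e, rfl, he, -⟩ := id hp
    obtain ⟨b, rfl, hb⟩ := extImage_pair.1 ((shift_map_iff hp).1 hpq)
    have hF := isEmbedding_addFun (γ := γ) hf
    obtain ⟨e', he', -⟩ := he.image (F := addFun f) (by fun_prop) (fun x hx => hF.mem (he.mem hx))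
      (fun x y hx hy => hF.lt (he.mem hx) (he.mem hy)) hb
    obtain ⟨σ', b', k', e'', hpair, he'', hσ'⟩ := hq
    obtain ⟨rfl, rfl⟩ := pair_inj.1 hpair
    obtain ⟨rfl, -⟩ := he'.unique he'' (smallLinear_ordOrder_add hγ hf.cod_mem_om).isLinear
    exact ⟨σ, a, k, e, rfl, he, hσ'⟩

end Predil

end

/-! ### Sums -/

namespace Predil

variable {L : ClassOrder M} {D : M → Predil M}

@[simp] theorem sum_el {n α σ : M} :
    (sum L D).El n (pair α σ) ↔ L.mem α ∧ (D α).El n σ := by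
  simp only [sum, pair_inj]
  grind

@[simp] theorem sum_lt {n α σ β τ : M} : (sum L D).lt n (pair α σ) (pair β τ) ↔
    L.mem α ∧ L.mem β ∧ (L.lt α β ∨ α = β ∧ (D α).lt n σ τ) := by
  simp only [sum, pair_inj]
  grind

@[simp] theorem sum_map {m n f α σ q : M} : (sum L D).map m n f (pair α σ) q ↔
    ∃ τ, q = pair α τ ∧ L.mem α ∧ (D α).map m n f σ τ := by
  simp only [sum, pair_inj]
  grind

@[simp] theorem sum_supp {n α σ i : M} :
    (sum L D).supp n (pair α σ) i ↔ L.mem α ∧ (D α).supp n σ i := by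
  simp only [sum, pair_inj]
  grind

theorem sum_ob_isLinear {n : M} (hL : L.IsLinear) (hD : ∀ α, L.mem α → ((D α).ob n).IsLinear) :
    ((sum L D).ob n).IsLinear := by
  refine ⟨?_, ?_, ?_⟩
  · rintro _ ⟨α, σ, rfl, hα, hσ⟩ h
    rcases (sum_lt.1 h).2.2 with h | ⟨-, h⟩
    · exact hL.irrefl hα h
    · exact (hD α hα).irrefl hσ h
  · rintro _ _ _ ⟨α, σ, rfl, hα, hσ⟩ ⟨β, τ, rfl, hβ, hτ⟩ ⟨δ, ρ, rfl, hδ, hρ⟩ h h'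
    refine sum_lt.2 ⟨hα, hδ, ?_⟩
    rcases (sum_lt.1 h).2.2 with hαβ | ⟨rfl, hστ⟩ <;>
      rcases (sum_lt.1 h').2.2 with hβδ | ⟨rfl, hτρ⟩
    · exact .inl (hL.trans hα hβ hδ hαβ hβδ)
    · exact .inl hαβ
    · exact .inl hβδ
    · exact .inr ⟨rfl, (hD α hα).trans hσ hτ hρ hστ hτρ⟩
  · rintro _ _ ⟨α, σ, rfl, hα, hσ⟩ ⟨β, τ, rfl, hβ, hτ⟩
    simp only [ob, sum_lt, hα, hβ, true_and, pair_inj]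
    rcases hL.trichotomy hα hβ with h | rfl | h
    · exact .inl (.inl h)
    · rcases (hD α hα).trichotomy hσ hτ with h | rfl | h
      · exact .inl (.inr ⟨rfl, h⟩)
      · exact .inr (.inl ⟨rfl, rfl⟩)
      · exact .inr (.inr (.inr ⟨rfl, h⟩))
    · exact .inr (.inr (.inl h))

theorem IsWeakPredilator.sum (hL : L.IsLinear) (hD : ∀ α, L.mem α → (D α).IsWeakPredilator) :
    (sum L D).IsWeakPredilator where
  linear hn := sum_ob_isLinear hL fun α hα => (hD α hα).linear hn
  map_fun := by
    rintro m n f _ hf ⟨α, σ, rfl, hα, hσ⟩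
    obtain ⟨τ, hτ, hτ_unique⟩ := (hD α hα).map_fun hf hσ
    refine ⟨pair α τ, sum_map.2 ⟨τ, rfl, hα, hτ⟩, fun q hq => ?_⟩
    obtain ⟨τ', rfl, -, hτ'⟩ := sum_map.1 hq
    rw [hτ_unique τ' hτ']
  map_mem := by
    rintro m n f _ q hf ⟨α, σ, rfl, hα, hσ⟩ hq
    obtain ⟨τ, rfl, -, hτ⟩ := sum_map.1 hq
    exact sum_el.2 ⟨hα, (hD α hα).map_mem hf hσ hτ⟩
  map_lt := by
    rintro m n f _ _ q q' hf ⟨α, σ, rfl, hα, hσ⟩ ⟨β, σ', rfl, hβ, hσ'⟩ hq hq' h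
    obtain ⟨τ, rfl, -, hτ⟩ := sum_map.1 hq
    obtain ⟨τ', rfl, -, hτ'⟩ := sum_map.1 hq'
    refine sum_lt.2 ⟨hα, hβ, (sum_lt.1 h).2.2.imp_right ?_⟩
    rintro ⟨rfl, hlt⟩
    exact ⟨rfl, (hD α hα).map_lt hf hσ hσ' hτ hτ' hlt⟩
  map_comp := by
    rintro k m n f g h _ q r hf hg hh hfg ⟨α, ρ, rfl, hα, hρ⟩ hq hr
    obtain ⟨σ, rfl, -, hσ⟩ := sum_map.1 hq
    obtain ⟨τ, rfl, -, hτ⟩ := sum_map.1 hr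
    exact sum_map.2 ⟨τ, rfl, hα, (hD α hα).map_comp hf hg hh hfg hρ hσ hτ⟩
  supp_sub := by
    rintro n _ i hn ⟨α, σ, rfl, hα, hσ⟩ hi
    exact (hD α hα).supp_sub hn hσ (sum_supp.1 hi).2
  supp_nat := by
    rintro m n f _ q hf ⟨α, σ, rfl, hα, hσ⟩ hq j
    obtain ⟨τ, rfl, -, hτ⟩ := sum_map.1 hq
    simpa [hα] using (hD α hα).supp_nat hf hσ hτ j

theorem isInitial_sum {L' : ClassOrder M} (hL : L'.IsInitial L) :
    (sum L' D).IsInitial (sum L D) where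
  ob {n} _ := by
    refine ⟨?_, ?_, ?_⟩
    · rintro _ ⟨α, σ, rfl, hα, hσ⟩
      exact sum_el.2 ⟨hL.mem hα, hσ⟩
    · rintro _ _ ⟨α, σ, rfl, hα, -⟩ ⟨β, τ, rfl, hβ, -⟩
      simp only [Predil.ob, sum_lt, hα, hβ, hL.mem, hL.lt_iff]
    · rintro _ _ ⟨α, σ, rfl, hα, hσ⟩ ⟨β, τ, rfl, hβ, -⟩ h
      refine sum_el.2 ⟨?_, hσ⟩
      rcases (sum_lt.1 h).2.2 with h | ⟨rfl, -⟩
      · exact hL.down hα hβ h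
      · exact hβ
  map_iff := by
    rintro m n f _ q - ⟨α, σ, rfl, hα, -⟩
    simp only [sum_map, hα, hL.mem hα]
  supp_iff := by
    rintro n _ i - ⟨α, σ, rfl, hα, -⟩
    simp only [sum_supp, hα, hL.mem hα]
  reflect := by
    rintro m n f _ q - ⟨α, σ, rfl, -, hσ⟩ hq h
    obtain ⟨τ, rfl, -, -⟩ := sum_map.1 hq
    exact sum_el.2 ⟨(sum_el.1 h).1, hσ⟩

end Predil

omit [ModelsPRS M] in
theorem ordOrder_isInitial {μ ν : M} (hν : IsOrd ν) (hμ : μ ∈ᴹ ν) :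
    (ordOrder μ).IsInitial (ordOrder ν) :=
  ⟨fun h => hν.1 μ hμ _ h, fun _ _ => Iff.rfl, fun {x y} _ hy hxy => (hν.mem hμ).1 y hy x hxy⟩

end

section

variable {M : Type u} [SetStructure M] [ModelsPRS M]

/-! ### Comparison of fixed points -/

/-- The function `π` embeds the ordinal `Ω` into an order `Y` of elements with supports, subject to
the conditions from the definition of `ψ`-fixed points. In the latter, `Y` is `D(Ω)`. To compare
fixed points, we rather consider `Y = D(Θ)` for an ordinal `Θ` that does not depend on `Ω`. -/
structure IsCollapse (Y : ClassOrder M) (Ω π : M) : Prop where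
  isOrd : IsOrd Ω
  isEmbedding : (ordOrder Ω).IsEmbedding Y (app π)
  supp : ∀ {α β}, β ∈ᴹ Ω → Predil.extSupp (app π β) α → α ∈ᴹ β
  surj : ∀ {τ}, Y.mem τ → (∀ α, Predil.extSupp τ α → α ∈ᴹ Ω) →
    (∀ α, Predil.extSupp τ α → Y.lt (app π α) τ) → ∃ β, β ∈ᴹ Ω ∧ app π β = τ

theorem Predil.IsPsiFixedPoint.exists_isCollapse {D : Predil M} {Ω Θ : M}
    (h : D.IsPsiFixedPoint Ω) (hΩΘ : ∀ α, α ∈ᴹ Ω → α ∈ᴹ Θ) :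
    ∃ π, IsCollapse (D.ext (ordOrder Θ)) Ω π := by
  obtain ⟨hΩ, π, -, hmem, hlt, hsupp, hsurj⟩ := h
  have hmem_of : ∀ {p x}, (D.ext (ordOrder Ω)).mem p → extSupp p x → x ∈ᴹ Ω :=
    fun hp hx => mem_of_extSupp (X := ordOrder Ω) hp hx
  refine ⟨π, hΩ, ⟨fun {α} hα => ?_, fun {α β} hα hβ hαβ => ?_⟩, fun hβ hα => ?_,
    fun {τ} hτ hτΩ hτ_lt => hsurj τ ?_ fun α hα => ?_⟩
  · exact ext_mem_of_extSupp (hmem α hα) (fun x hx => hΩΘ x (hmem_of (hmem α hα) hx))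
      fun _ _ _ _ h => h
  · exact ext_lt_of_extSupp (hmem α hα) (hmem β hβ) (hlt α β hα hβ hαβ)
      (fun x hx => hΩΘ x (hx.elim (hmem_of (hmem α hα)) (hmem_of (hmem β hβ))))
      fun _ _ _ _ h => h
  · exact hsupp _ _ (hmem_of (hmem _ hβ) hα) hβ hα
  · exact ext_mem_of_extSupp hτ hτΩ fun _ _ _ _ h => h
  · have hα' := hmem α (hτΩ α hα)
    refine ext_lt_of_extSupp (X := ordOrder Θ) ?_ hτ (hτ_lt α hα)
      (fun x hx => hx.elim (hmem_of hα') (hτΩ x)) fun _ _ _ _ h => h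
    exact ext_mem_of_extSupp hα' (fun x hx => hΩΘ x (hmem_of hα' hx)) fun _ _ _ _ h => h

namespace IsCollapse

variable {Y Y' : ClassOrder M} {Ω Ω' π π' α : M}

omit [ModelsPRS M] in
theorem exists_app_eq (h : IsCollapse Y Ω π) (h' : IsCollapse Y' Ω' π')
    (hlt : ∀ {x y}, Y.mem x → Y.mem y → Y'.mem x → Y'.mem y → Y.lt x y → Y'.lt x y)
    (hα : α ∈ᴹ Ω) (hαY' : Y'.mem (app π α))
    (heq : ∀ δ, δ ∈ᴹ α → δ ∈ᴹ Ω' ∧ app π δ = app π' δ) : ∃ β, β ∈ᴹ Ω' ∧ app π' β = app π α := by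
  refine h'.surj hαY' (fun δ hδ => (heq δ (h.supp hα hδ)).1) fun δ hδ => ?_
  have hδα := h.supp hα hδ
  obtain ⟨hδΩ', hδ_eq⟩ := heq δ hδα
  have hδΩ := h.isOrd.1 α hα δ hδα
  have hδY' := h'.isEmbedding.mem hδΩ'
  rw [← hδ_eq] at hδY' ⊢
  exact hlt (h.isEmbedding.mem hδΩ) (h.isEmbedding.mem hα) hδY' hαY'
    (h.isEmbedding.lt hδΩ hα hδα)

variable (h : IsCollapse Y Ω π) (h' : IsCollapse Y' Ω' π') (hYY' : Y'.IsInitial Y)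
  (hY : Y.IsLinear)
include h h' hYY' hY

theorem app_eq_app (hα : α ∈ᴹ Ω) (hα' : α ∈ᴹ Ω') : app π α = app π' α := by
  have hemb' : (ordOrder Ω').IsEmbedding Y (app π') := h'.isEmbedding.of_isInitial hYY'
  refine mem_induction (A := Ω) (P := fun α => α ∈ᴹ Ω' → app π α = app π' α) (by fun_prop)
    (fun α hα ih hα' => ?_) α hα hα'
  have heq : ∀ δ, δ ∈ᴹ α → app π δ = app π' δ := fun δ hδ =>
    ih δ hδ (h.isOrd.1 α hα δ hδ) (h'.isOrd.1 α hα' δ hδ)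
  rcases hY.trichotomy (h.isEmbedding.mem hα) (hemb'.mem hα') with hlt | heq | hlt
  · obtain ⟨β, hβ, hβα⟩ := h.exists_app_eq h' (fun _ _ hx hy => (hYY'.lt_iff hx hy).2) hα
      (hYY'.down (h.isEmbedding.mem hα) (h'.isEmbedding.mem hα') hlt)
      fun δ hδ => ⟨h'.isOrd.1 α hα' δ hδ, heq δ hδ⟩
    rw [← hβα] at hlt
    have hβ_lt := (hemb'.lt_iff (isLinear_ordOrder h'.isOrd) hY hβ hα').1 hlt
    have := h.isEmbedding.inj (isLinear_ordOrder h.isOrd) hY (h.isOrd.1 α hα β hβ_lt) hα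
      ((heq β hβ_lt).trans hβα)
    exact absurd (this ▸ hβ_lt) (not_mem_self α)
  · exact heq
  · obtain ⟨β, hβ, hβα⟩ := h'.exists_app_eq h (fun hx hy _ _ => (hYY'.lt_iff hx hy).1) hα'
      (hemb'.mem hα') fun δ hδ => ⟨h.isOrd.1 α hα δ hδ, (heq δ hδ).symm⟩
    rw [← hβα] at hlt
    have hβ_lt := (h.isEmbedding.lt_iff (isLinear_ordOrder h.isOrd) hY hβ hα).1 hlt
    have := hemb'.inj (isLinear_ordOrder h'.isOrd) hY (h'.isOrd.1 α hα' β hβ_lt) hα'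
      ((heq β hβ_lt).symm.trans hβα)
    exact absurd (this ▸ hβ_lt) (not_mem_self α)

theorem ordLe : OrdLe Ω' Ω := by
  rcases h'.isOrd.trichotomy h.isOrd with hlt | heq | hlt
  · exact .inl hlt
  · exact .inr heq
  · have hsub : ∀ δ, δ ∈ᴹ Ω → δ ∈ᴹ Ω' := h'.isOrd.1 Ω hlt
    have hemb' : (ordOrder Ω').IsEmbedding Y (app π') := h'.isEmbedding.of_isInitial hYY'
    obtain ⟨β, hβ, hβΩ⟩ := h'.exists_app_eq h (fun hx hy _ _ => (hYY'.lt_iff hx hy).1) hlt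
      (hemb'.mem hlt) fun δ hδ => ⟨hδ, (h.app_eq_app h' hYY' hY hδ (hsub δ hδ)).symm⟩
    rw [h.app_eq_app h' hYY' hY hβ (hsub β hβ)] at hβΩ
    have := hemb'.inj (isLinear_ordOrder h'.isOrd) hY (hsub β hβ) hlt hβΩ
    exact absurd (this ▸ hβ) (not_mem_self Ω)

theorem mem_of_app_mem (hα : α ∈ᴹ Ω) (hαY' : Y'.mem (app π α)) : α ∈ᴹ Ω' := by
  by_contra hnmem
  obtain ⟨hΩ', hΩ'Y'⟩ : Ω' ∈ᴹ Ω ∧ Y'.mem (app π Ω') := by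
    rcases (h.isOrd.mem hα).trichotomy h'.isOrd with hlt | rfl | hlt
    · exact absurd hlt hnmem
    · exact ⟨hα, hαY'⟩
    · have hΩ' := h.isOrd.1 α hα Ω' hlt
      exact ⟨hΩ', hYY'.down (h.isEmbedding.mem hΩ') hαY' (h.isEmbedding.lt hΩ' hα hlt)⟩
  have hsub : ∀ δ, δ ∈ᴹ Ω' → δ ∈ᴹ Ω := h.isOrd.1 Ω' hΩ'
  obtain ⟨β, hβ, hβΩ'⟩ := h.exists_app_eq h' (fun _ _ hx hy => (hYY'.lt_iff hx hy).2) hΩ'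
    hΩ'Y' fun δ hδ => ⟨hδ, h.app_eq_app h' hYY' hY (hsub δ hδ) hδ⟩
  rw [← h.app_eq_app h' hYY' hY (hsub β hβ) hβ] at hβΩ'
  have := h.isEmbedding.inj (isLinear_ordOrder h.isOrd) hY (hsub β hβ) hΩ' hβΩ'
  exact absurd (this ▸ hβ) (not_mem_self Ω')

end IsCollapse

theorem OrdLe.antisymm {α β : M} (h : OrdLe α β) (h' : OrdLe β α) : α = β := by
  rcases h with h | h
  · rcases h' with h' | h'
    · exact absurd h' (not_mem_of_mem h)
    · exact h'.symm
  · exact h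

theorem exists_isOrd_superset {α β : M} (hα : IsOrd α) (hβ : IsOrd β) :
    ∃ δ, IsOrd δ ∧ (∀ x, x ∈ᴹ α → x ∈ᴹ δ) ∧ ∀ x, x ∈ᴹ β → x ∈ᴹ δ := by
  rcases hα.trichotomy hβ with h | rfl | h
  · exact ⟨β, hβ, hβ.1 α h, fun _ => id⟩
  · exact ⟨α, hα, fun _ => id, fun _ => id⟩
  · exact ⟨α, hα, fun _ => id, hα.1 β h⟩

namespace Predil.IsPsiFixedPoint

variable {D D' : Predil M} {Ω Ω' : M}

theorem ordLe (h : D.IsPsiFixedPoint Ω) (h' : D'.IsPsiFixedPoint Ω') (hD'D : D'.IsInitial D)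
    (hD' : D'.IsWeakPredilator) (hD : D.IsWeakPredilator) : OrdLe Ω' Ω := by
  obtain ⟨Θ, hΘ, hΩ, hΩ'⟩ := exists_isOrd_superset h.1 h'.1
  obtain ⟨π, hπ⟩ := h.exists_isCollapse hΩ
  obtain ⟨π', hπ'⟩ := h'.exists_isCollapse hΩ'
  have hΘ' := smallLinear_ordOrder hΘ
  exact hπ.ordLe hπ' (hD'D.ext hD' hD hΘ') (hD.ext_isLinear hΘ')

theorem unique (h : D.IsPsiFixedPoint Ω) (h' : D.IsPsiFixedPoint Ω') (hD : D.IsWeakPredilator) :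
    Ω = Ω' :=
  (h'.ordLe h (.refl D) hD hD).antisymm (h.ordLe h' (.refl D) hD hD)

theorem isOrdSup {I : M → Prop} {E : M → Predil M} (h : D.IsPsiFixedPoint Ω)
    (hD : D.IsWeakPredilator) (hE : ∀ μ, I μ → (E μ).IsWeakPredilator)
    (hED : ∀ μ, I μ → (E μ).IsInitial D)
    (hcover : ∀ p, (D.ext (ordOrder Ω)).mem p → ∃ μ, I μ ∧ ((E μ).ext (ordOrder Ω)).mem p)
    (hex : ∀ μ, I μ → ∃ β, (E μ).IsPsiFixedPoint β) :
    IsOrdSup (fun β => ∃ μ, I μ ∧ (E μ).IsPsiFixedPoint β) Ω := by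
  have hle : ∀ β, (∃ μ, I μ ∧ (E μ).IsPsiFixedPoint β) → OrdLe β Ω := fun β ⟨μ, hμ, hβ⟩ =>
    h.ordLe hβ (hED μ hμ) (hE μ hμ) hD
  refine ⟨h.1, hle, fun Ω' hΩ' hΩ'_ub => ?_⟩
  rcases h.1.trichotomy hΩ' with hlt | heq | hlt
  · exact .inl hlt
  · exact .inr heq
  obtain ⟨π, hπ⟩ := h.exists_isCollapse (Θ := Ω) fun _ => id
  obtain ⟨μ, hμ, hmem⟩ := hcover _ (hπ.isEmbedding.mem hlt)
  obtain ⟨β, hβ⟩ := hex μ hμ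
  have hβΩ : ∀ x, x ∈ᴹ β → x ∈ᴹ Ω := (hle β ⟨μ, hμ, hβ⟩).elim (h.1.1 β) fun heq _ => heq ▸ id
  obtain ⟨π', hπ'⟩ := hβ.exists_isCollapse hβΩ
  have hΩ := smallLinear_ordOrder h.1
  have hΩ'β := hπ.mem_of_app_mem hπ' ((hED μ hμ).ext (hE μ hμ) hD hΩ) (hD.ext_isLinear hΩ) hlt hmem
  rcases hΩ'_ub β ⟨μ, hμ, hβ⟩ with hβΩ' | rfl
  · exact absurd hΩ'β (not_mem_of_mem hβΩ')
  · exact absurd hΩ'β (not_mem_self β)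

end Predil.IsPsiFixedPoint

end

section

variable {M : Type u} [SetStructure M] [ModelsPRS M]
variable {Γ Δ : Type*} [TupleCoded M Γ] [TupleCoded M Δ]

/-! ### Primitive recursive predilators -/

theorem NatHom.mem_univ {m n f : M} (h : NatHom m n f) : f ∈ᴹ univ om :=
  (isUniv_univ om).finite_fun_mem h.dom_mem_om h.isFunOn fun _ hi =>
    (isUniv_univ om).of_mem_om _ (mem_om_of_mem h.cod_mem_om (h.app_mem hi))

theorem Enum.mem_univ {X : ClassOrder M} {a n e : M} (h : Enum X a n e) : e ∈ᴹ univ a :=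
  h.fun_mem_univ (isUniv_univ a) fun _ hx => (isUniv_univ a).mem_of_mem (mem_univ_self a) hx

namespace IsPR

variable {X : Γ → ClassOrder M} {a b m n f p x : Γ → M}

@[fun_prop]
theorem natHom (hm : IsPR M m) (hn : IsPR M n) (hf : IsPR M f) :
    IsPR M (fun z => NatHom (m z) (n z) (f z)) := by
  refine congr (Q := fun z => m z ∈ᴹ om ∧ n z ∈ᴹ om ∧ IsFunOn (f z) (m z) ∧
    (∀ i, i ∈ᴹ m z → ATRSet.app (f z) i ∈ᴹ n z) ∧ ∀ i, i ∈ᴹ m z → ∀ j, j ∈ᴹ m z → i ∈ᴹ j →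
      ATRSet.app (f z) i ∈ᴹ ATRSet.app (f z) j) (by fun_prop) fun z => ?_
  unfold NatHom
  grind

@[fun_prop]
theorem inclHom (hX : IsPROrder X) (ha : IsPR M a) (hb : IsPR M b) (hm : IsPR M m)
    (hn : IsPR M n) (hf : IsPR M f) :
    IsPR M (fun z => InclHom (X z) (a z) (b z) (m z) (n z) (f z)) := by
  refine congr (Q := fun z => NatHom (m z) (n z) (f z) ∧ ∃ e, e ∈ᴹ ATRSet.univ (a z) ∧
    ∃ e', e' ∈ᴹ ATRSet.univ (b z) ∧ Enum (X z) (a z) (m z) e ∧ Enum (X z) (b z) (n z) e' ∧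
      ∀ i, i ∈ᴹ m z → ATRSet.app e' (ATRSet.app (f z) i) = ATRSet.app e i)
    (by fun_prop) fun z => ?_
  unfold InclHom
  grind [Enum.mem_univ]

@[fun_prop]
theorem extSupp (hp : IsPR M p) (hx : IsPR M x) :
    IsPR M (fun z => Predil.extSupp (p z) (x z)) := by
  unfold Predil.extSupp
  fun_prop

end IsPR

/-- A family of predilators whose relations are uniformly primitive recursive, with bounds that
turn quantification over elements and values into bounded quantification. -/
@[fun_prop]
structure IsPRPredil (D : Γ → Predil M) : Prop where
  el : IsPR M (fun z : Γ × M × M => (D z.1).El z.2.1 z.2.2)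
  lt : IsPR M (fun z : Γ × M × M × M => (D z.1).lt z.2.1 z.2.2.1 z.2.2.2)
  map : IsPR M (fun z : Γ × M × M × M × M × M =>
    (D z.1).map z.2.1 z.2.2.1 z.2.2.2.1 z.2.2.2.2.1 z.2.2.2.2.2)
  supp : IsPR M (fun z : Γ × M × M × M => (D z.1).supp z.2.1 z.2.2.1 z.2.2.2)
  el_bound : ∃ B : Γ → M, IsPR M B ∧ ∀ z n σ, n ∈ᴹ om → (D z).El n σ → σ ∈ᴹ B z
  map_bound : ∃ B : Γ × M × M × M × M → M, IsPR M B ∧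
    ∀ z m n f σ τ, (D z).map m n f σ τ → τ ∈ᴹ B (z, m, n, f, σ)

@[fun_prop]
theorem IsPRPredil.comp {D : Δ → Predil M} {g : Γ → Δ} (hD : IsPRPredil D) (hg : IsPR M g) :
    IsPRPredil (fun z => D (g z)) where
  el := hD.el.comp (f := fun z : Γ × M × M => (g z.1, z.2)) (by fun_prop)
  lt := hD.lt.comp (f := fun z : Γ × M × M × M => (g z.1, z.2)) (by fun_prop)
  map := hD.map.comp (f := fun z : Γ × M × M × M × M × M => (g z.1, z.2)) (by fun_prop)
  supp := hD.supp.comp (f := fun z : Γ × M × M × M => (g z.1, z.2)) (by fun_prop)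
  el_bound := by
    obtain ⟨B, hB, h⟩ := hD.el_bound
    exact ⟨fun z => B (g z), by fun_prop, fun z => h (g z)⟩
  map_bound := by
    obtain ⟨B, hB, h⟩ := hD.map_bound
    exact ⟨fun z => B (g z.1, z.2), by fun_prop, fun z => h (g z)⟩

namespace Predil

/-- A predilator that is primitive recursive with parameters. -/
def IsDefinable (D : Predil M) : Prop := IsPRPredil (fun _ : M => D)

@[fun_prop]
theorem IsDefinable.isPRPredil {D : Predil M} (hD : D.IsDefinable) :
    IsPRPredil (fun _ : Γ => D) :=
  IsPRPredil.comp hD (IsPR.const (empty : M))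

end Predil

namespace IsPR

variable {D : Γ → Predil M} {X : Γ → ClassOrder M} {m n f p q σ τ i : Γ → M}

@[fun_prop]
theorem predil_el (hD : IsPRPredil D) (hn : IsPR M n) (hσ : IsPR M σ) :
    IsPR M (fun z => (D z).El (n z) (σ z)) :=
  hD.el.comp (f := fun z => (z, n z, σ z)) (by fun_prop)

@[fun_prop]
theorem predil_lt (hD : IsPRPredil D) (hn : IsPR M n) (hσ : IsPR M σ) (hτ : IsPR M τ) :
    IsPR M (fun z => (D z).lt (n z) (σ z) (τ z)) :=
  hD.lt.comp (f := fun z => (z, n z, σ z, τ z)) (by fun_prop)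

@[fun_prop]
theorem predil_map (hD : IsPRPredil D) (hm : IsPR M m) (hn : IsPR M n) (hf : IsPR M f)
    (hσ : IsPR M σ) (hτ : IsPR M τ) :
    IsPR M (fun z => (D z).map (m z) (n z) (f z) (σ z) (τ z)) :=
  hD.map.comp (f := fun z => (z, m z, n z, f z, σ z, τ z)) (by fun_prop)

@[fun_prop]
theorem predil_supp (hD : IsPRPredil D) (hn : IsPR M n) (hσ : IsPR M σ) (hi : IsPR M i) :
    IsPR M (fun z => (D z).supp (n z) (σ z) (i z)) :=
  hD.supp.comp (f := fun z => (z, n z, σ z, i z)) (by fun_prop)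

@[fun_prop]
theorem tr (hD : IsPRPredil D) (hσ : IsPR M σ) (hn : IsPR M n) :
    IsPR M (fun z => (D z).Tr (σ z) (n z)) := by
  unfold Predil.Tr
  fun_prop

@[fun_prop]
theorem ext_mem (hD : IsPRPredil D) (hX : IsPROrder X) (hp : IsPR M p) :
    IsPR M (fun z => ((D z).ext (X z)).mem (p z)) := by
  refine congr (Q := fun z => ∃ σ a, p z = ATRSet.pair σ a ∧ ∃ n, n ∈ᴹ om ∧
    ∃ e, e ∈ᴹ ATRSet.univ a ∧ Enum (X z) a n e ∧ (D z).Tr σ n) (by fun_prop) fun z => ?_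
  unfold Predil.ext
  grind [Enum.mem_univ, Enum.size_mem_om]

@[fun_prop]
theorem ext_lt (hD : IsPRPredil D) (hX : IsPROrder X) (hp : IsPR M p) (hq : IsPR M q) :
    IsPR M (fun z => ((D z).ext (X z)).lt (p z) (q z)) := by
  obtain ⟨B, hB, hmap⟩ := hD.map_bound
  refine congr (Q := fun z => ∃ σ a, p z = ATRSet.pair σ a ∧ ∃ τ b, q z = ATRSet.pair τ b ∧
    ∃ k, k ∈ᴹ om ∧ ∃ m, m ∈ᴹ om ∧ ∃ n, n ∈ᴹ om ∧
    ∃ f, f ∈ᴹ ATRSet.univ om ∧ ∃ g, g ∈ᴹ ATRSet.univ om ∧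
    ∃ σ', σ' ∈ᴹ B (z, k, n, f, σ) ∧ ∃ τ', τ' ∈ᴹ B (z, m, n, g, τ) ∧
      InclHom (X z) a (ATRSet.cup a b) k n f ∧ InclHom (X z) b (ATRSet.cup a b) m n g ∧
      (D z).map k n f σ σ' ∧ (D z).map m n g τ τ' ∧ (D z).lt n σ' τ') (by fun_prop) fun z => ?_
  constructor
  · rintro ⟨σ, a, τ, b, hσ, hτ, c, k, m, n, f, g, σ', τ', hc, hf, hg, hσ', hτ', hlt⟩
    obtain rfl : c = ATRSet.cup a b := set_ext fun x => by rw [hc, mem_cup]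
    exact ⟨σ, a, hσ, τ, b, hτ, k, hf.natHom.dom_mem_om, m, hg.natHom.dom_mem_om, n,
      hf.natHom.cod_mem_om, f, hf.natHom.mem_univ, g, hg.natHom.mem_univ, σ', hmap _ _ _ _ _ _ hσ',
      τ', hmap _ _ _ _ _ _ hτ', hf, hg, hσ', hτ', hlt⟩
  · rintro ⟨σ, a, hσ, τ, b, hτ, k, -, m, -, n, -, f, -, g, -, σ', -, τ', -, h⟩
    exact ⟨σ, a, τ, b, hσ, hτ, _, k, m, n, f, g, σ', τ', fun _ => mem_cup, h⟩

@[fun_prop]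
theorem exists_code {d : Γ → M} {P : Γ → M → M → M → M → Prop} (hd : IsPR M d)
    (hP : IsPR M (fun z : Γ × M × M × M × M => P z.1 z.2.1 z.2.2.1 z.2.2.2.1 z.2.2.2.2)) :
    IsPR M (fun z => ∃ E L F S, d z = Predil.code E L F S ∧ P z E L F S) := by
  refine congr (Q := fun z => ∃ c c', d z = ATRSet.pair c c' ∧ ∃ E L, c = ATRSet.pair E L ∧
    ∃ F S, c' = ATRSet.pair F S ∧ P z E L F S) ?_ fun z => ?_
  · fun_prop
  · unfold Predil.code
    grind

end IsPR

/-! ### Definability of shifted sums -/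

namespace Predil

variable {D : Γ → Predil M} {d : Γ → M}

theorem code_mem_univ {d E L F S : M} (h : d = code E L F S) :
    E ∈ᴹ univ d ∧ L ∈ᴹ univ d ∧ F ∈ᴹ univ d ∧ S ∈ᴹ univ d := by
  have hd : code E L F S ∈ᴹ univ d := h ▸ mem_univ_self d
  simp only [code, (isUniv_univ d).pair_mem_iff] at hd
  tauto

theorem isPRPredil_ofCode (hd : IsPR M d) : IsPRPredil (fun z => ofCode (d z)) where
  el := by unfold ofCode; fun_prop
  lt := by unfold ofCode; fun_prop
  map := by unfold ofCode; fun_prop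
  supp := by unfold ofCode; fun_prop
  el_bound := by
    refine ⟨fun z => univ (d z), by fun_prop, fun z n σ _ ⟨E, L, F, S, hc, h⟩ => ?_⟩
    have hU := isUniv_univ (d z)
    exact (hU.pair_mem_iff.1 (hU.mem_of_mem (code_mem_univ hc).1 h)).2
  map_bound := by
    refine ⟨fun z => univ (d z.1), by fun_prop, fun z m n f σ τ ⟨E, L, F, S, hc, h⟩ => ?_⟩
    have hU := isUniv_univ (d z)
    have := hU.mem_of_mem (code_mem_univ hc).2.2.1 h
    simp only [hU.pair_mem_iff] at this
    exact this.2.2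

theorem isDefinable_sum {L : ClassOrder M} {D : M → Predil M} (hL : SmallLinear L)
    (hD : IsPRPredil D) : (sum L D).IsDefinable where
  el := by
    unfold sum
    fun_prop (disch := assumption)
  lt := by
    refine IsPR.congr (Q := fun z : M × M × M × M => ∃ α σ, z.2.2.1 = pair α σ ∧
      ∃ β τ, z.2.2.2 = pair β τ ∧ L.mem α ∧ L.mem β ∧
        (L.lt α β ∨ α = β ∧ (D α).lt z.2.1 σ τ)) (by fun_prop (disch := assumption)) fun z => ?_
    simp only [sum]
    grind
  map := by
    refine IsPR.congr (Q := fun z : M × M × M × M × M × M => ∃ α σ, z.2.2.2.2.1 = pair α σ ∧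
      ∃ β τ, z.2.2.2.2.2 = pair β τ ∧ β = α ∧ L.mem α ∧ (D α).map z.2.1 z.2.2.1 z.2.2.2.1 σ τ)
      (by fun_prop (disch := assumption)) fun z => ?_
    simp only [sum]
    grind
  supp := by
    unfold sum
    fun_prop (disch := assumption)
  el_bound := by
    obtain ⟨A, hA⟩ := hL.bdd
    obtain ⟨B, hB, hel⟩ := hD.el_bound
    obtain ⟨P, hP, hP_mem⟩ := IsPR.exists_image (F := pair) hB (by fun_prop)
    obtain ⟨S, hS, hS_mem⟩ := IsPR.exists_bUnion (Γ := M) (u := fun _ => A) (F := fun _ => P)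
      (by fun_prop) (by fun_prop)
    refine ⟨S, hS, ?_⟩
    rintro z n _ hn ⟨α, σ, rfl, hα, hσ⟩
    exact (hS_mem _ _).2 ⟨α, hA α hα, (hP_mem _ _).2 ⟨σ, hel _ _ _ hn hσ, rfl⟩⟩
  map_bound := by
    obtain ⟨B, hB, hmap⟩ := hD.map_bound
    obtain ⟨P, hP, hP_mem⟩ := IsPR.exists_image (Γ := M × M × M × M × M)
      (u := fun z => B (pairFst z.2.2.2.2, z.2.1, z.2.2.1, z.2.2.2.1, pairSnd z.2.2.2.2))
      (F := fun z τ => pair (pairFst z.2.2.2.2) τ) (by fun_prop) (by fun_prop)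
    refine ⟨P, hP, ?_⟩
    rintro z m n f _ _ ⟨α, σ, τ, rfl, rfl, -, hστ⟩
    exact (hP_mem _ _).2 ⟨τ, by simpa using hmap _ _ _ _ _ _ hστ, by simp⟩

end Predil

theorem IsUniv.ext_mem {U p : M} (hU : IsUniv U) {D : Predil M} {X : ClassOrder M}
    (hD : ∀ n σ, n ∈ᴹ om → D.El n σ → σ ∈ᴹ U) (hX : ∀ x, X.mem x → x ∈ᴹ U)
    (hp : (D.ext X).mem p) : p ∈ᴹ U := by
  obtain ⟨σ, a, n, e, rfl, he, hσ⟩ := hp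
  exact hU.pair (hD n σ hσ.1 hσ.2.1) (he.set_mem_univ hU fun x hx => hX x (he.mem hx))

namespace Predil

variable {D : Predil M} {γ : M}

theorem exists_shift_el_bound (hD : D.IsDefinable) (γ : M) :
    ∃ B, ∀ n p, n ∈ᴹ om → (D.shift γ).El n p → p ∈ᴹ B := by
  obtain ⟨B, -, hel⟩ := hD.el_bound
  have hU := isUniv_univ (pair (B empty) γ)
  obtain ⟨hB, hγ⟩ := hU.pair_mem_iff.1 (mem_univ_self _)
  refine ⟨_, fun n p hn hp => hU.ext_mem (fun k σ hk hσ => hU.mem_of_mem hB (hel _ k σ hk hσ))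
    (fun x hx => ?_) hp⟩
  obtain ⟨z, hz, rfl⟩ | ⟨i, hi, rfl⟩ := ordOrder_add_cases hx
  · exact hU.pair hU.empty (hU.mem_of_mem hγ hz)
  · exact hU.pair (hU.adj hU.empty hU.empty) (hU.of_mem_om i (mem_om_of_mem hn hi))

theorem exists_shift_map_eq (D : Predil M) (γ : M) : ∃ F : M × M × M → M, IsPR M F ∧
    ∀ m n f p q, (D.shift γ).map m n f p q ↔ ∃ σ a, p = pair σ a ∧ q = F (m, f, p) := by
  obtain ⟨A, hA, hA_mem⟩ := IsPR.exists_sep (Γ := M × M × M) (u := fun z => pairSnd z.2.2)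
    (P := fun z x => ((ordOrder γ).add (ordOrder z.1)).mem x) (by fun_prop) (by fun_prop)
  obtain ⟨B, hB, hB_mem⟩ := IsPR.exists_image (F := fun z x => addFun z.2.1 x) hA (by fun_prop)
  refine ⟨fun z => pair (pairFst z.2.2) (B z), by fun_prop, fun m n f p q => ⟨?_, ?_⟩⟩
  · rintro ⟨σ, a, b, rfl, rfl, hb⟩
    have hb' : b = B (m, f, pair σ a) := set_ext fun y => by
      simp [hb, hB_mem, hA_mem, addMap_iff, and_assoc]
    exact ⟨σ, a, rfl, by simpa using hb'⟩
  · rintro ⟨σ, a, rfl, rfl⟩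
    exact ⟨σ, a, B (m, f, pair σ a), rfl, by simp, fun y => by
      simp [hB_mem, hA_mem, addMap_iff, and_assoc]⟩

theorem IsDefinable.shift (hD : D.IsDefinable) (γ : M) : (D.shift γ).IsDefinable := by
  obtain ⟨F, hF, hF_eq⟩ := D.exists_shift_map_eq γ
  refine ⟨?_, ?_, ?_, by unfold Predil.shift; fun_prop, ?_, ?_⟩
  · unfold Predil.shift
    fun_prop (disch := assumption)
  · unfold Predil.shift
    fun_prop (disch := assumption)
  · simp only [hF_eq]
    fun_prop
  · obtain ⟨B, hB⟩ := D.exists_shift_el_bound hD γ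
    exact ⟨fun _ => B, by fun_prop, fun _ => hB⟩
  · refine ⟨fun z => adj empty (F (z.2.1, z.2.2.2.1, z.2.2.2.2)), by fun_prop, ?_⟩
    intro z m n f p q hpq
    obtain ⟨σ, a, -, hq⟩ := (hF_eq m n f p q).1 hpq
    simpa using hq

end Predil

end

section

variable {M : Type u} [SetStructure M] [ModelsPRS M]
variable {Γ : Type*} [TupleCoded M Γ]

/-! ### Terms -/

namespace Predil

/-- A term over `X` is an element of `D(X)` that lies above the elements of its support, where
these are themselves considered as elements of `D(X)`. -/
def IsTerm (D : Predil M) (X : ClassOrder M) (p : M) : Prop :=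
  (D.ext X).mem p ∧ ∀ s, extSupp p s → (D.ext X).lt s p

/-- The reflexive order on terms over `X`. -/
def TermLe (D : Predil M) (X : ClassOrder M) (p q : M) : Prop :=
  D.IsTerm X p ∧ D.IsTerm X q ∧ (p = q ∨ (D.ext X).lt p q)

/-- The order `X` is the least fixed point of the construction that maps an order `X` to the
suborder of terms in `D(X)`. -/
structure IsTermOrder (D : Predil M) (X : ClassOrder M) : Prop where
  smallLinear : SmallLinear X
  mem_iff : ∀ p, X.mem p ↔ D.IsTerm X p
  lt_iff : ∀ {p q}, X.mem p → X.mem q → (X.lt p q ↔ (D.ext X).lt p q)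
  induction : ∀ P : M → Prop, IsPR M P →
    (∀ p, X.mem p → (∀ s, extSupp p s → P s) → P p) → ∀ p, X.mem p → P p

omit [ModelsPRS M] in
theorem TermLe.left {D : Predil M} {X : ClassOrder M} {p q : M} (h : D.TermLe X p q) :
    D.TermLe X p p :=
  ⟨h.1, h.1, Or.inl rfl⟩

omit [ModelsPRS M] in
theorem TermLe.right {D : Predil M} {X : ClassOrder M} {p q : M} (h : D.TermLe X p q) :
    D.TermLe X q q :=
  ⟨h.2.1, h.2.1, Or.inl rfl⟩

section Suborder

variable {D : Predil M} {X Y : ClassOrder M} {p q : M}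

theorem ext_mem_iff_of_suborder (h : X.IsEmbedding Y id) (hX : X.IsLinear) (hY : Y.IsLinear)
    (hp : ∀ x, extSupp p x → X.mem x) : (D.ext X).mem p ↔ (D.ext Y).mem p :=
  ⟨fun hpX => ext_mem_of_extSupp hpX (fun _ hx => h.mem (hp _ hx))
      fun _ _ hx hy => h.lt (hp _ hx) (hp _ hy),
    fun hpY => ext_mem_of_extSupp hpY hp
      fun _ _ hx hy => (h.lt_iff hX hY (hp _ hx) (hp _ hy)).1⟩

theorem ext_lt_iff_of_suborder (h : X.IsEmbedding Y id) (hX : X.IsLinear) (hY : Y.IsLinear)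
    (hp : (D.ext X).mem p) (hq : (D.ext X).mem q) : (D.ext X).lt p q ↔ (D.ext Y).lt p q := by
  have hmem : ∀ {p}, (D.ext X).mem p → (D.ext Y).mem p := fun hp =>
    (ext_mem_iff_of_suborder h hX hY fun _ => mem_of_extSupp hp).1 hp
  have hsupp : ∀ x, extSupp p x ∨ extSupp q x → X.mem x := fun _ hx =>
    hx.elim (mem_of_extSupp hp) (mem_of_extSupp hq)
  exact ⟨fun hpq => ext_lt_of_extSupp hp hq hpq (fun _ hx => h.mem (hsupp _ hx))
      fun _ _ hx hy => h.lt (hsupp _ hx) (hsupp _ hy),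
    fun hpq => ext_lt_of_extSupp (hmem hp) (hmem hq) hpq hsupp
      fun _ _ hx hy => (h.lt_iff hX hY (hsupp _ hx) (hsupp _ hy)).1⟩

theorem isTerm_iff_of_suborder (h : X.IsEmbedding Y id) (hX : X.IsLinear) (hY : Y.IsLinear)
    (hXD : ∀ s, X.mem s → (D.ext X).mem s) (hp : ∀ x, extSupp p x → X.mem x) :
    D.IsTerm X p ↔ D.IsTerm Y p := by
  unfold IsTerm
  rw [← ext_mem_iff_of_suborder h hX hY hp]
  exact and_congr_right fun hpX => forall₂_congr fun s hs =>
    ext_lt_iff_of_suborder h hX hY (hXD s (hp s hs)) hpX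

theorem termLe_iff_of_suborder (h : X.IsEmbedding Y id) (hX : X.IsLinear) (hY : Y.IsLinear)
    (hXD : ∀ s, X.mem s → (D.ext X).mem s) (hp : ∀ x, extSupp p x → X.mem x)
    (hq : ∀ x, extSupp q x → X.mem x) : D.TermLe X p q ↔ D.TermLe Y p q := by
  unfold TermLe
  rw [← isTerm_iff_of_suborder h hX hY hXD hp, ← isTerm_iff_of_suborder h hX hY hXD hq]
  exact and_congr_right fun hpX => and_congr_right fun hqX =>
    or_congr_right (ext_lt_iff_of_suborder h hX hY hpX.1 hqX.1)

end Suborder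

end Predil

/-! ### The stages of the term order -/

/-- The strict order on the field of the reflexive order relation `S` (a set of ordered pairs). -/
def strictPart (S : M) : ClassOrder M where
  mem x := pair x x ∈ᴹ S
  lt x y := x ≠ y ∧ pair x y ∈ᴹ S

theorem strictPart_mem_univ {S x : M} (h : (strictPart S).mem x) : x ∈ᴹ univ S :=
  ((isUniv_univ S).pair_mem_iff.1 ((isUniv_univ S).mem_of_mem (mem_univ_self S) h)).1

@[fun_prop]
theorem isPROrder_strictPart {S : Γ → M} (hS : IsPR M S) :
    IsPROrder (fun z => strictPart (S z)) :=
  ⟨by unfold strictPart; fun_prop, by unfold strictPart; fun_prop⟩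

theorem smallLinear_strictPart {S : M} (h : (strictPart S).IsLinear) :
    SmallLinear (strictPart S) :=
  ⟨h, ⟨univ S, fun _ => strictPart_mem_univ⟩, by unfold strictPart; fun_prop,
    by unfold strictPart; fun_prop⟩

omit [ModelsPRS M] in
theorem isEmbedding_strictPart {S S' : M} (h : ∀ p q, pair p q ∈ᴹ S → pair p q ∈ᴹ S') :
    (strictPart S).IsEmbedding (strictPart S') id :=
  ⟨h _ _, fun _ _ hxy => ⟨hxy.1, h _ _ hxy.2⟩⟩

theorem IsPR.isLinear_strictPart {S : Γ → M} (hS : IsPR M S) :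
    IsPR M (fun z => (strictPart (S z)).IsLinear) := by
  refine congr (Q := fun z => (∀ x, x ∈ᴹ ATRSet.univ (S z) → (strictPart (S z)).mem x →
      ¬ (strictPart (S z)).lt x x) ∧
    (∀ x, x ∈ᴹ ATRSet.univ (S z) → ∀ y, y ∈ᴹ ATRSet.univ (S z) → ∀ w, w ∈ᴹ ATRSet.univ (S z) →
      (strictPart (S z)).mem x → (strictPart (S z)).mem y → (strictPart (S z)).mem w →
      (strictPart (S z)).lt x y → (strictPart (S z)).lt y w → (strictPart (S z)).lt x w) ∧
    (∀ x, x ∈ᴹ ATRSet.univ (S z) → ∀ y, y ∈ᴹ ATRSet.univ (S z) → (strictPart (S z)).mem x →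
      (strictPart (S z)).mem y →
      (strictPart (S z)).lt x y ∨ x = y ∨ (strictPart (S z)).lt y x)) (by fun_prop) fun z => ?_
  have := fun x => strictPart_mem_univ (S := S z) (x := x)
  unfold ClassOrder.IsLinear
  grind

namespace Predil

variable {D : Predil M}

/-- The relation `S` is a linear order between elements of `D(X)` that are terms over `X`, where
`X` is the order given by `S` itself. -/
structure IsStage (D : Predil M) (S : M) : Prop where
  isLinear : (strictPart S).IsLinear
  termLe : ∀ {p q}, pair p q ∈ᴹ S → D.TermLe (strictPart S) p q
  mem_left : ∀ {p q}, pair p q ∈ᴹ S → (strictPart S).mem p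
  mem_right : ∀ {p q}, pair p q ∈ᴹ S → (strictPart S).mem q

@[fun_prop]
theorem isPR_termLe (hD : D.IsDefinable) {X : Γ → ClassOrder M} {p q : Γ → M}
    (hX : IsPROrder X) (hp : IsPR M p) (hq : IsPR M q) :
    IsPR M (fun z => D.TermLe (X z) (p z) (q z)) := by
  have isTerm : ∀ {p : Γ → M}, IsPR M p → IsPR M (fun z => D.IsTerm (X z) (p z)) := fun {p} hp => by
    refine IsPR.congr (Q := fun z => (D.ext (X z)).mem (p z) ∧
      ∀ s, s ∈ᴹ univ (p z) → extSupp (p z) s → (D.ext (X z)).lt s (p z))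
      (by fun_prop (disch := assumption)) fun z => ?_
    have hs : ∀ s, extSupp (p z) s → s ∈ᴹ univ (p z) := fun s ⟨σ, a, h, hs⟩ => by
      have hU := isUniv_univ (p z)
      have hp : pair σ a ∈ᴹ univ (p z) := h ▸ mem_univ_self (p z)
      exact hU.mem_of_mem (hU.pair_mem_iff.1 hp).2 hs
    unfold IsTerm
    grind
  unfold TermLe
  exact (isTerm hp).and ((isTerm hq).and (by fun_prop (disch := assumption)))

theorem isPR_isStage (hD : D.IsDefinable) {S : Γ → M} (hS : IsPR M S) :
    IsPR M (fun z => D.IsStage (S z)) := by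
  refine IsPR.congr (Q := fun z => (strictPart (S z)).IsLinear ∧
    ∀ p, p ∈ᴹ univ (S z) → ∀ q, q ∈ᴹ univ (S z) → pair p q ∈ᴹ S z →
      D.TermLe (strictPart (S z)) p q ∧ (strictPart (S z)).mem p ∧ (strictPart (S z)).mem q)
    (IsPR.and (IsPR.isLinear_strictPart hS) (by fun_prop (disch := assumption))) fun z => ?_
  have hU := isUniv_univ (S z)
  have hpq : ∀ p q, pair p q ∈ᴹ S z → p ∈ᴹ univ (S z) ∧ q ∈ᴹ univ (S z) := fun p q h =>
    hU.pair_mem_iff.1 (hU.mem_of_mem (mem_univ_self _) h)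
  exact ⟨fun h => ⟨h.isLinear, fun p _ q _ h' => ⟨h.termLe h', h.mem_left h', h.mem_right h'⟩⟩,
    fun h => ⟨h.1, fun h' => (h.2 _ (hpq _ _ h').1 _ (hpq _ _ h').2 h').1,
      fun h' => (h.2 _ (hpq _ _ h').1 _ (hpq _ _ h').2 h').2.1,
      fun h' => (h.2 _ (hpq _ _ h').1 _ (hpq _ _ h').2 h').2.2⟩⟩

namespace IsStage

variable {S S' : M}

omit [ModelsPRS M] in
theorem ext_mem (h : D.IsStage S) {p : M} (hp : (strictPart S).mem p) :
    (D.ext (strictPart S)).mem p :=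
  (h.termLe hp).1.1

theorem isLinear_step (hD : D.IsWeakPredilator) (h : D.IsStage S)
    (hS' : ∀ p q, pair p q ∈ᴹ S' ↔ D.TermLe (strictPart S) p q) : (strictPart S').IsLinear := by
  have hlin := hD.ext_isLinear (smallLinear_strictPart h.isLinear)
  have mem : ∀ {p}, (strictPart S').mem p → (D.ext (strictPart S)).mem p := fun hp =>
    ((hS' _ _).1 hp).1.1
  have lt_iff : ∀ {p q}, (strictPart S').mem p → (strictPart S').mem q →
      ((strictPart S').lt p q ↔ (D.ext (strictPart S)).lt p q) := fun {p q} hp hq =>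
    ⟨fun hpq => ((hS' p q).1 hpq.2).2.2.resolve_left hpq.1,
      fun hpq => ⟨fun he => hlin.irrefl (mem hp) (he ▸ hpq),
        (hS' p q).2 ⟨((hS' p p).1 hp).1, ((hS' q q).1 hq).1, Or.inr hpq⟩⟩⟩
  refine ⟨fun x _ hx => hx.1 rfl, fun x y z hx hy hz hxy hyz => ?_, fun x y hx hy => ?_⟩
  · rw [lt_iff hx hz]
    exact hlin.trans (mem hx) (mem hy) (mem hz) ((lt_iff hx hy).1 hxy) ((lt_iff hy hz).1 hyz)
  · rw [lt_iff hx hy, lt_iff hy hx]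
    exact hlin.trichotomy (mem hx) (mem hy)

theorem step (hD : D.IsWeakPredilator) (h : D.IsStage S)
    (hS' : ∀ p q, pair p q ∈ᴹ S' ↔ D.TermLe (strictPart S) p q) : D.IsStage S' where
  isLinear := h.isLinear_step hD hS'
  termLe {p q} hpq := by
    have hpq := (hS' p q).1 hpq
    exact (termLe_iff_of_suborder (isEmbedding_strictPart fun p q hpq => (hS' p q).2 (h.termLe hpq))
      h.isLinear (h.isLinear_step hD hS') (fun _ => h.ext_mem)
      (fun _ => Predil.mem_of_extSupp hpq.1.1) (fun _ => Predil.mem_of_extSupp hpq.2.1.1)).1 hpq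
  mem_left hpq := (hS' _ _).2 ((hS' _ _).1 hpq).left
  mem_right hpq := (hS' _ _).2 ((hS' _ _).1 hpq).right

end IsStage

theorem exists_termLe_set (hD : D.IsDefinable) : ∃ Φ : M → M, IsPR M Φ ∧
    ∀ S p q, pair p q ∈ᴹ Φ S ↔ D.TermLe (strictPart S) p q := by
  obtain ⟨B, -, hB⟩ := hD.el_bound
  obtain ⟨Φ, hΦ, hΦ_mem⟩ := IsPR.exists_sep (Γ := M) (u := fun S => univ (pair (B ATRSet.empty) S))
    (P := fun S z => ∃ p q, z = pair p q ∧ D.TermLe (strictPart S) p q) (by fun_prop)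
    (by fun_prop (disch := assumption))
  refine ⟨Φ, hΦ, fun S p q => ?_⟩
  have hU := isUniv_univ (pair (B ATRSet.empty) S)
  obtain ⟨hBU, hSU⟩ := hU.pair_mem_iff.1 (mem_univ_self _)
  have mem_univ : ∀ {p}, D.IsTerm (strictPart S) p → p ∈ᴹ univ (pair (B ATRSet.empty) S) :=
    fun hp => hU.ext_mem (fun n σ hn hσ => hU.mem_of_mem hBU (hB _ n σ hn hσ))
      (fun x hx => (hU.pair_mem_iff.1 (hU.mem_of_mem hSU hx)).1) hp.1
  rw [hΦ_mem]
  constructor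
  · rintro ⟨-, p', q', h, hpq⟩
    obtain ⟨rfl, rfl⟩ := pair_inj.1 h
    exact hpq
  · exact fun hpq => ⟨hU.pair (mem_univ hpq.1) (mem_univ hpq.2.1), p, q, rfl, hpq⟩

theorem exists_stages (hD : D.IsDefinable) : ∃ W : M → M, IsPR M W ∧
    ∀ n p q, pair p q ∈ᴹ W n ↔ ∃ m, m ∈ᴹ n ∧ D.TermLe (strictPart (W m)) p q := by
  obtain ⟨Φ, hΦ, hΦ_mem⟩ := exists_termLe_set hD
  obtain ⟨R, hR, hR_eq⟩ := IsPR.exists_recursion (Γ := M) (h := fun w _ _ => Φ w) (by fun_prop)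
  obtain ⟨W, hW, hW_mem⟩ := IsPR.exists_bUnion (Γ := M) (u := fun n => n)
    (F := fun _ m => R m ATRSet.empty) (by fun_prop) (by fun_prop)
  have hRW : ∀ n, R n ATRSet.empty = Φ (W n) := fun n => by
    obtain ⟨w, hw, h⟩ := hR_eq n ATRSet.empty
    rw [h, show w = W n from set_ext fun z => by rw [hw, hW_mem]]
  exact ⟨W, hW, fun n p q => by simp only [hW_mem, hRW, hΦ_mem]⟩

end Predil

end

section

variable {M : Type u} [SetStructure M] [ModelsPRS M]
variable {D : Predil M} {W : M → M}

namespace Predil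

/-! ### The union of the stages -/

section Stages

variable (hD : D.IsWeakPredilator) (hdef : D.IsDefinable) (hW : IsPR M W)
  (hW_iff : ∀ n p q, pair p q ∈ᴹ W n ↔ ∃ m, m ∈ᴹ n ∧ D.TermLe (strictPart (W m)) p q)

include hW_iff in
omit [ModelsPRS M] in
theorem stage_mono {m n : M} (hn : IsOrd n) (hmn : m ∈ᴹ n) {p q : M} (h : pair p q ∈ᴹ W m) :
    pair p q ∈ᴹ W n := by
  obtain ⟨k, hk, hpq⟩ := (hW_iff m p q).1 h
  exact (hW_iff n p q).2 ⟨k, hn.1 m hmn k hk, hpq⟩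

include hW_iff in
theorem stage_succ {n : M} (hn : D.IsStage (W n)) (p q : M) :
    pair p q ∈ᴹ W (adj n n) ↔ D.TermLe (strictPart (W n)) p q := by
  rw [hW_iff]
  constructor
  · rintro ⟨m, hm, hpq⟩
    rcases mem_adj.1 hm with hm | rfl
    · exact hn.termLe ((hW_iff n p q).2 ⟨m, hm, hpq⟩)
    · exact hpq
  · exact fun hpq => ⟨n, by simp, hpq⟩

include hD hdef hW hW_iff

theorem isStage_of_mem_om {n : M} (hn : n ∈ᴹ om) : D.IsStage (W n) := by
  refine om_induction (P := fun n => D.IsStage (W n)) (isPR_isStage hdef hW) ?_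
    (fun n _ ih => ih.step hD (stage_succ hW_iff ih)) n hn
  have : ∀ p q, ¬ pair p q ∈ᴹ W ATRSet.empty := by simp [hW_iff]
  refine ⟨⟨?_, ?_, ?_⟩, ?_, ?_, ?_⟩ <;> simp [strictPart, this]

theorem mem_stage_om_iff {p q : M} : pair p q ∈ᴹ W om ↔ ∃ n, n ∈ᴹ om ∧ pair p q ∈ᴹ W n := by
  refine ⟨fun h => ?_, fun ⟨n, hn, h⟩ => stage_mono hW_iff isOrd_om hn h⟩
  obtain ⟨n, hn, hpq⟩ := (hW_iff om p q).1 h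
  exact ⟨_, succ_mem_om hn,
    (stage_succ hW_iff (isStage_of_mem_om hD hdef hW hW_iff hn) p q).2 hpq⟩

omit hD hdef hW in
theorem exists_stage_ge {m n : M} (hm : m ∈ᴹ om) (hn : n ∈ᴹ om) : ∃ k, k ∈ᴹ om ∧
    (∀ p q, pair p q ∈ᴹ W m → pair p q ∈ᴹ W k) ∧ ∀ p q, pair p q ∈ᴹ W n → pair p q ∈ᴹ W k := by
  have hmo := isOrd_of_mem_om hm
  have hno := isOrd_of_mem_om hn
  rcases hmo.trichotomy hno with h | rfl | h
  · exact ⟨n, hn, fun _ _ => stage_mono hW_iff hno h, fun _ _ => id⟩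
  · exact ⟨m, hm, fun _ _ => id, fun _ _ => id⟩
  · exact ⟨m, hm, fun _ _ => id, fun _ _ => stage_mono hW_iff hmo h⟩

theorem isLinear_stage_om : (strictPart (W om)).IsLinear := by
  have common : ∀ {p q p' q'}, pair p q ∈ᴹ W om → pair p' q' ∈ᴹ W om →
      ∃ k, k ∈ᴹ om ∧ pair p q ∈ᴹ W k ∧ pair p' q' ∈ᴹ W k := fun h h' => by
    obtain ⟨m, hm, h⟩ := (mem_stage_om_iff hD hdef hW hW_iff).1 h
    obtain ⟨n, hn, h'⟩ := (mem_stage_om_iff hD hdef hW hW_iff).1 h'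
    obtain ⟨k, hk, hmk, hnk⟩ := exists_stage_ge hW_iff hm hn
    exact ⟨k, hk, hmk _ _ h, hnk _ _ h'⟩
  have lt_mono : ∀ {k p q}, k ∈ᴹ om → (strictPart (W k)).lt p q → (strictPart (W om)).lt p q :=
    fun hk h => ⟨h.1, stage_mono hW_iff isOrd_om hk h.2⟩
  refine ⟨fun x _ hx => hx.1 rfl, fun x y z _ _ _ hxy hyz => ?_, fun x y hx hy => ?_⟩
  · obtain ⟨k, hk, hxy', hyz'⟩ := common hxy.2 hyz.2
    have hWk := isStage_of_mem_om hD hdef hW hW_iff hk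
    exact lt_mono hk (hWk.isLinear.trans (hWk.mem_left hxy') (hWk.mem_right hxy')
      (hWk.mem_right hyz') ⟨hxy.1, hxy'⟩ ⟨hyz.1, hyz'⟩)
  · obtain ⟨k, hk, hx', hy'⟩ := common hx hy
    have hWk := isStage_of_mem_om hD hdef hW hW_iff hk
    exact (hWk.isLinear.trichotomy hx' hy').imp (lt_mono hk) (Or.imp id (lt_mono hk))

theorem exists_stage_of_finSub {a : M} (ha : FinSub (strictPart (W om)) a) :
    ∃ n, n ∈ᴹ om ∧ ∀ x, x ∈ᴹ a → (strictPart (W n)).mem x := by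
  have hom := smallLinear_strictPart (isLinear_stage_om hD hdef hW hW_iff)
  refine hom.finSub_induction
    (P := fun a => ∃ n, n ∈ᴹ om ∧ ∀ x, x ∈ᴹ a → (strictPart (W n)).mem x)
    (by fun_prop) ⟨ATRSet.empty, by simp, by simp⟩ (fun a y _ hy _ ⟨n, hn, ih⟩ => ?_) a ha
  obtain ⟨m, hm, hy⟩ := (mem_stage_om_iff hD hdef hW hW_iff).1 hy
  obtain ⟨k, hk, hnk, hmk⟩ := exists_stage_ge hW_iff hn hm
  refine ⟨k, hk, fun x hx => ?_⟩
  rcases mem_adj.1 hx with hx | rfl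
  · exact hnk _ _ (ih x hx)
  · exact hmk _ _ hy

theorem stage_om_iff {p q : M} : pair p q ∈ᴹ W om ↔ D.TermLe (strictPart (W om)) p q := by
  have hlin := isLinear_stage_om hD hdef hW hW_iff
  have termLe_iff : ∀ {n}, n ∈ᴹ om → (∀ x, extSupp p x → (strictPart (W n)).mem x) →
      (∀ x, extSupp q x → (strictPart (W n)).mem x) →
      (D.TermLe (strictPart (W n)) p q ↔ D.TermLe (strictPart (W om)) p q) := fun hn hp hq => by
    have hWn := isStage_of_mem_om hD hdef hW hW_iff hn
    exact termLe_iff_of_suborder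
      (isEmbedding_strictPart fun _ _ => stage_mono hW_iff isOrd_om hn) hWn.isLinear hlin
      (fun _ => hWn.ext_mem) hp hq
  constructor
  · intro h
    obtain ⟨n, hn, hpq⟩ := (hW_iff om p q).1 h
    exact (termLe_iff hn (fun _ => mem_of_extSupp hpq.1.1)
      fun _ => mem_of_extSupp hpq.2.1.1).1 hpq
  · intro h
    obtain ⟨a, ha, ha_iff⟩ := exists_finSub_extSupp h.1.1
    obtain ⟨b, hb, hb_iff⟩ := exists_finSub_extSupp h.2.1.1
    obtain ⟨n, hn, hab⟩ := exists_stage_of_finSub hD hdef hW hW_iff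
      ((smallLinear_strictPart hlin).finSub_cup ha hb)
    exact (hW_iff om p q).2 ⟨n, hn, (termLe_iff hn
      (fun x hx => hab x (mem_cup.2 (Or.inl ((ha_iff x).1 hx))))
      fun x hx => hab x (mem_cup.2 (Or.inr ((hb_iff x).1 hx)))).2 h⟩

theorem stage_om_induction {P : M → Prop} (hP : IsPR M P)
    (ih : ∀ p, (strictPart (W om)).mem p → (∀ s, extSupp p s → P s) → P p) :
    ∀ p, (strictPart (W om)).mem p → P p := by
  have stage : ∀ n, n ∈ᴹ om → ∀ p, p ∈ᴹ univ (W n) → (strictPart (W n)).mem p → P p := by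
    refine om_induction (P := fun n => ∀ p, p ∈ᴹ univ (W n) → (strictPart (W n)).mem p → P p)
      (by fun_prop) (fun p _ hp => ?_) fun n hn ihn p _ hp => ?_
    · obtain ⟨m, hm, -⟩ := (hW_iff _ p p).1 hp
      exact absurd hm (by simp)
    · have hWn := isStage_of_mem_om hD hdef hW hW_iff hn
      refine ih p ((mem_stage_om_iff hD hdef hW hW_iff).2 ⟨_, succ_mem_om hn, hp⟩) fun s hs => ?_
      have hsn := mem_of_extSupp ((stage_succ hW_iff hWn p p).1 hp).1.1 hs
      exact ihn s (strictPart_mem_univ hsn) hsn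
  intro p hp
  obtain ⟨n, hn, hpn⟩ := (mem_stage_om_iff hD hdef hW hW_iff).1 hp
  exact stage n hn p (strictPart_mem_univ hpn) hpn

end Stages

theorem exists_isTermOrder (hD : D.IsWeakPredilator) (hdef : D.IsDefinable) :
    ∃ X, D.IsTermOrder X := by
  obtain ⟨W, hW, hW_iff⟩ := exists_stages hdef
  have hX := smallLinear_strictPart (isLinear_stage_om hD hdef hW hW_iff)
  have le_iff : ∀ {p q}, pair p q ∈ᴹ W om ↔ D.TermLe (strictPart (W om)) p q :=
    stage_om_iff hD hdef hW hW_iff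
  have mem_iff : ∀ {p}, (strictPart (W om)).mem p ↔ D.IsTerm (strictPart (W om)) p :=
    le_iff.trans ⟨And.left, fun h => ⟨h, h, Or.inl rfl⟩⟩
  refine ⟨strictPart (W om), hX, fun p => mem_iff, fun {p q} hp hq => ?_,
    fun P hP => stage_om_induction hD hdef hW hW_iff hP⟩
  refine ⟨fun h => (le_iff.1 h.2).2.2.resolve_left h.1, fun h => ⟨fun hpq => ?_,
    le_iff.2 ⟨mem_iff.1 hp, mem_iff.1 hq, Or.inr h⟩⟩⟩
  exact (hD.ext_isLinear hX).irrefl (mem_iff.1 hp).1 (hpq ▸ h)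

end Predil

end

section

variable {M : Type u} [SetStructure M] [ModelsPRS M]

/-! ### Fixed points inside the term order -/

theorem exists_leftInverse (A : M) {F : M → M} (hF : IsPR M F)
    (hinj : ∀ x y, x ∈ᴹ A → y ∈ᴹ A → F x = F y → x = y) : ∃ g, ∀ x, x ∈ᴹ A → app g (F x) = x := by
  obtain ⟨B, hB⟩ := exists_image A hF
  obtain ⟨g, -, hg⟩ := exists_fun_of_rel B A (R := fun y x => x ∈ᴹ A ∧ y = F x) (by fun_prop)
    (fun y hy => by
      obtain ⟨x, hx, hxy⟩ := (hB y).1 hy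
      exact ⟨x, hx, hx, hxy⟩)
    fun y x x' _ hx hx' => hinj x x' hx.1 hx'.1 (hx.2.symm.trans hx'.2)
  refine ⟨g, fun x hx => ?_⟩
  obtain ⟨hgx, -, hx_eq⟩ := hg (F x) ((hB _).2 ⟨x, hx, rfl⟩)
  exact (hinj _ _ hx hgx hx_eq).symm

theorem exists_course_of_values_recursion {H : M → M → M}
    (hH : IsPR M (fun z : M × M => H z.1 z.2)) : ∃ k : M → M, IsPR M k ∧
      ∀ β, ∃ w, (∀ x, x ∈ᴹ β → app w x = k x) ∧ k β = H w β := by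
  obtain ⟨R, hR, hR_eq⟩ := IsPR.exists_recursion (Γ := M)
    (h := fun w β _ => adj empty (pair β (H w β))) (by fun_prop)
  obtain ⟨W, hW, hW_mem⟩ := IsPR.exists_bUnion (Γ := M) (u := fun β => β)
    (F := fun _ x => R x empty) (by fun_prop)
    (hR.comp (f := fun z : M × M => (z.2, empty)) (by fun_prop))
  have hR_W : ∀ β, R β empty = adj empty (pair β (H (W β) β)) := fun β => by
    obtain ⟨w, hw, hRβ⟩ := hR_eq β empty
    rw [hRβ, show w = W β from set_ext fun z => (hw z).trans (hW_mem β z).symm]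
  have hW_pair : ∀ β x y, pair x y ∈ᴹ W β ↔ x ∈ᴹ β ∧ y = H (W x) x := fun β x y => by
    simp only [hW_mem, hR_W, mem_adj, not_mem_empty, false_or, pair_inj]
    grind
  refine ⟨fun β => H (W β) β, by fun_prop, fun β => ⟨W β, fun x hx => ?_, rfl⟩⟩
  have hx_pair := (hW_pair β x _).2 ⟨hx, rfl⟩
  exact app_eq ⟨_, hx_pair, fun y hy => ((hW_pair β x y).1 hy).2⟩ hx_pair

namespace Predil

theorem exists_recursive_extImage (π : M) : ∃ k : M → M, IsPR M k ∧
    ∀ β, (∃ σ a, app π β = pair σ a) → (∀ x, extSupp (app π β) x → x ∈ᴹ β) →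
      ExtImage k (app π β) (k β) := by
  obtain ⟨J, hJ, hJ_mem⟩ := IsPR.exists_image (Γ := M × M) (u := fun z => pairSnd (app π z.2))
    (F := fun z x => app z.1 x) (by fun_prop) (by fun_prop)
  obtain ⟨k, hk, hk_eq⟩ := exists_course_of_values_recursion
    (H := fun w β => pair (pairFst (app π β)) (J (w, β))) (by fun_prop)
  refine ⟨k, hk, fun β ⟨σ, a, hβ⟩ hsupp => ?_⟩
  obtain ⟨w, hw, hkβ⟩ := hk_eq β
  simp only [hβ, extSupp_pair] at hsupp
  rw [hkβ, hβ, pairFst_pair, extImage_pair]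
  refine ⟨J (w, β), rfl, fun y => ?_⟩
  simp only [hJ_mem, hβ, pairSnd_pair]
  exact exists_congr fun x => and_congr_right fun hx => by rw [hw x (hsupp x hx)]

end Predil

namespace IsCollapse

variable {D D' : Predil M} {X : ClassOrder M} {Ω π : M} {k : M → M}

theorem exists_extImage (h : IsCollapse (D.ext (ordOrder Ω)) Ω π) :
    ∃ k, IsPR M k ∧ ∀ β, β ∈ᴹ Ω → Predil.ExtImage k (app π β) (k β) := by
  obtain ⟨k, hk, hkπ⟩ := Predil.exists_recursive_extImage π
  refine ⟨k, hk, fun β hβ => hkπ β ?_ fun α => h.supp hβ⟩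
  obtain ⟨σ, a, n, e, hβ_eq, -, -⟩ := h.isEmbedding.mem hβ
  exact ⟨σ, a, hβ_eq⟩

variable (h : IsCollapse (D'.ext (ordOrder Ω)) Ω π) (hk : IsPR M k)
  (hkπ : ∀ β, β ∈ᴹ Ω → Predil.ExtImage k (app π β) (k β)) (hX : D.IsTermOrder X)
  (hD : D.IsWeakPredilator) (hD' : D'.IsWeakPredilator) (hD'D : D'.IsInitial D)
include h hk hkπ hX hD hD' hD'D

theorem isEmbedding_termOrder : (ordOrder Ω).IsEmbedding X k := by
  have hΩ := h.isOrd
  have hπ := h.isEmbedding.of_isInitial (hD'D.ext hD' hD (smallLinear_ordOrder hΩ))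
  have hsmall := hX.smallLinear
  suffices hk_lt : ∀ β, β ∈ᴹ Ω → X.mem (k β) ∧ ∀ α, α ∈ᴹ β → X.lt (k α) (k β) from
    ⟨fun hβ => (hk_lt _ hβ).1, fun _ hβ hαβ => (hk_lt _ hβ).2 _ hαβ⟩
  refine mem_induction (by fun_prop (disch := assumption)) fun β hβ ih => ?_
  have hβΩ : ∀ {α}, α ∈ᴹ β → α ∈ᴹ Ω := fun hα => hΩ.1 β hβ _ hα
  have hk_mem : ∀ {α}, α ∈ᴹ β → X.mem (k α) := fun hα => (ih _ hα (hβΩ hα)).1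
  have hk_lt : ∀ {α α'}, α' ∈ᴹ β → α ∈ᴹ α' → X.lt (k α) (k α') := fun hα' =>
    (ih _ hα' (hβΩ hα')).2 _
  have hext_mem : (D.ext X).mem (k β) :=
    (hkπ β hβ).ext_mem hk (hπ.mem hβ) (fun _ hx => hk_mem (h.supp hβ hx))
      fun _ _ _ hy => hk_lt (h.supp hβ hy)
  have hext_lt : ∀ {α}, α ∈ᴹ β → (D.ext X).lt (k α) (k β) := fun {α} hα => by
    have hsupp : ∀ x, Predil.extSupp (app π α) x ∨ Predil.extSupp (app π β) x → x ∈ᴹ β :=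
      fun x hx => hx.elim (fun hx => (hΩ.mem hβ).1 α hα x (h.supp (hβΩ hα) hx)) (h.supp hβ)
    exact (hkπ α (hβΩ hα)).ext_lt (hkπ β hβ) hk (hπ.lt (hβΩ hα) hβ hα)
      (fun x hx => hk_mem (hsupp x hx)) fun _ y _ hy => hk_lt (hsupp y hy)
  have hβX : X.mem (k β) := by
    refine (hX.mem_iff _).2 ⟨hext_mem, fun s hs => ?_⟩
    obtain ⟨α, hα, rfl⟩ := (hkπ β hβ).extSupp_iff.1 hs
    exact hext_lt (h.supp hβ hα)
  exact ⟨hβX, fun α hα => (hX.lt_iff (hk_mem hα) hβX).2 (hext_lt hα)⟩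

theorem exists_eq_of_extSupp {t : M} (ht : (D'.ext X).mem t)
    (hlt : ∀ s, Predil.extSupp t s → (D'.ext X).lt s t)
    (hrange : ∀ s, Predil.extSupp t s → ∃ β, β ∈ᴹ Ω ∧ s = k β) : ∃ β, β ∈ᴹ Ω ∧ t = k β := by
  have hΩ := isLinear_ordOrder h.isOrd
  have hXlin := hX.smallLinear.isLinear
  have hemb := h.isEmbedding_termOrder hk hkπ hX hD hD' hD'D
  obtain ⟨j, hj⟩ := exists_leftInverse Ω hk fun _ _ => hemb.inj hΩ hXlin
  have hj_pr : IsPR M (app j) := by fun_prop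
  let K : ClassOrder M := ⟨fun x => ∃ β, β ∈ᴹ Ω ∧ x = k β, X.lt⟩
  have hkK : (ordOrder Ω).IsEmbedding K k := ⟨fun hβ => ⟨_, hβ, rfl⟩, hemb.lt⟩
  have hjK : K.IsEmbedding (ordOrder Ω) (app j) := by
    refine ⟨?_, ?_⟩
    · rintro _ ⟨β, hβ, rfl⟩
      rwa [hj β hβ]
    · rintro _ _ ⟨α, hα, rfl⟩ ⟨β, hβ, rfl⟩ hlt
      rw [hj α hα, hj β hβ]
      exact (hemb.lt_iff hΩ hXlin hα hβ).1 hlt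
  have htK : (D'.ext K).mem t := Predil.ext_mem_of_extSupp ht hrange fun _ _ _ _ h => h
  obtain ⟨τ, hτ⟩ := Predil.exists_extImage_of_ext_mem hj_pr ht
  have hτΩ : (D'.ext (ordOrder Ω)).mem τ := hjK.ext_mem hj_pr htK hτ
  have hτ_gt : ∀ s, Predil.extSupp t s → (D'.ext (ordOrder Ω)).lt (app π (app j s)) τ := by
    intro s hs
    obtain ⟨α, hα, rfl⟩ := hrange s hs
    rw [hj α hα]
    have hkα : (D'.ext K).mem (k α) := hkK.ext_mem hk (h.isEmbedding.mem hα) (hkπ α hα)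
    have hlt' : (D'.ext K).lt (k α) t :=
      Predil.ext_lt_of_extSupp (hemb.ext_mem hk (h.isEmbedding.mem hα) (hkπ α hα)) ht (hlt _ hs)
        (fun x hx => hx.elim (Predil.mem_of_extSupp hkα) (hrange x)) fun _ _ _ _ h => h
    exact hjK.ext_lt hj_pr hkα htK
      ((hkπ α hα).symm fun x hx => hj x (h.isOrd.1 α hα x (h.supp hα hx))) hτ hlt'
  obtain ⟨β, hβ, rfl⟩ := h.surj hτΩ (fun α => Predil.mem_of_extSupp (X := ordOrder Ω) hτΩ)
    fun α hα => by
      obtain ⟨s, hs, rfl⟩ := hτ.extSupp_iff.1 hα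
      exact hτ_gt s hs
  refine ⟨β, hβ, (hτ.symm fun s hs => ?_).unique (hkπ β hβ)⟩
  obtain ⟨α, hα, rfl⟩ := hrange s hs
  rw [hj α hα]

theorem exists_eq_of_mem_termOrder (hdef : D'.IsDefinable) {t : M} (ht : X.mem t)
    (htD' : (D'.ext X).mem t) : ∃ β, β ∈ᴹ Ω ∧ t = k β := by
  have hini := hD'D.ext hD' hD hX.smallLinear
  have hsmall := hX.smallLinear
  refine hX.induction (fun t => (D'.ext X).mem t → ∃ β, β ∈ᴹ Ω ∧ t = k β)
    (by fun_prop (disch := assumption)) (fun t ht ih htD' => ?_) t ht htD'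
  have hterm := (hX.mem_iff t).1 ht
  have hsD' : ∀ s, Predil.extSupp t s → (D'.ext X).mem s := fun s hs =>
    hini.down ((hX.mem_iff s).1 (Predil.mem_of_extSupp htD' hs)).1 htD' (hterm.2 s hs)
  exact h.exists_eq_of_extSupp hk hkπ hX hD hD' hD'D htD'
    (fun s hs => (hini.lt_iff (hsD' s hs) htD').2 (hterm.2 s hs)) fun s hs => ih s hs (hsD' s hs)

end IsCollapse

theorem Predil.IsTermOrder.isWF {I : M → Prop} {E : M → Predil M} {D : Predil M} {X : ClassOrder M}
    (hX : D.IsTermOrder X) (hD : D.IsWeakPredilator) (hE : ∀ μ, I μ → (E μ).IsWeakPredilator)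
    (hED : ∀ μ, I μ → (E μ).IsInitial D) (hdef : ∀ μ, I μ → (E μ).IsDefinable)
    (hcover : ∀ p, (D.ext X).mem p → ∃ μ, I μ ∧ ((E μ).ext X).mem p)
    (hex : ∀ μ, I μ → ∃ Ω, (E μ).IsPsiFixedPoint Ω) : X.IsWF := by
  intro s ⟨t, hts⟩ hs
  have hext : ∀ {x}, x ∈ᴹ s → (D.ext X).mem x := fun hx => ((hX.mem_iff _).1 (hs _ hx)).1
  obtain ⟨μ, hμ, htμ⟩ := hcover t (hext hts)
  obtain ⟨Ω, hΩ⟩ := hex μ hμ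
  obtain ⟨π, hπ⟩ := hΩ.exists_isCollapse (Θ := Ω) fun _ => id
  obtain ⟨k, hk, hkπ⟩ := hπ.exists_extImage
  have hrange : ∀ {x}, x ∈ᴹ s → ((E μ).ext X).mem x → ∃ β, β ∈ᴹ Ω ∧ x = k β := fun hx =>
    hπ.exists_eq_of_mem_termOrder hk hkπ hX hD (hE μ hμ) (hED μ hμ) (hdef μ hμ) (hs _ hx)
  have hemb := hπ.isEmbedding_termOrder hk hkπ hX hD (hE μ hμ) (hED μ hμ)
  obtain ⟨β₀, hβ₀, rfl⟩ := hrange hts htμ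
  obtain ⟨β, hβ, hβs, hmin⟩ := exists_minimal (A := Ω) (P := fun β => k β ∈ᴹ s) (by fun_prop)
    ⟨β₀, hβ₀, hts⟩
  have hβμ : ((E μ).ext X).mem (k β) := hemb.ext_mem hk (hπ.isEmbedding.mem hβ) (hkπ β hβ)
  refine ⟨k β, hβs, fun x hx hxβ => ?_⟩
  have hxβ' := (hX.lt_iff (hs x hx) (hs _ hβs)).1 hxβ
  obtain ⟨α, hα, rfl⟩ := hrange hx
    (((hED μ hμ).ext (hE μ hμ) hD hX.smallLinear).down (hext hx) hβμ hxβ')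
  have hαβ := (hemb.lt_iff (isLinear_ordOrder hπ.isOrd) hX.smallLinear.isLinear hα hβ).1 hxβ
  exact hmin α hαβ hα hx

end

section

variable {M : Type u} [SetStructure M]

/-! ### Order types -/

/-- Axiom beta: every well-founded relation `r` has a collapsing function on its field. -/
def AxiomBeta (M : Type u) [SetStructure M] : Prop :=
  ∀ r : M, WFRel r → ∃ A f : M, (∀ x, x ∈ᴹ A ↔ ∃ y, pair x y ∈ᴹ r ∨ pair y x ∈ᴹ r) ∧
    IsFunOn f A ∧ ∀ y, y ∈ᴹ A → ∀ z, z ∈ᴹ app f y ↔ ∃ x, pair x y ∈ᴹ r ∧ z = app f x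

variable [ModelsPRS M] {X : ClassOrder M}

theorem SmallLinear.exists_set (hX : SmallLinear X) : ∃ A, ∀ x, x ∈ᴹ A ↔ X.mem x := by
  obtain ⟨B, hB⟩ := hX.bdd
  obtain ⟨A, hA⟩ := exists_sep B hX.pr_mem
  exact ⟨A, fun x => (hA x).trans ⟨And.right, fun hx => ⟨hB x hx, hx⟩⟩⟩

-- A new maximal element puts all elements of `X` into the field of the relation.
theorem SmallLinear.exists_rel (hX : SmallLinear X) : ∃ A r : M, ¬ X.mem A ∧
    ∀ x y, pair x y ∈ᴹ r ↔ X.mem x ∧ (X.mem y ∧ X.lt x y ∨ y = A) := by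
  obtain ⟨A, hA⟩ := hX.exists_set
  obtain ⟨r, hr⟩ := exists_sep (univ A) (P := fun p => X.mem (pairFst p) ∧
    (X.mem (pairSnd p) ∧ X.lt (pairFst p) (pairSnd p) ∨ pairSnd p = A))
    (by fun_prop (disch := assumption))
  refine ⟨A, r, fun h => not_mem_self A ((hA A).2 h), fun x y => ?_⟩
  simp only [hr, pairFst_pair, pairSnd_pair, (isUniv_univ A).pair_mem_iff, and_iff_right_iff_imp]
  have hmem : ∀ {z}, X.mem z → z ∈ᴹ univ A := fun hz =>
    (isUniv_univ A).mem_of_mem (mem_univ_self A) ((hA _).2 hz)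
  rintro ⟨hx, ⟨hy, -⟩ | rfl⟩
  · exact ⟨hmem hx, hmem hy⟩
  · exact ⟨hmem hx, mem_univ_self y⟩

theorem AxiomBeta.exists_collapse (hbeta : AxiomBeta M) (hX : SmallLinear X) (hwf : X.IsWF) :
    ∃ f, ∀ y, X.mem y → ∀ z, z ∈ᴹ app f y ↔ ∃ x, X.mem x ∧ X.lt x y ∧ z = app f x := by
  obtain ⟨A, r, hA, hr⟩ := hX.exists_rel
  have hr_mem : ∀ {x y}, X.mem y → (pair x y ∈ᴹ r ↔ X.mem x ∧ X.lt x y) := fun {x y} hy => by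
    have hyA : y ≠ A := fun heq => hA (heq ▸ hy)
    simp only [hr, hy, hyA, true_and, or_false]
  have hr_wf : WFRel r := by
    intro s ⟨y, hy⟩
    obtain ⟨t, ht⟩ := exists_sep s hX.pr_mem
    by_cases h : ∃ x, x ∈ᴹ t
    · obtain ⟨m, hm, hmin⟩ := hwf t h fun x hx => ((ht x).1 hx).2
      obtain ⟨hms, hmX⟩ := (ht m).1 hm
      refine ⟨m, hms, fun x hx hxm => ?_⟩
      obtain ⟨hxX, hlt⟩ := (hr_mem hmX).1 hxm
      exact hmin x ((ht x).2 ⟨hx, hxX⟩) hlt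
    · exact ⟨y, hy, fun x hx hxy => h ⟨x, (ht x).2 ⟨hx, ((hr x y).1 hxy).1⟩⟩⟩
  obtain ⟨B, f, hB, -, hf⟩ := hbeta r hr_wf
  refine ⟨f, fun y hy z => ?_⟩
  rw [hf y ((hB y).2 ⟨A, .inl ((hr y A).2 ⟨hy, .inr rfl⟩)⟩)]
  simp only [hr_mem hy, and_assoc]

theorem AxiomBeta.exists_orderType (hbeta : AxiomBeta M) (hX : SmallLinear X) (hwf : X.IsWF) :
    ∃ Ω f, IsOrd Ω ∧ X.IsEmbedding (ordOrder Ω) (app f) ∧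
      ∀ α, α ∈ᴹ Ω → ∃ x, X.mem x ∧ α = app f x := by
  obtain ⟨f, hf⟩ := hbeta.exists_collapse hX hwf
  obtain ⟨A, hA⟩ := hX.exists_set
  obtain ⟨Ω, hΩ⟩ := exists_image A (F := app f) (by fun_prop)
  simp only [hA] at hΩ
  refine ⟨Ω, f, ⟨fun α hα β hβ => ?_, fun α hα β hβ γ hγ => ?_⟩,
    ⟨fun hx => (hΩ _).2 ⟨_, hx, rfl⟩, fun hx hy hxy => (hf _ hy _).2 ⟨_, hx, hxy, rfl⟩⟩,
    fun α hα => (hΩ α).1 hα⟩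
  · obtain ⟨x, hx, rfl⟩ := (hΩ α).1 hα
    obtain ⟨y, hy, -, rfl⟩ := (hf x hx β).1 hβ
    exact (hΩ _).2 ⟨y, hy, rfl⟩
  · obtain ⟨x, hx, rfl⟩ := (hΩ α).1 hα
    obtain ⟨y, hy, hyx, rfl⟩ := (hf x hx β).1 hβ
    obtain ⟨z, hz, hzy, rfl⟩ := (hf y hy γ).1 hγ
    exact (hf x hx _).2 ⟨z, hz, hX.isLinear.trans hz hy hx hzy hyx, rfl⟩

theorem AxiomBeta.exists_isomorphism (hbeta : AxiomBeta M) (hX : SmallLinear X) (hwf : X.IsWF) :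
    ∃ Ω f g, IsOrd Ω ∧ X.IsEmbedding (ordOrder Ω) (app f) ∧ (ordOrder Ω).IsEmbedding X (app g) ∧
      (∀ x, X.mem x → app g (app f x) = x) ∧ ∀ α, α ∈ᴹ Ω → app f (app g α) = α := by
  obtain ⟨Ω, f, hΩ, hf, hsurj⟩ := hbeta.exists_orderType hX hwf
  obtain ⟨A, hA⟩ := hX.exists_set
  have hΩ_lin := isLinear_ordOrder hΩ
  obtain ⟨g, hg⟩ := exists_leftInverse A (F := app f) (by fun_prop) fun x y hx hy =>
    hf.inj hX.isLinear hΩ_lin ((hA x).1 hx) ((hA y).1 hy)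
  simp only [hA] at hg
  refine ⟨Ω, f, g, hΩ, hf, ⟨?_, ?_⟩, hg, ?_⟩
  · rintro _ hα
    obtain ⟨x, hx, rfl⟩ := hsurj _ hα
    rwa [hg x hx]
  · rintro _ _ hα hβ hαβ
    obtain ⟨x, hx, rfl⟩ := hsurj _ hα
    obtain ⟨y, hy, rfl⟩ := hsurj _ hβ
    rw [hg x hx, hg y hy]
    exact (hf.lt_iff hX.isLinear hΩ_lin hx hy).1 hαβ
  · rintro _ hα
    obtain ⟨x, hx, rfl⟩ := hsurj _ hα
    rw [hg x hx]

theorem Predil.IsTermOrder.exists_isPsiFixedPoint {D : Predil M} (hX : D.IsTermOrder X)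
    (hbeta : AxiomBeta M) (hwf : X.IsWF) : ∃ Ω, D.IsPsiFixedPoint Ω := by
  obtain ⟨Ω, f, g, hΩ, hf, hg, hgf, hfg⟩ := hbeta.exists_isomorphism hX.smallLinear hwf
  have hf_pr : IsPR M (app f) := by fun_prop
  have hg_pr : IsPR M (app g) := by fun_prop
  obtain ⟨J, hJ, hJ_image⟩ := exists_extImage hf_pr
  obtain ⟨π, hπ, hπ_eq⟩ := exists_fun Ω (F := fun α => J (app g α)) (by fun_prop)
  have hterm : ∀ {α}, α ∈ᴹ Ω → D.IsTerm X (app g α) := fun hα => (hX.mem_iff _).1 (hg.mem hα)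
  have hπ_image : ∀ {α}, α ∈ᴹ Ω → ExtImage (app f) (app g α) (app π α) := fun {α} hα => by
    obtain ⟨σ, a, n, e, heq, -⟩ := (hterm hα).1
    rw [hπ_eq α hα, heq]
    exact hJ_image σ a
  have hπ_mem : ∀ {α}, α ∈ᴹ Ω → (D.ext (ordOrder Ω)).mem (app π α) := fun hα =>
    hf.ext_mem hf_pr (hterm hα).1 (hπ_image hα)
  refine ⟨Ω, hΩ, π, hπ, fun α => hπ_mem, fun α β hα hβ hαβ => ?_, fun α β hα hβ hαβ => ?_,
    fun τ hτ hτ_gt => ?_⟩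
  · exact hf.ext_lt hf_pr (hterm hα).1 (hterm hβ).1 (hπ_image hα) (hπ_image hβ)
      ((hX.lt_iff (hg.mem hα) (hg.mem hβ)).1 (hg.lt hα hβ hαβ))
  · obtain ⟨x, hx, rfl⟩ := (hπ_image hβ).extSupp_iff.1 hαβ
    have hxX := mem_of_extSupp (hterm hβ).1 hx
    have := hf.lt hxX (hg.mem hβ) ((hX.lt_iff hxX (hg.mem hβ)).2 ((hterm hβ).2 x hx))
    rwa [hfg β hβ] at this
  · have hτΩ : ∀ {α}, extSupp τ α → α ∈ᴹ Ω := mem_of_extSupp (X := ordOrder Ω) hτ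
    obtain ⟨t, ht⟩ := exists_extImage_of_ext_mem hg_pr hτ
    have htX : X.mem t := by
      refine (hX.mem_iff t).2 ⟨hg.ext_mem hg_pr hτ ht, fun s hs => ?_⟩
      obtain ⟨α, hα, rfl⟩ := ht.extSupp_iff.1 hs
      have hgα := (hπ_image (hτΩ hα)).symm fun x hx => hgf x (mem_of_extSupp (hterm (hτΩ hα)).1 hx)
      exact hg.ext_lt hg_pr (hπ_mem (hτΩ hα)) hτ hgα ht (hτ_gt α hα)
    have hπt := hπ_image (hf.mem htX)
    rw [hgf t htX] at hπt
    exact ⟨app f t, hf.mem htX, hπt.unique (ht.symm fun α hα => hfg α (hτΩ hα))⟩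

end

namespace Predil

variable {M : Type u} [SetStructure M] [ModelsPRS M]

/-! ### Sums of limit length -/

theorem exists_ext_mem_shift_sum {D : M → Predil M} {l γ p : M} {X : ClassOrder M}
    (hl : IsLimitOrd l) (hp : (((sum (ordOrder l) D).shift γ).ext X).mem p) :
    ∃ μ, μ ∈ᴹ l ∧ (((sum (ordOrder μ) D).shift γ).ext X).mem p := by
  obtain ⟨q, b, n, e, rfl, he, hn, ⟨s, a, k, e', rfl, he', hk, ⟨α, σ, rfl, hα, hσ⟩, hs⟩, hq⟩ := hp
  obtain ⟨μ, hμ, hαμ⟩ := hl.2.2 α hα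
  exact ⟨μ, hμ, _, b, n, e, rfl, he, hn, ⟨_, a, k, e', rfl, he', hk, sum_el.2 ⟨hαμ, hσ⟩,
    fun i hi => sum_supp.2 ⟨hαμ, (sum_supp.1 (hs i hi)).2⟩⟩, hq⟩

theorem exists_isOrdSup_isPsiFixedPoint {I : M → Prop} {E : M → Predil M} {D : Predil M}
    (hbeta : AxiomBeta M) (hD : D.IsWeakPredilator) (hdefD : D.IsDefinable)
    (hE : ∀ μ, I μ → (E μ).IsWeakPredilator) (hdefE : ∀ μ, I μ → (E μ).IsDefinable)
    (hED : ∀ μ, I μ → (E μ).IsInitial D)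
    (hcover : ∀ X p, (D.ext X).mem p → ∃ μ, I μ ∧ ((E μ).ext X).mem p)
    (hex : ∀ μ, I μ → ∃ β, (E μ).IsPsiFixedPoint β) :
    ∃ Ω, IsOrdSup (fun β => ∃ μ, I μ ∧ (E μ).IsPsiFixedPoint β) Ω ∧ D.IsPsiFixedPoint Ω := by
  obtain ⟨X, hX⟩ := exists_isTermOrder hD hdefD
  obtain ⟨Ω, hΩ⟩ := hX.exists_isPsiFixedPoint hbeta
    (hX.isWF hD hE hED hdefE (hcover X) hex)
  exact ⟨Ω, hΩ.isOrdSup hD hE hED (hcover _) hex, hΩ⟩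

end Predil

end ATRSet

open ATRSet in
theorem mainTheorem9_general {M : Type u} [SetStructure M] [ModelsPRS M] (hbeta : AxiomBeta M)
    {l γ : M} {D : M → Predil M} (hl : IsLimitOrd l) (hγ : IsOrd γ) (hdef : IsPRPredil D)
    (hD : ∀ α, α ∈ᴹ l → (D α).IsWeakPredilator)
    (hex : ∀ μ, μ ∈ᴹ l → ∃ β, ((Predil.sum (ordOrder μ) D).shift γ).IsPsiFixedPoint β) :
    ∃ Ω, IsOrdSup
        (fun β => ∃ μ, μ ∈ᴹ l ∧ ((Predil.sum (ordOrder μ) D).shift γ).IsPsiFixedPoint β) Ω ∧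
      ((Predil.sum (ordOrder l) D).shift γ).IsPsiFixedPoint Ω ∧
      ∀ Ω', ((Predil.sum (ordOrder l) D).shift γ).IsPsiFixedPoint Ω' → Ω' = Ω := by
  have hsum : ∀ {μ}, IsOrd μ → (∀ α, α ∈ᴹ μ → α ∈ᴹ l) →
      (Predil.sum (ordOrder μ) D).IsWeakPredilator := fun hμ hμl =>
    .sum (isLinear_ordOrder hμ) fun α hα => hD α (hμl α hα)
  have hsum_l := hsum hl.1 fun _ => id
  have hsum_μ : ∀ μ, μ ∈ᴹ l → (Predil.sum (ordOrder μ) D).IsWeakPredilator := fun μ hμ =>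
    hsum (hl.1.mem hμ) (hl.1.1 μ hμ)
  have hdef_sum : ∀ {μ}, IsOrd μ → ((Predil.sum (ordOrder μ) D).shift γ).IsDefinable := fun hμ =>
    (Predil.isDefinable_sum (smallLinear_ordOrder hμ) hdef).shift γ
  obtain ⟨Ω, hsup, hΩ⟩ := Predil.exists_isOrdSup_isPsiFixedPoint (I := (· ∈ᴹ l)) hbeta
    (hsum_l.shift hγ) (hdef_sum hl.1) (fun μ hμ => (hsum_μ μ hμ).shift hγ)
    (fun μ hμ => hdef_sum (hl.1.mem hμ))
    (fun μ hμ => (Predil.isInitial_sum (ordOrder_isInitial hl.1 hμ)).shift (hsum_μ μ hμ) hsum_l hγ)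
    (fun X p => Predil.exists_ext_mem_shift_sum hl) hex
  exact ⟨Ω, hsup, hΩ, fun Ω' hΩ' => hΩ'.unique hΩ (hsum_l.shift hγ)⟩

theorem mainTheorem9 {M : Type*} [ATRSet.SetStructure M] (hM : ATRSet.ModelsATR0Set M)
    (lam γ D : M) (hlam : ATRSet.IsLimitOrd lam) (hγ : ATRSet.IsOrd γ)
    (hD : ATRSet.IsFunOn D lam)
    (hdil : ∀ α, α ∈ᴹ lam → ATRSet.Predil.IsDilatorCode (ATRSet.app D α))
    (hex : ∀ μ, μ ∈ᴹ lam → ∃ β, (ATRSet.Predil.shiftedSum D μ γ).IsPsiFixedPoint β) :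
    ∃ Ω : M,
      ATRSet.IsOrdSup
        (fun β => ∃ μ, μ ∈ᴹ lam ∧ (ATRSet.Predil.shiftedSum D μ γ).IsPsiFixedPoint β) Ω ∧
      (ATRSet.Predil.shiftedSum D lam γ).IsPsiFixedPoint Ω ∧
      ∀ Ω', (ATRSet.Predil.shiftedSum D lam γ).IsPsiFixedPoint Ω' → Ω' = Ω := by
  have := hM.modelsPRS
  exact mainTheorem9_general hM.beta hlam hγ (ATRSet.Predil.isPRPredil_ofCode (by fun_prop))
    (fun α hα => (hdil α hα).2.1.isWeakPredilator) hex
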